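/- Let $A$ be a finite alphabet and let $\sigma$ be the shift map on $A^{\mathbb N}$, $(\sigma x)_n = x_{n+1}$. A subshift is a nonempty closed set $X \subset A^{\mathbb N}$ with $\sigma(X)\subset X$. For a word $w$ of length $|w|$ let $[w]$ be the set of points of $X$ that begin with $w$, let $\mathcal L(X)$ be the set of words $w$ with $[w]\neq\emptyset$ (the words that appear in $X$), and let $\mathcal L_n(X)$ be the set of words of length $n$ in $\mathcal L(X)$. For $\varphi\colon X\to\mathbb R$ continuous put $S_n\varphi = \sum_{k=0}^{n-1}\varphi\circ\sigma^k$, $\varphi_n(w)=\sup_{x\in[w]} S_n\varphi(x)$ for $w\in\mathcal L_n(X)$, and $$P(X,\varphi)=\limsup_{n\to\infty}\frac1n\log\sum_{w\in\mathcal L_n(X)}e^{\varphi_n(w)} .$$ For a subshift $Y\subset X$, $P(Y,\varphi)$ is the pressure of $\varphi|_Y$ on $Y$. An equilibrium state of $\varphi$ is a $\sigma$-invariant Borel probability measure $\mu$ on $X$ that maximises $h(\mu)+\int\varphi\,d\mu$ among all such measures, where $h$ is the Kolmogorov–Sinai entropy. Let $\mathrm{Per}_n=\{x\in X : \sigma^n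 x=x\}$. $X$ has specification if there is $t\in\mathbb N$ such that for all $m\ge1$ and $w^1,\dots,w^m\in\mathcal L(X)$ there are $v^1,\dots,v^{m-1}\in\mathcal L(X)$, all of length exactly $t$, with $w^1v^1w^2\cdots v^{m-1}w^m\in\mathcal L(X)$. A continuous function $\varphi$ on $X$ is Bowen if $\sup\{|S_n\varphi(x)-S_n\varphi(y)| : n\in\mathbb N,\ w\in\mathcal L_n(X),\ x,y\in[w]\}<\infty$. Let $\mathcal F(X,Y)$ be the set of words $w\in\mathcal L(X)\setminus\mathcal L(Y)$ that lie in $\mathcal L(Y)$ after removal of the last letter, and let $\mathcal P(X,Y)=\{[w]: w\in\mathcal F(X,Y)\}\cup\{Y\}$, a partition of $X$. A grid function for $\mathcal P(X,Y)$ is a function $\varphi_0=\sum_{w\in\mathcal F(X,Y)}a_w\mathbf 1_{[w]}$ on $X$ with real numbers $a_w$ such that $\max\{|a_w| : w\in\mathcal F(X,Y),\ |w|=n\}\to0$ as $n\to\infty$ (a maximum over the empty set being $0$). For $\ell\ge0$ let $\mathcal G^\ell$ consist of the empty word and of the words in $\mathcal L(X)$ of length at least $\ell$ whose last $\ell$ letters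 form a word not in $\mathcal L(Y)$; let $\mathcal C^{s,\ell}$ consist of the words in $\mathcal L(X)$ all of whose subwords of length $\ell$ lie in $\mathcal L(Y)$; and for $M\in\mathbb N$ let $\mathcal G^\ell(M)$ be the set of words in $\mathcal L(X)$ of the form $uv$ with $u\in\mathcal G^\ell$, $v\in\mathcal C^{s,\ell}$ and $|v|\le M$. **Theorem.** Let $X\subset A^{\mathbb N}$ be a subshift with specification, let $Y\subset X$ be any subshift, and let $\varphi=\varphi_r+\varphi_0$, where $\varphi_r$ is continuous and Bowen on $X$ and $\varphi_0$ is a grid function for $\mathcal P(X,Y)$. If $P(Y,\varphi)<P(X,\varphi)$, then $\varphi$ has a unique equilibrium state $\mu$. Moreover: 1. (weak Gibbs property) for every $\ell\ge0$, every word of $\mathcal L(X)$ is of the form $uv$ with $u\in\mathcal G^\ell$, $v\in\mathcal C^{s,\ell}$, and there are constants $K'>0$ and $K_M>0$ ($M\in\mathbb N$) such that for all $M,n\in\mathbb N$ and all $w\in\mathcal G^\ell(M)$ of length $n$, $$K_M\le\frac{\mu([w])}{e^{-nP(X,\varphi)+\varphi_n(w)}}\le K' ;$$ 2. $\mu$ is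 the weak* limit, as $n\to\infty$, of the periodic orbit measures $$\frac1{\sum_{x\in\mathrm{Per}_n}e^{S_n\varphi(x)}}\sum_{x\in\mathrm{Per}_n}e^{S_n\varphi(x)}\,\delta_x .$$ -/

import Mathlib

open Filter Topology MeasureTheory

noncomputable section

namespace SymbolicDynamics

variable {A : Type*}

/-- The shift map on one-sided sequences. -/
def shift (x : ℕ → A) : ℕ → A := fun n => x (n + 1)

/-- A (one-sided) subshift: a nonempty closed set of sequences that the shift maps into itself. -/
structure IsSubshift [TopologicalSpace A] (X : Set (ℕ → A)) : Prop where
  nonempty : X.Nonempty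
  isClosed : IsClosed X
  mapsTo : Set.MapsTo shift X X

/-- The cylinder `[w]` in `X`: the points of `X` that begin with the word `w`. -/
def cylinder (X : Set (ℕ → A)) (w : List A) : Set (ℕ → A) :=
  {x | x ∈ X ∧ ∀ i : Fin w.length, x i = w.get i}

/-- The language of `X`: the words with nonempty cylinder. For a shift-invariant `X` these are
the words that appear in some point of `X`. -/
def language (X : Set (ℕ → A)) : Set (List A) :=
  {w | (cylinder X w).Nonempty}

/-- `φ_n(w) = sup_{x ∈ [w]} S_n φ(x)`, where `n = |w|`. -/
def supBirkhoff (X : Set (ℕ → A)) (φ : (ℕ → A) → ℝ) (w : List A) : ℝ :=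
  sSup (birkhoffSum shift φ w.length '' cylinder X w)

/-- `Λ_n(𝓓, φ) = ∑_{w ∈ 𝓓_n} exp (φ_n(w))`, a finite sum for a finite alphabet. -/
def partitionSum (X : Set (ℕ → A)) (D : Set (List A)) (φ : (ℕ → A) → ℝ) (n : ℕ) : ℝ :=
  ∑ᶠ w ∈ {w : List A | w ∈ D ∧ w.length = n}, Real.exp (supBirkhoff X φ w)

/-- The topological pressure `P(X, φ) = limsup (1/n) log Λ_n(𝓛(X), φ)`. For a subshift over a
finite alphabet and a potential continuous on `X`, the sequence is bounded. -/
def pressure (X : Set (ℕ → A)) (φ : (ℕ → A) → ℝ) : ℝ :=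
  limsup (fun n : ℕ => Real.log (partitionSum X (language X) φ n) / n) atTop

/-- (S)-specification on `G` with gap size `t`: words `w⁰, …, wᵐ` of `G` can be joined by words
`v⁰, …, vᵐ⁻¹` of the language, all of length `t`, to a word `w⁰ v⁰ w¹ v¹ ⋯ vᵐ⁻¹ wᵐ` of the
language. -/
def SpecificationOn (X : Set (ℕ → A)) (G : Set (List A)) (t : ℕ) : Prop :=
  ∀ (m : ℕ) (w : Fin (m + 1) → List A), (∀ i, w i ∈ G) →
    ∃ v : Fin m → List A, (∀ i, v i ∈ language X ∧ (v i).length = t) ∧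
      w 0 ++ (List.ofFn fun i : Fin m => v i ++ w i.succ).flatten ∈ language X

/-- The specification property of a shift: (S)-specification on its whole language, for some
gap size. -/
def HasSpecification (X : Set (ℕ → A)) : Prop :=
  ∃ t : ℕ, SpecificationOn X (language X) t

/-- The Bowen property of `φ` on a collection `G` of words: the variation of `S_n φ` on the
cylinder of a word of length `n` in `G` is bounded uniformly in the word and in `n`. -/
def HasBowenProperty (X : Set (ℕ → A)) (G : Set (List A)) (φ : (ℕ → A) → ℝ) : Prop :=
  ∃ V : ℝ, ∀ w ∈ G, ∀ x ∈ cylinder X w, ∀ y ∈ cylinder X w,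
    |birkhoffSum shift φ w.length x - birkhoffSum shift φ w.length y| ≤ V

/-- The minimal forbidden words `𝓕(X, Y)`: words of `𝓛(X) ∖ 𝓛(Y)` that lie in `𝓛(Y)` once the
last letter is removed. -/
def minimalForbidden (X Y : Set (ℕ → A)) : Set (List A) :=
  {w | w ∈ language X ∧ w ∉ language Y ∧ w.dropLast ∈ language Y}

/-- Grid functions for the partition of `X` into `Y` and the cylinders `[w]`, `w ∈ 𝓕(X, Y)`:
`φ₀ = ∑_w a_w 1_{[w]}` on `X`, with `max_{w ∈ 𝓕(X, Y)_n} |a_w| → 0`. -/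
def IsGridFunction (X Y : Set (ℕ → A)) (φ₀ : (ℕ → A) → ℝ) : Prop :=
  ∃ a : List A → ℝ,
    (∀ ε > 0, ∃ N : ℕ, ∀ w ∈ minimalForbidden X Y, N ≤ w.length → |a w| < ε) ∧
    ∀ x ∈ X, φ₀ x =
      ∑' w : minimalForbidden X Y, (cylinder X (w : List A)).indicator (fun _ => a w) x

/-- The class `𝓐(X, Y)` of potentials `φ = φ_r + φ₀` on `X` with `φ_r` continuous with the Bowen
property and `φ₀` a grid function. -/
def IsBowenPlusGrid [TopologicalSpace A] (X Y : Set (ℕ → A)) (φ : (ℕ → A) → ℝ) : Prop :=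
  ∃ φr φ₀ : (ℕ → A) → ℝ, ContinuousOn φr X ∧ HasBowenProperty X (language X) φr ∧
    IsGridFunction X Y φ₀ ∧ ∀ x ∈ X, φ x = φr x + φ₀ x

/-- The Shannon entropy of the join of `ξ, T⁻¹ξ, …, T⁻⁽ⁿ⁻¹⁾ξ`, where a finite partition is given
by the map `ξ` that sends a point to the index of its cell. -/
def joinEntropy {Ω : Type*} [MeasurableSpace Ω] (T : Ω → Ω) (μ : Measure Ω) {k : ℕ}
    (ξ : Ω → Fin k) (n : ℕ) : ℝ :=
  ∑ s : Fin n → Fin k, Real.negMulLog (μ.real {x | ∀ i : Fin n, ξ (T^[i] x) = s i})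

/-- The measure-theoretic (Kolmogorov–Sinai) entropy: the supremum over all finite measurable
partitions of the asymptotic entropy rate. -/
def measureEntropy {Ω : Type*} [MeasurableSpace Ω] (T : Ω → Ω) (μ : Measure Ω) : EReal :=
  ⨆ (k : ℕ) (ξ : Ω → Fin k) (_ : Measurable ξ),
    limsup (fun n : ℕ => ((joinEntropy T μ ξ n / n : ℝ) : EReal)) atTop

/-- The shift-invariant Borel probability measures on `X`, as measures on the full shift that are
concentrated on `X`. -/
def invariantMeasures [MeasurableSpace A] (X : Set (ℕ → A)) : Set (Measure (ℕ → A)) :=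
  {μ | IsProbabilityMeasure μ ∧ μ Xᶜ = 0 ∧ MeasurePreserving shift μ μ}

/-- `h(μ) + ∫ φ dμ`. -/
def freeEnergy [MeasurableSpace A] (φ : (ℕ → A) → ℝ) (μ : Measure (ℕ → A)) : EReal :=
  measureEntropy shift μ + ((∫ x, φ x ∂μ : ℝ) : EReal)

/-- An equilibrium state: an invariant probability measure on `X` that maximises
`h(μ) + ∫ φ dμ`. -/
def IsEquilibriumState [MeasurableSpace A] (X : Set (ℕ → A)) (φ : (ℕ → A) → ℝ)
    (μ : Measure (ℕ → A)) : Prop :=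
  μ ∈ invariantMeasures X ∧ ∀ ν ∈ invariantMeasures X, freeEnergy φ ν ≤ freeEnergy φ μ

/-- A decomposition `𝓒ᵖ 𝓖 𝓒ˢ = 𝓛` of the language of `X`. -/
def IsDecomposition (X : Set (ℕ → A)) (Cp G Cs : Set (List A)) : Prop :=
  Cp ⊆ language X ∧ G ⊆ language X ∧ Cs ⊆ language X ∧
    ∀ w ∈ language X, ∃ u ∈ Cp, ∃ v ∈ G, ∃ z ∈ Cs, w = u ++ v ++ z

/-- The fattened collection `𝓖(M)`: words of the language with a good core, and a prefix and a
suffix of length at most `M`. -/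
def fattened (X : Set (ℕ → A)) (Cp G Cs : Set (List A)) (M : ℕ) : Set (List A) :=
  {w | w ∈ language X ∧ ∃ u ∈ Cp, ∃ v ∈ G, ∃ z ∈ Cs,
    u.length ≤ M ∧ z.length ≤ M ∧ w = u ++ v ++ z}

/-- The weak Gibbs property of `μ` with respect to a decomposition: the upper bound has a
constant valid for all words, the lower bound a constant for each `𝓖(M)`. -/
def IsWeakGibbs [MeasurableSpace A] (X : Set (ℕ → A)) (φ : (ℕ → A) → ℝ) (Cp G Cs : Set (List A))
    (μ : Measure (ℕ → A)) : Prop :=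
  ∃ K' > (0 : ℝ), ∀ M : ℕ, ∃ K > (0 : ℝ), ∀ w ∈ fattened X Cp G Cs M,
    K ≤ μ.real (cylinder X w) /
        Real.exp (-(w.length * pressure X φ) + supBirkhoff X φ w) ∧
    μ.real (cylinder X w) /
        Real.exp (-(w.length * pressure X φ) + supBirkhoff X φ w) ≤ K'

/-- The collection `𝓖^ℓ` of good words: the words of `𝓛(X)` whose last `ℓ` letters form a word
that is not in `𝓛(Y)`, and the empty word. -/
def goodWords (X Y : Set (ℕ → A)) (l : ℕ) : Set (List A) :=
  {w | w ∈ language X ∧ (w = [] ∨ l ≤ w.length ∧ w.drop (w.length - l) ∉ language Y)}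

/-- The collection `𝓒^{s,ℓ}` of suffixes: the words of `𝓛(X)` all of whose subwords of length `ℓ`
are in `𝓛(Y)`. -/
def suffixWords (X Y : Set (ℕ → A)) (l : ℕ) : Set (List A) :=
  {w | w ∈ language X ∧ ∀ u : List A, u <:+: w → u.length = l → u ∈ language Y}

/-- `Per_n`, the points of `X` fixed by the `n`-th power of the shift. -/
def periodicPoints (X : Set (ℕ → A)) (n : ℕ) : Set (ℕ → A) :=
  {x | x ∈ X ∧ shift^[n] x = x}

/-- The periodic orbit measure
`(∑_{x ∈ Per_n} exp (S_n φ(x)))⁻¹ ∑_{x ∈ Per_n} exp (S_n φ(x)) δ_x`. -/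
def periodicMeasure [MeasurableSpace A] (X : Set (ℕ → A)) (φ : (ℕ → A) → ℝ) (n : ℕ) :
    Measure (ℕ → A) :=
  (∑' x : periodicPoints X n, ENNReal.ofReal (Real.exp (birkhoffSum shift φ n x)))⁻¹ •
    Measure.sum fun x : periodicPoints X n =>
      ENNReal.ofReal (Real.exp (birkhoffSum shift φ n x)) • Measure.dirac (x : ℕ → A)

/-- Weak* convergence of measures concentrated on `X`: convergence of the integrals of all
continuous functions on `X`. -/
def WeakStarTendsto [TopologicalSpace A] [MeasurableSpace A] (X : Set (ℕ → A))
    (ν : ℕ → Measure (ℕ → A)) (μ : Measure (ℕ → A)) : Prop :=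
  ∀ f : (ℕ → A) → ℝ, ContinuousOn f X →
    Tendsto (fun n => ∫ x, f x ∂(ν n)) atTop (𝓝 (∫ x, f x ∂μ))

end SymbolicDynamics

end

open SymbolicDynamics

/-! A grid function is constant on the cylinder of each minimal forbidden word. Along a word that
ends in a block outside `𝓛(Y)`, its Birkhoff sum is therefore determined up to the last `ℓ` terms,
and `S_n φ` has bounded variation on the cylinders of good words
(`goodWords_subset_boundedVariationWords`). Every other word is a good word followed by a suffix
made of blocks of `Y`. Since `P(Y, φ) < P(X, φ) = P`, for a suitable `ℓ` these suffixes grow at a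
rate below `P` (`exists_partitionSum_suffixWords_le`).

Specification makes the partition sums of good words supermultiplicative up to a constant, hence
`O(exp (n P))`. Convolution with the suffixes gives the same bound for the whole language, and shows
that words of variation above `V` carry a proportion that tends to `0` as `V` grows, uniformly in
the length (`exists_partitionSum_le`).

Specification also yields a synchronizing word, and with it periodic points with prescribed
beginnings. Counting them shows that every limit of the periodic orbit measures is invariant, with
an upper Gibbs bound on all words and a lower one on words of bounded variation
(`exists_tendsto_periodicMeasure`).

The upper bound makes such a limit an equilibrium state. The lower bound, through a relative entropy
estimate, makes every equilibrium state absolutely continuous with respect to it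
(`IsGibbs.absolutelyContinuous`), and gluing makes it ergodic (`IsGibbs.ergodic`). So the
equilibrium state is unique, all limits of periodic measures coincide with it, and the periodic
measures converge. -/

namespace SymbolicDynamics

/-! ### Words, cylinders and the language -/

section Words

variable {A : Type*} {X : Set (ℕ → A)}

/-- The word formed by the first `n` letters of `x`. -/
def initialWord (x : ℕ → A) (n : ℕ) : List A := (List.range n).map x

@[simp] lemma length_initialWord (x : ℕ → A) (n : ℕ) : (initialWord x n).length = n := by
  simp [initialWord]

@[simp] lemma initialWord_zero (x : ℕ → A) : initialWord x 0 = [] := rfl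

lemma shift_iterate_apply (x : ℕ → A) (k n : ℕ) : (shift^[k] x) n = x (k + n) := by
  induction k generalizing x with
  | zero => simp
  | succ k ih =>
    rw [Function.iterate_succ_apply, ih, shift]
    congr 1
    omega

lemma initialWord_add (x : ℕ → A) (m n : ℕ) :
    initialWord x (m + n) = initialWord x m ++ initialWord (shift^[m] x) n := by
  simp only [initialWord, List.range_add, List.map_append, List.map_map]
  congr 1
  apply List.map_congr_left
  intro i _
  simp [shift_iterate_apply]

lemma initialWord_eq_iff {x y : ℕ → A} {n : ℕ} :
    initialWord x n = initialWord y n ↔ ∀ i < n, x i = y i := by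
  simp [initialWord]

lemma initialWord_eq_of_le {x y : ℕ → A} {m n : ℕ} (h : initialWord x n = initialWord y n)
    (hmn : m ≤ n) : initialWord x m = initialWord y m := by
  rw [initialWord_eq_iff] at *
  exact fun i hi => h i (hi.trans_le hmn)

lemma initialWord_shift_eq_of_le {x y : ℕ → A} {k m n : ℕ} (h : initialWord x n = initialWord y n)
    (hmn : k + m ≤ n) :
    initialWord (shift^[k] x) m = initialWord (shift^[k] y) m := by
  rw [initialWord_eq_iff] at *
  intro i hi
  rw [shift_iterate_apply, shift_iterate_apply]
  exact h _ (by omega)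

lemma mem_cylinder_iff {w : List A} {x : ℕ → A} :
    x ∈ cylinder X w ↔ x ∈ X ∧ initialWord x w.length = w := by
  refine and_congr_right fun _ => ⟨fun h => ?_, fun h i => ?_⟩
  · apply List.ext_getElem (by simp)
    intro i h1 h2
    simpa [initialWord] using h ⟨i, h2⟩
  · have : (initialWord x w.length)[(i : ℕ)]'(by simp) = w[(i : ℕ)] := by
      congr 1
    simpa [initialWord] using this

lemma mem_cylinder_initialWord {x : ℕ → A} (hx : x ∈ X) (n : ℕ) :
    x ∈ cylinder X (initialWord x n) := by
  rw [mem_cylinder_iff]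
  simpa using hx

lemma initialWord_append_iff {u v : List A} {x : ℕ → A} :
    initialWord x (u ++ v).length = u ++ v ↔
      initialWord x u.length = u ∧ initialWord (shift^[u.length] x) v.length = v := by
  rw [List.length_append, initialWord_add]
  constructor
  · intro h
    exact List.append_inj h (by simp)
  · rintro ⟨h1, h2⟩
    rw [h1, h2]

lemma mem_language_iff {w : List A} :
    w ∈ language X ↔ ∃ x ∈ X, initialWord x w.length = w := by
  simp only [language, Set.mem_ofPred_eq, Set.Nonempty, mem_cylinder_iff]

lemma initialWord_mem_language {x : ℕ → A} (hx : x ∈ X) (n : ℕ) :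
    initialWord x n ∈ language X := ⟨x, mem_cylinder_initialWord hx n⟩

lemma mem_language_left {u v : List A} (h : u ++ v ∈ language X) : u ∈ language X := by
  obtain ⟨x, hx, hw⟩ := mem_language_iff.1 h
  exact mem_language_iff.2 ⟨x, hx, (initialWord_append_iff.1 hw).1⟩

variable [TopologicalSpace A]

lemma IsSubshift.iterate_mem (hX : IsSubshift X) {x : ℕ → A} (hx : x ∈ X) (k : ℕ) :
    shift^[k] x ∈ X := hX.mapsTo.iterate k hx

lemma IsSubshift.mem_language_right (hX : IsSubshift X) {u v : List A}
    (h : u ++ v ∈ language X) : v ∈ language X := by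
  obtain ⟨x, hx, hw⟩ := mem_language_iff.1 h
  exact mem_language_iff.2 ⟨_, hX.iterate_mem hx u.length, (initialWord_append_iff.1 hw).2⟩

lemma IsSubshift.nil_mem_language (hX : IsSubshift X) : [] ∈ language X := by
  obtain ⟨x, hx⟩ := hX.nonempty
  exact initialWord_mem_language hx 0

lemma continuous_shift : Continuous (shift : (ℕ → A) → ℕ → A) :=
  continuous_pi fun n => continuous_apply (n + 1)

/-- A point all of whose initial words belong to the language of a subshift belongs to it. -/
lemma IsSubshift.mem_of_initialWord_mem [DiscreteTopology A] (hX : IsSubshift X) {x : ℕ → A}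
    (h : ∀ n, ∃ m, n ≤ m ∧ initialWord x m ∈ language X) : x ∈ X := by
  choose m hm hw using h
  have : ∀ n, ∃ y ∈ X, initialWord y (m n) = initialWord x (m n) := by
    intro n
    obtain ⟨y, hy, h⟩ := mem_language_iff.1 (hw n)
    exact ⟨y, hy, by simpa using h⟩
  choose y hy hyx using this
  refine hX.isClosed.mem_of_tendsto (b := atTop) (f := y) ?_ (Eventually.of_forall hy)
  rw [tendsto_pi_nhds]
  intro i
  rw [nhds_discrete, tendsto_pure]
  filter_upwards [eventually_gt_atTop i] with n hn
  exact initialWord_eq_iff.1 (hyx n) i (hn.trans_le (hm n))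

/-- A continuous function on sequences is determined up to `ε` by a finite number of letters. -/
lemma exists_initialWord_dist_lt [Finite A] [DiscreteTopology A] {f : (ℕ → A) → ℝ}
    (hf : Continuous f) {ε : ℝ} (hε : 0 < ε) :
    ∃ N : ℕ, ∀ x y : ℕ → A, initialWord x N = initialWord y N → |f x - f y| < ε := by
  by_contra! hcon
  choose x y hxy hf' using hcon
  -- Along a nonprincipal ultrafilter `x` has a limit. The sequence `y` agrees with `x` on more and
  -- more letters, so it has the same limit, against continuity.
  obtain ⟨x₀, -, hx₀⟩ := isCompact_univ.ultrafilter_le_nhds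
    ((Ultrafilter.map x (hyperfilter ℕ))) (by simp)
  have htop : ((hyperfilter ℕ : Ultrafilter ℕ) : Filter ℕ) ≤ atTop := Nat.hyperfilter_le_atTop
  have hx : Tendsto x (hyperfilter ℕ) (𝓝 x₀) := hx₀
  have hy : Tendsto y (hyperfilter ℕ) (𝓝 x₀) := by
    rw [tendsto_pi_nhds] at hx ⊢
    intro i
    refine (hx i).congr' ?_
    filter_upwards [htop (eventually_gt_atTop i)] with n hn
    exact initialWord_eq_iff.1 (hxy n) i hn
  have h0 := (((hf.tendsto x₀).comp hx).sub ((hf.tendsto x₀).comp hy)).abs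
  simp only [sub_self, abs_zero] at h0
  have := (h0.eventually (gt_mem_nhds hε)).and (Eventually.of_forall hf')
  obtain ⟨n, h1, h2⟩ := this.exists
  simp only [Function.comp_apply] at h1
  linarith

end Words

/-! ### Synchronizing words and periodic points -/

section Specification

variable {A : Type*} {X : Set (ℕ → A)}

lemma SpecificationOn.pair {G : Set (List A)} {t : ℕ} (h : SpecificationOn X G t) {w u : List A}
    (hw : w ∈ G) (hu : u ∈ G) : ∃ v : List A, v.length = t ∧ w ++ v ++ u ∈ language X := by
  obtain ⟨v, hv, hm⟩ := h 1 ![w, u] (by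
    intro i
    fin_cases i
    · exact hw
    · exact hu)
  exact ⟨v 0, (hv 0).2, by simpa using hm⟩

/-- A subshift with specification has a synchronizing word. -/
lemma exists_synchronizing_word [Finite A] [TopologicalSpace A] (hX : IsSubshift X) {t : ℕ}
    (h : SpecificationOn X (language X) t) :
    ∃ s ∈ language X, ∀ p q : List A, p ++ s ∈ language X → s ++ q ∈ language X →
      p ++ s ++ q ∈ language X := by
  classical
  -- The connecting words from `a` to `b`. Extending `a` to the left and `b` to the right can only
  -- lose some of them; for a pair with the fewest, none is lost, so every connecting word `v` makes
  -- `a v b` synchronizing.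
  let C : List A → List A → Set (List A) := fun a b =>
    {v | v.length = t ∧ a ++ v ++ b ∈ language X}
  have hfin : ∀ a b, (C a b).Finite := fun a b =>
    (List.finite_length_eq A t).subset fun v hv => hv.1
  have hex : ∃ n, ∃ a ∈ language X, ∃ b ∈ language X, (C a b).ncard = n :=
    ⟨_, [], hX.nil_mem_language, [], hX.nil_mem_language, rfl⟩
  obtain ⟨a, ha, b, hb, hab⟩ := Nat.find_spec hex
  obtain ⟨v, hv, hs⟩ := h.pair ha hb
  refine ⟨a ++ v ++ b, hs, fun p q hp hq => ?_⟩
  have hpa : p ++ a ∈ language X := by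
    apply mem_language_left (v := v ++ b)
    simpa using hp
  have hbq : b ++ q ∈ language X := by
    apply hX.mem_language_right (u := a ++ v)
    simpa using hq
  have hsub : C (p ++ a) (b ++ q) ⊆ C a b := by
    rintro z ⟨hz, hm⟩
    refine ⟨hz, hX.mem_language_right (u := p) (mem_language_left (v := q) ?_)⟩
    simpa using hm
  have heq : C (p ++ a) (b ++ q) = C a b := by
    apply Set.eq_of_subset_of_ncard_le hsub _ (hfin a b)
    rw [hab]
    exact Nat.find_min' hex ⟨_, hpa, _, hbq, rfl⟩
  have : v ∈ C (p ++ a) (b ++ q) := by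
    rw [heq]
    exact ⟨hv, hs⟩
  simpa using this.2

/-- The periodic sequence obtained by repeating a word. -/
def repeatWord (w : List A) (hw : w ≠ []) : ℕ → A := fun i =>
  w[i % w.length]'(Nat.mod_lt _ (List.length_pos_iff.2 hw))

lemma shift_iterate_repeatWord (w : List A) (hw : w ≠ []) :
    shift^[w.length] (repeatWord w hw) = repeatWord w hw := by
  funext i
  simp [shift_iterate_apply, repeatWord]

lemma initialWord_repeatWord (w : List A) (hw : w ≠ []) :
    initialWord (repeatWord w hw) w.length = w := by
  apply List.ext_getElem (by simp)
  intro i h1 h2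
  simp [initialWord, repeatWord, Nat.mod_eq_of_lt h2]

lemma initialWord_mul_repeatWord (w : List A) (hw : w ≠ []) (k : ℕ) :
    initialWord (repeatWord w hw) (w.length * (k + 1)) =
      w ++ initialWord (repeatWord w hw) (w.length * k) := by
  rw [mul_add, mul_one, add_comm, initialWord_add, shift_iterate_repeatWord,
    initialWord_repeatWord]

/-- Synchronization at each copy of `s` lets the block `s v` be prepended again and again;
closedness of `X` then admits the infinite repetition. -/
lemma repeatWord_mem [TopologicalSpace A] [DiscreteTopology A] (hX : IsSubshift X)
    {s v : List A} (hsync : ∀ p q : List A, p ++ s ∈ language X → s ++ q ∈ language X →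
      p ++ s ++ q ∈ language X) (hs : s ∈ language X)
    (hw : s ++ v ++ s ∈ language X) (hne : s ++ v ≠ []) :
    repeatWord (s ++ v) hne ∈ X := by
  have key : ∀ k, initialWord (repeatWord (s ++ v) hne) ((s ++ v).length * k) ++ s ∈ language X := by
    intro k
    induction k with
    | zero => simpa using hs
    | succ k ih =>
      rw [initialWord_mul_repeatWord]
      cases k with
      | zero => simpa using hw
      | succ k =>
        rw [initialWord_mul_repeatWord] at ih ⊢
        have := hsync (s ++ v) (v ++ initialWord (repeatWord (s ++ v) hne)
          ((s ++ v).length * k) ++ s) hw (by simpa using ih)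
        simpa using this
  refine hX.mem_of_initialWord_mem fun n => ⟨(s ++ v).length * n, ?_, mem_language_left (key n)⟩
  exact Nat.le_mul_of_pos_left n (List.length_pos_iff.2 hne)

lemma iterate_mem_periodicPoints [TopologicalSpace A] (hX : IsSubshift X) {x : ℕ → A} {n : ℕ}
    (hx : x ∈ periodicPoints X n) (k : ℕ) : shift^[k] x ∈ periodicPoints X n := by
  refine ⟨hX.iterate_mem hx.1 k, ?_⟩
  rw [← Function.iterate_add_apply, add_comm, Function.iterate_add_apply, hx.2]

/-- In a subshift with specification two words can be put at the beginning of a periodic point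
whose period exceeds the total length of the words by a constant. -/
lemma exists_periodicPoint [Finite A] [TopologicalSpace A] [DiscreteTopology A]
    (hX : IsSubshift X) {t : ℕ} (h : SpecificationOn X (language X) t) :
    ∃ N : ℕ, ∀ w ∈ language X, ∀ u ∈ language X,
      ∃ x ∈ periodicPoints X (w.length + t + u.length + N),
        initialWord x w.length = w ∧
        initialWord (shift^[w.length + t] x) u.length = u := by
  obtain ⟨s₀, hs₀, hsync₀⟩ := exists_synchronizing_word hX h
  -- The synchronizing word may be empty, but a period block must not be. Appending a letter on the
  -- right preserves synchronization.
  obtain ⟨s, hs, hne, hsync⟩ : ∃ s ∈ language X, s ≠ [] ∧ ∀ p q : List A, p ++ s ∈ language X →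
      s ++ q ∈ language X → p ++ s ++ q ∈ language X := by
    obtain ⟨y, hy, hy'⟩ := mem_language_iff.1 hs₀
    have hy1 : initialWord y (s₀.length + 1) = s₀ ++ initialWord (shift^[s₀.length] y) 1 := by
      rw [initialWord_add, hy']
    refine ⟨initialWord y (s₀.length + 1), initialWord_mem_language hy _, ?_, ?_⟩
    · rw [hy1]
      simp [initialWord]
    · intro p q hp hq
      rw [hy1] at hp hq ⊢
      have := hsync₀ p (initialWord (shift^[s₀.length] y) 1 ++ q)
        (mem_language_left (v := initialWord (shift^[s₀.length] y) 1) (by simpa using hp))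
        (by simpa using hq)
      simpa using this
  -- The period block is `s v₁ w v₂ u v₃`; besides `w v₂ u` it contains `s` and two gaps of length
  -- `t`.
  refine ⟨s.length + t + t, fun w hw u hu => ?_⟩
  obtain ⟨v₁, hv₁, h₁⟩ := h.pair hs hw
  obtain ⟨v₂, hv₂, h₂⟩ := h.pair h₁ hu
  obtain ⟨v₃, hv₃, h₃⟩ := h.pair h₂ hs
  have hne' : s ++ (v₁ ++ w ++ v₂ ++ u ++ v₃) ≠ [] := by simp [hne]
  have hmem := repeatWord_mem hX hsync hs (v := v₁ ++ w ++ v₂ ++ u ++ v₃) (by simpa using h₃) hne'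
  set y := repeatWord (s ++ (v₁ ++ w ++ v₂ ++ u ++ v₃)) hne'
  have hlen : (s ++ (v₁ ++ w ++ v₂ ++ u ++ v₃)).length =
      w.length + t + u.length + (s.length + t + t) := by
    simp [hv₁, hv₂, hv₃]
    omega
  have hper : y ∈ periodicPoints X (w.length + t + u.length + (s.length + t + t)) := by
    refine ⟨hmem, ?_⟩
    rw [← hlen]
    exact shift_iterate_repeatWord _ _
  have hini : initialWord y ((s ++ v₁) ++ ((w ++ v₂) ++ (u ++ v₃))).length =
      (s ++ v₁) ++ ((w ++ v₂) ++ (u ++ v₃)) := by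
    have := initialWord_repeatWord _ hne'
    simpa only [List.append_assoc] using this
  have hini' := initialWord_append_iff.1 (initialWord_append_iff.1 hini).2
  refine ⟨shift^[(s ++ v₁).length] y, iterate_mem_periodicPoints hX hper _,
    (initialWord_append_iff.1 hini'.1).1, ?_⟩
  have := (initialWord_append_iff.1 hini'.2).1
  rwa [List.length_append, hv₂] at this

end Specification

/-! ### Birkhoff sums and their variation on cylinders -/

section BirkhoffSums

variable {A : Type*} {X : Set (ℕ → A)} {φ : (ℕ → A) → ℝ} {B : ℝ}

lemma abs_birkhoffSum_le (hB : ∀ x, |φ x| ≤ B) (n : ℕ) (x : ℕ → A) :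
    |birkhoffSum shift φ n x| ≤ n * B := by
  rw [birkhoffSum]
  refine (Finset.abs_sum_le_sum_abs _ _).trans ?_
  refine (Finset.sum_le_sum fun i _ => hB _).trans ?_
  simp

lemma bddAbove_birkhoffSum (hB : ∀ x, |φ x| ≤ B) (n : ℕ) (s : Set (ℕ → A)) :
    BddAbove (birkhoffSum shift φ n '' s) := by
  refine ⟨n * B, ?_⟩
  rintro _ ⟨x, -, rfl⟩
  exact (abs_le.1 (abs_birkhoffSum_le hB n x)).2

lemma birkhoffSum_le_supBirkhoff (hB : ∀ x, |φ x| ≤ B) {w : List A} {x : ℕ → A}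
    (hx : x ∈ cylinder X w) : birkhoffSum shift φ w.length x ≤ supBirkhoff X φ w :=
  le_csSup (bddAbove_birkhoffSum hB _ _) ⟨x, hx, rfl⟩

lemma supBirkhoff_le {w : List A} (hw : w ∈ language X) {c : ℝ}
    (h : ∀ x ∈ cylinder X w, birkhoffSum shift φ w.length x ≤ c) : supBirkhoff X φ w ≤ c := by
  refine csSup_le (hw.image _) ?_
  rintro _ ⟨x, hx, rfl⟩
  exact h x hx

lemma neg_mul_le_supBirkhoff (hB : ∀ x, |φ x| ≤ B) {w : List A} (hw : w ∈ language X) :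
    -(w.length * B) ≤ supBirkhoff X φ w := by
  obtain ⟨x, hx⟩ := hw
  exact (abs_le.1 (abs_birkhoffSum_le hB _ x)).1.trans (birkhoffSum_le_supBirkhoff hB hx)

lemma supBirkhoff_nil (hX : X.Nonempty) : supBirkhoff X φ [] = 0 := by
  have : (cylinder X ([] : List A)).Nonempty := by
    obtain ⟨x, hx⟩ := hX
    exact ⟨x, mem_cylinder_initialWord hx 0⟩
  have h2 : birkhoffSum shift φ ([] : List A).length '' cylinder X [] = {0} := by
    ext r
    constructor
    · rintro ⟨x, -, rfl⟩
      simp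
    · rintro rfl
      obtain ⟨x, hx⟩ := this
      exact ⟨x, hx, by simp⟩
  rw [supBirkhoff, h2, csSup_singleton]

lemma mem_cylinder_left {u v : List A} {x : ℕ → A}
    (hx : x ∈ cylinder X (u ++ v)) : x ∈ cylinder X u := by
  rw [mem_cylinder_iff, initialWord_append_iff] at hx
  exact mem_cylinder_iff.2 ⟨hx.1, hx.2.1⟩

/-- The words on whose cylinder the Birkhoff sum varies by at most `V`. -/
def boundedVariationWords (X : Set (ℕ → A)) (φ : (ℕ → A) → ℝ) (V : ℝ) : Set (List A) :=
  {w | w ∈ language X ∧ ∀ x ∈ cylinder X w, ∀ y ∈ cylinder X w,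
    |birkhoffSum shift φ w.length x - birkhoffSum shift φ w.length y| ≤ V}

lemma supBirkhoff_sub_le {V : ℝ} {w : List A}
    (hw : w ∈ boundedVariationWords X φ V) {x : ℕ → A} (hx : x ∈ cylinder X w) :
    supBirkhoff X φ w - V ≤ birkhoffSum shift φ w.length x := by
  have := supBirkhoff_le hw.1 (c := birkhoffSum shift φ w.length x + V) fun y hy => by
    linarith [(abs_le.1 (hw.2 x hx y hy)).1]
  linarith

lemma mem_boundedVariationWords_of_length_le (hB : ∀ x, |φ x| ≤ B) {m : ℕ} {w : List A}
    (hw : w ∈ language X) (hm : w.length ≤ m) :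
    w ∈ boundedVariationWords X φ (2 * (m * B)) := by
  refine ⟨hw, fun x hx y hy => ?_⟩
  have hB0 : 0 ≤ B := (abs_nonneg _).trans (hB x)
  have h1 := abs_birkhoffSum_le hB w.length x
  have h2 := abs_birkhoffSum_le hB w.length y
  have h3 : (w.length : ℝ) * B ≤ m * B :=
    mul_le_mul_of_nonneg_right (by exact_mod_cast hm) hB0
  linarith [abs_sub (birkhoffSum shift φ w.length x) (birkhoffSum shift φ w.length y)]

variable [TopologicalSpace A]

lemma IsSubshift.iterate_mem_cylinder (hX : IsSubshift X) {u v : List A} {x : ℕ → A}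
    (hx : x ∈ cylinder X (u ++ v)) : shift^[u.length] x ∈ cylinder X v := by
  rw [mem_cylinder_iff, initialWord_append_iff] at hx
  exact mem_cylinder_iff.2 ⟨hX.iterate_mem hx.1 _, hx.2.2⟩

lemma supBirkhoff_append_le (hX : IsSubshift X) (hB : ∀ x, |φ x| ≤ B) {u v : List A}
    (h : u ++ v ∈ language X) :
    supBirkhoff X φ (u ++ v) ≤ supBirkhoff X φ u + supBirkhoff X φ v := by
  refine supBirkhoff_le h fun x hx => ?_
  rw [List.length_append, birkhoffSum_add]
  exact add_le_add (birkhoffSum_le_supBirkhoff hB (mem_cylinder_left hx))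
    (birkhoffSum_le_supBirkhoff hB (hX.iterate_mem_cylinder hx))

lemma append_mem_boundedVariationWords (hX : IsSubshift X) {V₁ V₂ : ℝ} {u v : List A}
    (hu : u ∈ boundedVariationWords X φ V₁) (hv : v ∈ boundedVariationWords X φ V₂)
    (huv : u ++ v ∈ language X) : u ++ v ∈ boundedVariationWords X φ (V₁ + V₂) := by
  refine ⟨huv, fun x hx y hy => ?_⟩
  rw [List.length_append, birkhoffSum_add, birkhoffSum_add, add_sub_add_comm]
  exact (abs_add_le _ _).trans (add_le_add
    (hu.2 x (mem_cylinder_left hx) y (mem_cylinder_left hy))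
    (hv.2 _ (hX.iterate_mem_cylinder hx) _ (hX.iterate_mem_cylinder hy)))

/-- Joining two words of bounded variation through a word of length `t` costs a constant. -/
lemma le_supBirkhoff_append (hX : IsSubshift X) (hB : ∀ x, |φ x| ≤ B) {V₁ V₂ : ℝ}
    {w v u : List A} (hw : w ∈ boundedVariationWords X φ V₁)
    (hu : u ∈ boundedVariationWords X φ V₂) (h : w ++ v ++ u ∈ language X) :
    supBirkhoff X φ w + supBirkhoff X φ u - (V₁ + V₂ + v.length * B) ≤
      supBirkhoff X φ (w ++ v ++ u) := by
  obtain ⟨x, hx⟩ := h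
  have h1 := birkhoffSum_le_supBirkhoff hB hx
  rw [List.length_append, List.length_append, birkhoffSum_add, birkhoffSum_add,
    ← List.length_append] at h1
  have h2 := supBirkhoff_sub_le hw (mem_cylinder_left (mem_cylinder_left hx))
  have h3 := supBirkhoff_sub_le hu (hX.iterate_mem_cylinder hx)
  have h4 := (abs_le.1 (abs_birkhoffSum_le hB v.length (shift^[w.length] x))).1
  linarith

/-- Uniform continuity gives `ε` for each term with at least `N` common letters left; the at most
`N` last terms go into the constant. This is the only variation bound available for words that are
not good. -/
lemma exists_abs_birkhoffSum_sub_le [Finite A] [DiscreteTopology A] (hφ : Continuous φ)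
    (hB : ∀ x, |φ x| ≤ B) {ε : ℝ} (hε : 0 < ε) :
    ∃ C : ℝ, ∀ (n : ℕ) (x y : ℕ → A), initialWord x n = initialWord y n →
      |birkhoffSum shift φ n x - birkhoffSum shift φ n y| ≤ ε * n + C := by
  obtain ⟨N, hN⟩ := exists_initialWord_dist_lt hφ hε
  refine ⟨2 * (N * B), fun n x y hxy => ?_⟩
  have hB0 : 0 ≤ B := (abs_nonneg _).trans (hB x)
  obtain ⟨m, r, rfl, hr, hm⟩ : ∃ m r, n = m + r ∧ r ≤ N ∧ ∀ i < m, i + N ≤ n := by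
    rcases le_total n N with h | h
    · exact ⟨0, n, by simp, h, by simp⟩
    · exact ⟨n - N, N, by omega, le_rfl, fun i hi => by omega⟩
  rw [birkhoffSum_add, birkhoffSum_add, add_sub_add_comm]
  have h1 : |birkhoffSum shift φ m x - birkhoffSum shift φ m y| ≤ ε * m := by
    rw [birkhoffSum, birkhoffSum, ← Finset.sum_sub_distrib]
    refine (Finset.abs_sum_le_sum_abs _ _).trans ?_
    refine (Finset.sum_le_sum (g := fun _ => ε) fun i hi => ?_).trans ?_
    · exact (hN _ _ (initialWord_shift_eq_of_le hxy (hm i (Finset.mem_range.1 hi)))).le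
    · simp [mul_comm]
  have h2 := abs_birkhoffSum_le hB r (shift^[m] x)
  have h3 := abs_birkhoffSum_le hB r (shift^[m] y)
  have h4 : (r : ℝ) * B ≤ N * B := mul_le_mul_of_nonneg_right (by exact_mod_cast hr) hB0
  have h5 := abs_sub (birkhoffSum shift φ r (shift^[m] x)) (birkhoffSum shift φ r (shift^[m] y))
  have h6 := abs_add_le (birkhoffSum shift φ m x - birkhoffSum shift φ m y)
    (birkhoffSum shift φ r (shift^[m] x) - birkhoffSum shift φ r (shift^[m] y))
  have h7 : 0 ≤ ε * r := by positivity
  push_cast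
  linarith

end BirkhoffSums

/-- The counting device used throughout: cutting and gluing words are injective maps, and the change
of weight is absorbed into `f` or `g`. -/
lemma sum_le_sum_of_injOn {ι κ : Type*} {s : Finset ι} {t : Finset κ} {f : ι → ℝ} {g : κ → ℝ}
    (i : ι → κ) (hi : ∀ a ∈ s, i a ∈ t) (hinj : Set.InjOn i s) (hfg : ∀ a ∈ s, f a ≤ g (i a))
    (hg : ∀ b ∈ t, 0 ≤ g b) : ∑ a ∈ s, f a ≤ ∑ b ∈ t, g b := by
  classical
  calc ∑ a ∈ s, f a ≤ ∑ a ∈ s, g (i a) := Finset.sum_le_sum hfg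
    _ = ∑ b ∈ s.image i, g b := (Finset.sum_image hinj).symm
    _ ≤ ∑ b ∈ t, g b := Finset.sum_le_sum_of_subset_of_nonneg
        (Finset.image_subset_iff.2 hi) fun b hb _ => hg b hb

/-! ### Partition sums and pressure -/

section PartitionSums

variable {A : Type*} [Finite A] {X Y : Set (ℕ → A)} {D E : Set (List A)} {φ : (ℕ → A) → ℝ}
  {B : ℝ}

lemma finite_wordsOfLength (D : Set (List A)) (n : ℕ) : {w | w ∈ D ∧ w.length = n}.Finite :=
  (List.finite_length_eq A n).subset fun _ hw => hw.2

/-- The words of length `n` in `D`. -/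
noncomputable def wordsOfLength (D : Set (List A)) (n : ℕ) : Finset (List A) :=
  (finite_wordsOfLength D n).toFinset

@[simp] lemma mem_wordsOfLength {w : List A} {n : ℕ} :
    w ∈ wordsOfLength D n ↔ w ∈ D ∧ w.length = n := by
  simp [wordsOfLength]

lemma partitionSum_eq_sum (n : ℕ) :
    partitionSum X D φ n = ∑ w ∈ wordsOfLength D n, Real.exp (supBirkhoff X φ w) :=
  finsum_mem_eq_finite_toFinset_sum _ (finite_wordsOfLength D n)

lemma partitionSum_nonneg (n : ℕ) : 0 ≤ partitionSum X D φ n := by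
  rw [partitionSum_eq_sum]
  exact Finset.sum_nonneg fun _ _ => (Real.exp_pos _).le

lemma partitionSum_mono (h : D ⊆ E) (n : ℕ) : partitionSum X D φ n ≤ partitionSum X E φ n := by
  rw [partitionSum_eq_sum, partitionSum_eq_sum]
  refine Finset.sum_le_sum_of_subset_of_nonneg (fun w hw => ?_) fun _ _ _ => (Real.exp_pos _).le
  rw [mem_wordsOfLength] at *
  exact ⟨h hw.1, hw.2⟩

lemma partitionSum_pos {w : List A} (hw : w ∈ D) : 0 < partitionSum X D φ w.length := by
  rw [partitionSum_eq_sum]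
  exact Finset.sum_pos (fun _ _ => Real.exp_pos _) ⟨w, by simpa using hw⟩

variable [TopologicalSpace A]

/-- Submultiplicativity of partition sums, for a collection of words that split into words of
two given collections. -/
lemma partitionSum_add_le (hX : IsSubshift X) (hB : ∀ x, |φ x| ≤ B) {D D₁ D₂ : Set (List A)}
    (hD : D ⊆ language X) {m n : ℕ}
    (hs : ∀ u v : List A, u.length = m → v.length = n → u ++ v ∈ D → u ∈ D₁ ∧ v ∈ D₂) :
    partitionSum X D φ (m + n) ≤ partitionSum X D₁ φ m * partitionSum X D₂ φ n := by
  rw [partitionSum_eq_sum, partitionSum_eq_sum, partitionSum_eq_sum, Finset.sum_mul_sum,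
    ← Finset.sum_product']
  have hlen : ∀ w ∈ wordsOfLength D (m + n), (w.take m).length = m ∧ (w.drop m).length = n := by
    intro w hw
    have := (mem_wordsOfLength.1 hw).2
    simp [this]
  refine sum_le_sum_of_injOn (fun w => (w.take m, w.drop m)) ?_ ?_ ?_ ?_
  · intro w hw
    have h := hs (w.take m) (w.drop m) (hlen w hw).1 (hlen w hw).2
      (by simpa using (mem_wordsOfLength.1 hw).1)
    simp only [Finset.mem_product, mem_wordsOfLength]
    exact ⟨⟨h.1, (hlen w hw).1⟩, h.2, (hlen w hw).2⟩
  · intro w _ w' _ h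
    simp only [Prod.mk.injEq] at h
    rw [← List.take_append_drop m w, ← List.take_append_drop m w', h.1, h.2]
  · intro w hw
    rw [← Real.exp_add, Real.exp_le_exp]
    have := supBirkhoff_append_le (u := w.take m) (v := w.drop m) hX hB
      (by simpa using hD (mem_wordsOfLength.1 hw).1)
    simpa using this
  · intro p _
    positivity

lemma partitionSum_language_pos (hX : IsSubshift X) (n : ℕ) :
    0 < partitionSum X (language X) φ n := by
  obtain ⟨x, hx⟩ := hX.nonempty
  simpa using partitionSum_pos (X := X) (φ := φ) (initialWord_mem_language hx n)

lemma exp_neg_le_partitionSum (hX : IsSubshift X) (hB : ∀ x, |φ x| ≤ B) (n : ℕ) :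
    Real.exp (-(n * B)) ≤ partitionSum X (language X) φ n := by
  obtain ⟨x, hx⟩ := hX.nonempty
  have hw := initialWord_mem_language hx n
  rw [partitionSum_eq_sum]
  refine le_trans ?_ (Finset.single_le_sum (fun _ _ => (Real.exp_pos _).le)
    (show initialWord x n ∈ wordsOfLength (language X) n by simpa using hw))
  rw [Real.exp_le_exp]
  simpa using neg_mul_le_supBirkhoff hB hw

lemma subadditive_log_partitionSum (hX : IsSubshift X) (hB : ∀ x, |φ x| ≤ B) :
    Subadditive fun n => Real.log (partitionSum X (language X) φ n) := by
  intro m n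
  rw [← Real.log_mul (partitionSum_language_pos hX m).ne' (partitionSum_language_pos hX n).ne']
  refine Real.log_le_log (partitionSum_language_pos hX _)
    (partitionSum_add_le hX hB subset_rfl fun u v _ _ h => ?_)
  exact ⟨mem_language_left h, hX.mem_language_right h⟩

lemma bddBelow_log_partitionSum (hX : IsSubshift X) (hB : ∀ x, |φ x| ≤ B) :
    BddBelow (Set.range fun n : ℕ => Real.log (partitionSum X (language X) φ n) / n) := by
  refine ⟨-B, ?_⟩
  rintro _ ⟨n, rfl⟩
  have hB0 : 0 ≤ B := by
    obtain ⟨x, -⟩ := hX.nonempty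
    exact (abs_nonneg _).trans (hB x)
  rcases Nat.eq_zero_or_pos n with rfl | hn
  · simpa using hB0
  · have hn' : (0 : ℝ) < n := by exact_mod_cast hn
    simp only
    rw [le_div_iff₀ hn', Real.le_log_iff_exp_le (partitionSum_language_pos hX n)]
    convert exp_neg_le_partitionSum hX hB n using 2
    ring

lemma tendsto_pressure (hX : IsSubshift X) (hB : ∀ x, |φ x| ≤ B) :
    Tendsto (fun n : ℕ => Real.log (partitionSum X (language X) φ n) / n) atTop
      (𝓝 (pressure X φ)) := by
  have h := (subadditive_log_partitionSum hX hB).tendsto_lim (bddBelow_log_partitionSum hX hB)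
  have h2 := h.limsup_eq
  rw [pressure, h2]
  exact h

/-- By Fekete's lemma the limit of the subadditive sequence is an infimum, so the bound holds at
every length without a constant. -/
lemma exp_pressure_le_partitionSum (hX : IsSubshift X) (hB : ∀ x, |φ x| ≤ B) (n : ℕ) :
    Real.exp (n * pressure X φ) ≤ partitionSum X (language X) φ n := by
  have h := (subadditive_log_partitionSum hX hB).tendsto_lim (bddBelow_log_partitionSum hX hB)
  have hP : pressure X φ = (subadditive_log_partitionSum hX hB).lim :=
    tendsto_nhds_unique (tendsto_pressure hX hB) h
  rw [← Real.le_log_iff_exp_le (partitionSum_language_pos hX n)]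
  rcases Nat.eq_zero_or_pos n with rfl | hn
  · rw [partitionSum_eq_sum]
    have : wordsOfLength (language X) 0 = {[]} := by
      ext w
      simp only [mem_wordsOfLength, List.length_eq_zero_iff, Finset.mem_singleton,
        and_iff_right_iff_imp]
      rintro rfl
      exact hX.nil_mem_language
    simp [this, supBirkhoff_nil hX.nonempty]
  · have := (subadditive_log_partitionSum hX hB).lim_le_div (bddBelow_log_partitionSum hX hB)
      hn.ne'
    rw [hP, mul_comm]
    exact (le_div_iff₀ (by exact_mod_cast hn)).1 this

lemma eventually_partitionSum_le (hX : IsSubshift X) (hB : ∀ x, |φ x| ≤ B) {R : ℝ}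
    (hR : pressure X φ < R) :
    ∀ᶠ n : ℕ in atTop, partitionSum X (language X) φ n ≤ Real.exp (n * R) := by
  filter_upwards [(tendsto_pressure hX hB).eventually (gt_mem_nhds hR), eventually_gt_atTop 0]
    with n hn hn0
  rw [← Real.log_le_iff_le_exp (partitionSum_language_pos hX n), mul_comm]
  exact ((div_lt_iff₀ (by exact_mod_cast hn0)).1 hn).le

/-- If `P(Y) < P(X)`, the words of `𝓒^{s,ℓ}` have, for some `ℓ`, partition sums of exponential
growth rate less than `P(X)`. -/
lemma exists_partitionSum_suffixWords_le [DiscreteTopology A] (hX : IsSubshift X)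
    (hY : IsSubshift Y) (hYX : Y ⊆ X) (hφ : Continuous φ) (hB : ∀ x, |φ x| ≤ B)
    (hP : pressure Y φ < pressure X φ) :
    ∃ (l : ℕ) (K R : ℝ), 0 < l ∧ 0 < K ∧ R < pressure X φ ∧
      ∀ n, partitionSum X (suffixWords X Y l) φ n ≤ K * Real.exp (n * R) := by
  -- The rate will be `P(Y) + 3ε`, still `ε` below `P(X)`: one `ε` for the pressure of `Y` at length
  -- `l`, one for the linear variation, one for its constant `C ≤ ε l`.
  set ε := (pressure X φ - pressure Y φ) / 4 with hε
  have hε0 : 0 < ε := by linarith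
  obtain ⟨C, hC⟩ := exists_abs_birkhoffSum_sub_le hφ hB hε0
  obtain ⟨l, hl1, hl2, hl3⟩ := ((eventually_partitionSum_le hY hB
    (show pressure Y φ < pressure Y φ + ε by linarith)).and ((eventually_gt_atTop 0).and
    ((tendsto_natCast_atTop_atTop.const_mul_atTop hε0).eventually_ge_atTop C))).exists
  set R := pressure Y φ + 3 * ε with hR
  have hlanguage : language Y ⊆ language X := by
    rintro w ⟨x, hx⟩
    exact ⟨x, hYX hx.1, hx.2⟩
  have hblock : partitionSum X (language Y) φ l ≤ Real.exp (l * R) := by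
    -- On the left the suprema run over cylinders of `X`, on the right over cylinders of `Y`; the
    -- variation bound pays for the change.
    have h1 : partitionSum X (language Y) φ l ≤
        Real.exp (ε * l + C) * partitionSum Y (language Y) φ l := by
      rw [partitionSum_eq_sum, partitionSum_eq_sum, Finset.mul_sum]
      refine Finset.sum_le_sum fun w hw => ?_
      obtain ⟨hwY, hwl⟩ := mem_wordsOfLength.1 hw
      rw [← Real.exp_add, Real.exp_le_exp]
      obtain ⟨y, hy⟩ := hwY
      refine supBirkhoff_le (hlanguage ⟨y, hy⟩) fun x hx => ?_
      have h2 := birkhoffSum_le_supBirkhoff hB hy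
      have h3 := hC w.length x y (by
        rw [(mem_cylinder_iff.1 hx).2, (mem_cylinder_iff.1 hy).2])
      rw [← hwl]
      linarith [(abs_le.1 h3).2]
    refine h1.trans ((mul_le_mul_of_nonneg_left hl1 (Real.exp_pos _).le).trans ?_)
    rw [← Real.exp_add, Real.exp_le_exp, hR]
    linarith
  have hsub : suffixWords X Y l ⊆ language X := fun w hw => hw.1
  have hstep : ∀ n, partitionSum X (suffixWords X Y l) φ (l + n) ≤
      Real.exp (l * R) * partitionSum X (suffixWords X Y l) φ n := by
    intro n
    refine (partitionSum_add_le hX hB hsub (D₁ := language Y) (D₂ := suffixWords X Y l)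
      fun u v hu hv huv => ⟨huv.2 u ⟨[], v, by simp⟩ hu, hX.mem_language_right huv.1,
        fun z hz hzl => huv.2 z (hz.trans ⟨u, [], by simp⟩) hzl⟩).trans ?_
    exact mul_le_mul_of_nonneg_right hblock (partitionSum_nonneg n)
  set c := partitionSum X (suffixWords X Y l) φ with hc
  have hK0 : 0 ≤ ∑ r ∈ Finset.range l, c r * Real.exp (-(r * R)) :=
    Finset.sum_nonneg fun r _ => mul_nonneg (partitionSum_nonneg r) (Real.exp_pos _).le
  -- The constant covers the lengths below `l`; longer words are reduced to these by cutting off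
  -- blocks of length `l`.
  refine ⟨l, ∑ r ∈ Finset.range l, c r * Real.exp (-(r * R)) + 1, R, hl2, by linarith,
    by linarith, fun n => ?_⟩
  induction n using Nat.strong_induction_on with
  | _ n ih =>
    rcases lt_or_ge n l with h | h
    · have h1 := Finset.single_le_sum (f := fun r : ℕ => c r * Real.exp (-(r * R)))
        (fun r _ => mul_nonneg (partitionSum_nonneg r) (Real.exp_pos _).le)
        (Finset.mem_range.2 h)
      have h2 : c n = c n * Real.exp (-(n * R)) * Real.exp (n * R) := by
        rw [mul_assoc, ← Real.exp_add]
        simp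
      change c n ≤ _
      rw [h2]
      exact mul_le_mul_of_nonneg_right (by linarith) (Real.exp_pos _).le
    · obtain ⟨k, rfl⟩ := Nat.exists_eq_add_of_le h
      refine (hstep k).trans ((mul_le_mul_of_nonneg_left (ih k (by omega))
        (Real.exp_pos _).le).trans_eq ?_)
      push_cast
      rw [add_mul (l : ℝ), Real.exp_add]
      ring

end PartitionSums

/-! ### Grid functions -/

section GridFunctions

variable {A : Type*} {X Y : Set (ℕ → A)} {φ₀ : (ℕ → A) → ℝ}

lemma dropLast_initialWord (x : ℕ → A) (n : ℕ) :
    (initialWord x (n + 1)).dropLast = initialWord x n := by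
  simp [initialWord, List.range_succ]

/-- An initial word of `x ∈ X` outside `𝓛(Y)` has an initial word in `𝓕(X, Y)`. -/
lemma exists_initialWord_mem_minimalForbidden (hY : Y.Nonempty) {x : ℕ → A} (hx : x ∈ X)
    {n : ℕ} (hn : initialWord x n ∉ language Y) :
    ∃ m ≤ n, initialWord x m ∈ minimalForbidden X Y := by
  classical
  have hex : ∃ m, initialWord x m ∉ language Y := ⟨n, hn⟩
  refine ⟨Nat.find hex, Nat.find_min' hex hn, initialWord_mem_language hx _,
    Nat.find_spec hex, ?_⟩
  obtain ⟨y, hy⟩ := hY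
  obtain ⟨k, hk⟩ : ∃ k, Nat.find hex = k + 1 := by
    refine Nat.exists_eq_succ_of_ne_zero fun h0 => Nat.find_spec hex ?_
    rw [h0]
    exact initialWord_mem_language hy 0
  rw [hk, dropLast_initialWord]
  exact not_not.1 (Nat.find_min hex (by omega))

/-- A proper initial word of a minimal forbidden word is in `𝓛(Y)`. Hence the series of a grid
function has at most one nonzero term at each point. -/
lemma initialWord_mem_minimalForbidden_unique {x : ℕ → A} {m n : ℕ}
    (hm : initialWord x m ∈ minimalForbidden X Y)
    (hn : initialWord x n ∈ minimalForbidden X Y) : m = n := by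
  have key : ∀ {m n : ℕ}, initialWord x m ∈ minimalForbidden X Y →
      initialWord x n ∈ minimalForbidden X Y → ¬ m < n := by
    intro m n hm hn hlt
    obtain ⟨k, rfl⟩ := Nat.exists_eq_add_of_lt hlt
    have := hn.2.2
    rw [dropLast_initialWord, initialWord_add] at this
    exact hm.2.1 (mem_language_left this)
  exact le_antisymm (not_lt.1 (key hn hm)) (not_lt.1 (key hm hn))

lemma tsum_minimalForbidden_eq {a : List A → ℝ} {x : ℕ → A} (hx : x ∈ X) {n : ℕ}
    (hn : initialWord x n ∈ minimalForbidden X Y) :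
    ∑' w : minimalForbidden X Y, (cylinder X (w : List A)).indicator (fun _ => a w) x =
      a (initialWord x n) := by
  rw [tsum_eq_single ⟨initialWord x n, hn⟩]
  · exact Set.indicator_of_mem (mem_cylinder_initialWord hx n) _
  · rintro ⟨w, hw⟩ hne
    refine Set.indicator_of_notMem (fun hxw => hne ?_) _
    have h : initialWord x w.length = w := (mem_cylinder_iff.1 hxw).2
    have := initialWord_mem_minimalForbidden_unique (h.symm ▸ hw) hn
    rw [this] at h
    exact Subtype.ext h.symm

lemma tsum_minimalForbidden_eq_zero {a : List A → ℝ} {x : ℕ → A}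
    (hn : ∀ n, initialWord x n ∉ minimalForbidden X Y) :
    ∑' w : minimalForbidden X Y, (cylinder X (w : List A)).indicator (fun _ => a w) x = 0 := by
  rw [← tsum_zero (α := ℝ) (β := minimalForbidden X Y)]
  refine tsum_congr fun w => Set.indicator_of_notMem (fun hxw => hn w.1.length ?_) _
  rw [(mem_cylinder_iff.1 hxw).2]
  exact w.2

/-- Once a point has visibly left `𝓛(Y)`, its minimal forbidden word has been read, and that word
alone fixes the value. -/
lemma IsGridFunction.eq_of_initialWord (h : IsGridFunction X Y φ₀) (hY : Y.Nonempty)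
    {x y : ℕ → A} (hx : x ∈ X) (hy : y ∈ X) {n : ℕ} (hxy : initialWord x n = initialWord y n)
    (hn : initialWord x n ∉ language Y) : φ₀ x = φ₀ y := by
  obtain ⟨a, -, ha⟩ := h
  obtain ⟨m, hm, hF⟩ := exists_initialWord_mem_minimalForbidden hY hx hn
  have he := initialWord_eq_of_le hxy hm
  rw [ha x hx, ha y hy, tsum_minimalForbidden_eq hx hF, tsum_minimalForbidden_eq hy (he ▸ hF), he]

/-- Either the first `N` letters already fix the value, or any minimal forbidden initial word has
length at least `N`, where the coefficients are small. -/
lemma IsGridFunction.exists_dist_lt (h : IsGridFunction X Y φ₀) (hY : Y.Nonempty) {ε : ℝ}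
    (hε : 0 < ε) : ∃ N, ∀ x ∈ X, ∀ y ∈ X, initialWord x N = initialWord y N →
      |φ₀ x - φ₀ y| < ε := by
  obtain ⟨a, hlim, ha⟩ := h
  obtain ⟨N, hN⟩ := hlim (ε / 2) (half_pos hε)
  refine ⟨N, fun x hx y hy hxy => ?_⟩
  by_cases hn : initialWord x N ∈ language Y
  · have small : ∀ z ∈ X, initialWord z N ∈ language Y → |φ₀ z| < ε / 2 := by
      intro z hz hzN
      rw [ha z hz]
      by_cases hF : ∃ n, initialWord z n ∈ minimalForbidden X Y
      · obtain ⟨n, hF⟩ := hF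
        rw [tsum_minimalForbidden_eq hz hF]
        refine hN _ hF ?_
        rw [length_initialWord]
        by_contra! hlt
        obtain ⟨k, rfl⟩ := Nat.exists_eq_add_of_lt hlt
        rw [add_assoc, initialWord_add] at hzN
        exact hF.2.1 (mem_language_left hzN)
      · push Not at hF
        rw [tsum_minimalForbidden_eq_zero hF]
        simpa using hε
    have h1 := small x hx hn
    have h2 := small y hy (hxy ▸ hn)
    exact (abs_sub _ _).trans_lt (by linarith)
  · rw [IsGridFunction.eq_of_initialWord ⟨a, hlim, ha⟩ hY hx hy hxy hn]
    simpa using hε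

lemma IsGridFunction.continuousOn [TopologicalSpace A] [DiscreteTopology A]
    (h : IsGridFunction X Y φ₀) (hY : Y.Nonempty) : ContinuousOn φ₀ X := by
  intro x hx
  rw [ContinuousWithinAt, Metric.tendsto_nhds]
  intro ε hε
  obtain ⟨N, hN⟩ := h.exists_dist_lt hY hε
  have hopen : IsOpen {y : ℕ → A | ∀ i ∈ Finset.range N, y i = x i} := by
    have : {y : ℕ → A | ∀ i ∈ Finset.range N, y i = x i} =
        ⋂ i ∈ Finset.range N, (fun y : ℕ → A => y i) ⁻¹' {x i} := by
      ext y
      simp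
    rw [this]
    exact isOpen_biInter_finset fun i _ => (isOpen_discrete _).preimage (continuous_apply i)
  filter_upwards [self_mem_nhdsWithin, mem_nhdsWithin_of_mem_nhds
    (hopen.mem_nhds (show x ∈ _ from fun i _ => rfl))] with y hy hyx
  exact hN y hy x hx (initialWord_eq_iff.2 fun i hi => hyx i (Finset.mem_range.2 hi))

/-- A Bowen potential plus a grid function has bounded variation on the good words. -/
lemma goodWords_subset_boundedVariationWords [TopologicalSpace A] (hX : IsSubshift X)
    (hY : IsSubshift Y) {φ φr : (ℕ → A) → ℝ} {V B₀ : ℝ}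
    (hV : ∀ w ∈ language X, ∀ x ∈ cylinder X w, ∀ y ∈ cylinder X w,
      |birkhoffSum shift φr w.length x - birkhoffSum shift φr w.length y| ≤ V)
    (hB₀ : ∀ x ∈ X, |φ₀ x| ≤ B₀) (h₀ : IsGridFunction X Y φ₀)
    (hφ : ∀ x ∈ X, φ x = φr x + φ₀ x) (l : ℕ) :
    goodWords X Y l ⊆ boundedVariationWords X φ (V + 2 * (l * B₀)) := by
  rintro w ⟨hw, hw'⟩
  have hV0 : 0 ≤ V := by
    obtain ⟨x, hx⟩ := hX.nonempty
    exact (abs_nonneg _).trans (hV [] hX.nil_mem_language x (mem_cylinder_initialWord hx 0) x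
      (mem_cylinder_initialWord hx 0))
  have hB0 : 0 ≤ B₀ := by
    obtain ⟨x, hx⟩ := hX.nonempty
    exact (abs_nonneg _).trans (hB₀ x hx)
  rcases hw' with rfl | ⟨hl, hlast⟩
  · refine ⟨hw, fun x _ y _ => ?_⟩
    have : 0 ≤ V + 2 * (l * B₀) := by positivity
    simpa using this
  refine ⟨hw, fun x hx y hy => ?_⟩
  have hsplit : ∀ z ∈ X, birkhoffSum shift φ w.length z =
      birkhoffSum shift φr w.length z + birkhoffSum shift φ₀ w.length z := by
    intro z hz
    rw [birkhoffSum, birkhoffSum, birkhoffSum, ← Finset.sum_add_distrib]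
    exact Finset.sum_congr rfl fun k _ => hφ _ (hX.iterate_mem hz k)
  rw [hsplit x hx.1, hsplit y hy.1, add_sub_add_comm]
  refine (abs_add_le _ _).trans (add_le_add (hV w hw x hx y hy) ?_)
  obtain ⟨m, hm⟩ := Nat.exists_eq_add_of_le' hl
  rw [hm, birkhoffSum_add, birkhoffSum_add]
  have hxy : initialWord x w.length = initialWord y w.length := by
    rw [(mem_cylinder_iff.1 hx).2, (mem_cylinder_iff.1 hy).2]
  have hdrop : w.drop (w.length - l) = initialWord (shift^[m] x) l := by
    have h1 := (mem_cylinder_iff.1 hx).2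
    rw [hm, initialWord_add] at h1
    rw [← h1]
    simp
  -- For `k < m` the part of `w` from position `k` on ends in the last `ℓ` letters, so it is outside
  -- `𝓛(Y)` and `φ₀` agrees at the two shifted points. Only the last `ℓ` terms can differ.
  have h1 : birkhoffSum shift φ₀ m x = birkhoffSum shift φ₀ m y := by
    rw [birkhoffSum, birkhoffSum]
    refine Finset.sum_congr rfl fun k hk => ?_
    have hk' := Finset.mem_range.1 hk
    refine h₀.eq_of_initialWord hY.nonempty (hX.iterate_mem hx.1 k) (hX.iterate_mem hy.1 k)
      (n := (m - k) + l) (initialWord_shift_eq_of_le hxy (by omega)) ?_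
    intro hmem
    rw [initialWord_add, ← Function.iterate_add_apply, Nat.sub_add_cancel hk'.le] at hmem
    exact hlast (hdrop ▸ hY.mem_language_right hmem)
  have habs : ∀ z ∈ X, |birkhoffSum shift φ₀ l z| ≤ l * B₀ := by
    intro z hz
    rw [birkhoffSum]
    refine (Finset.abs_sum_le_sum_abs _ _).trans ?_
    refine (Finset.sum_le_sum fun i _ => hB₀ _ (hX.iterate_mem hz i)).trans ?_
    simp
  rw [h1, add_sub_add_comm, sub_self, zero_add]
  refine (abs_sub _ _).trans ?_
  linarith [habs _ (hX.iterate_mem hx.1 m), habs _ (hX.iterate_mem hy.1 m)]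

end GridFunctions

/-! ### Decomposition of the language and gluing of words -/

section Decomposition

variable {A : Type*} {X Y : Set (ℕ → A)}

/-- Goodness is read off the last `ℓ` letters, so it survives any extension to the left. The empty
word is excluded because it is good only by convention. -/
lemma append_mem_goodWords {l : ℕ} {w u : List A} (hu : u ∈ goodWords X Y l) (hne : u ≠ [])
    (h : w ++ u ∈ language X) : w ++ u ∈ goodWords X Y l := by
  obtain ⟨-, rfl | ⟨hl, hu⟩⟩ := hu
  · exact absurd rfl hne
  · refine ⟨h, Or.inr ⟨by simp; omega, ?_⟩⟩
    rwa [List.length_append, Nat.add_sub_assoc hl, List.drop_append, List.drop_eq_nil_of_le (by omega),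
      Nat.add_sub_cancel_left, List.nil_append]

variable [TopologicalSpace A]

/-- The longest good prefix works: a block of length `ℓ` outside `𝓛(Y)` in the remainder would end a
longer good prefix. -/
lemma exists_goodWords_append_suffixWords (hX : IsSubshift X) (hY : IsSubshift Y) (l : ℕ)
    {w : List A} (hw : w ∈ language X) :
    ∃ u ∈ goodWords X Y l, ∃ v ∈ suffixWords X Y l, w = u ++ v := by
  classical
  have h0 : w.take 0 ∈ goodWords X Y l := ⟨by simpa using hX.nil_mem_language, Or.inl (by simp)⟩
  set k := Nat.findGreatest (fun k => w.take k ∈ goodWords X Y l) w.length with hk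
  have hgood : w.take k ∈ goodWords X Y l :=
    Nat.findGreatest_spec (P := fun k => w.take k ∈ goodWords X Y l) (Nat.zero_le _) h0
  have hkw : k ≤ w.length := Nat.findGreatest_le _
  refine ⟨w.take k, hgood, w.drop k, ⟨?_, ?_⟩, (List.take_append_drop k w).symm⟩
  · exact hX.mem_language_right (u := w.take k) (by simpa using hw)
  · rintro u ⟨a, b, hab⟩ rfl
    by_contra hu
    have hw' : w = (w.take k ++ a ++ u) ++ b := by
      conv_lhs => rw [← List.take_append_drop k w, ← hab]
      simp
    have htk : (w.take k).length = k := by simp [hkw]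
    have hlen : (w.take k ++ a ++ u).length = k + a.length + u.length := by
      simp only [List.length_append, htk]
    have hle : k + a.length + u.length ≤ w.length := by
      have := congrArg List.length hw'
      rw [List.length_append, hlen] at this
      omega
    have hmem : w.take (k + a.length + u.length) ∈ goodWords X Y u.length := by
      have : w.take (k + a.length + u.length) = w.take k ++ a ++ u := by
        conv_lhs => rw [hw']
        rw [← hlen, List.take_left']
        rfl
      rw [this]
      refine ⟨mem_language_left (hw' ▸ hw), Or.inr ⟨by rw [hlen]; omega, ?_⟩⟩
      rwa [hlen, Nat.add_sub_cancel, List.drop_left']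
      rw [List.length_append, htk]
    have := Nat.le_findGreatest (P := fun k => w.take k ∈ goodWords X Y u.length) hle hmem
    rw [← hk] at this
    -- The new prefix fails to be strictly longer only when `ℓ = 0`, and the empty word is in
    -- `𝓛(Y)`.
    have hu0 : u = [] := List.length_eq_zero_iff.1 (by omega)
    exact hu (hu0 ▸ hY.nil_mem_language)

lemma isDecomposition_goodWords (hX : IsSubshift X) (hY : IsSubshift Y) (l : ℕ) :
    IsDecomposition X {[]} (goodWords X Y l) (suffixWords X Y l) := by
  refine ⟨?_, fun w hw => hw.1, fun w hw => hw.1, fun w hw => ?_⟩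
  · rintro _ rfl
    exact hX.nil_mem_language
  · obtain ⟨u, hu, v, hv, rfl⟩ := exists_goodWords_append_suffixWords hX hY l hw
    exact ⟨[], rfl, u, hu, v, hv, rfl⟩

variable [Finite A] {φ : (ℕ → A) → ℝ} {B : ℝ}

/-- Counting words through a decomposition `w = u v` according to the length of `u`. -/
lemma partitionSum_le_sum_mul (hX : IsSubshift X) (hB : ∀ x, |φ x| ≤ B)
    {D G S : Set (List A)} (hD : D ⊆ language X) {n : ℕ} {T : Finset ℕ}
    (h : ∀ w ∈ D, w.length = n → ∃ u ∈ G, ∃ v ∈ S, u.length ∈ T ∧ w = u ++ v) :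
    partitionSum X D φ n ≤ ∑ k ∈ T, partitionSum X G φ k * partitionSum X S φ (n - k) := by
  classical
  have h' : ∀ w : List A, ∃ p : List A × List A, w ∈ D → w.length = n →
      p.1 ∈ G ∧ p.2 ∈ S ∧ p.1.length ∈ T ∧ w = p.1 ++ p.2 := by
    intro w
    by_cases hw : w ∈ D ∧ w.length = n
    · obtain ⟨u, hu, v, hv, hT, rfl⟩ := h w hw.1 hw.2
      exact ⟨(u, v), fun _ _ => ⟨hu, hv, hT, rfl⟩⟩
    · exact ⟨([], []), fun h1 h2 => absurd ⟨h1, h2⟩ hw⟩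
  choose p hp using h'
  simp only [partitionSum_eq_sum, Finset.sum_mul_sum, ← Finset.sum_product']
  rw [Finset.sum_sigma']
  refine sum_le_sum_of_injOn (fun w => (⟨(p w).1.length, p w⟩ : Σ _ : ℕ, List A × List A))
    ?_ ?_ ?_ ?_
  · intro w hw
    obtain ⟨hwD, hwn⟩ := mem_wordsOfLength.1 hw
    obtain ⟨h1, h2, h3, h4⟩ := hp w hwD hwn
    simp only [Finset.mem_sigma, Finset.mem_product, mem_wordsOfLength]
    refine ⟨h3, ⟨h1, trivial⟩, h2, ?_⟩
    have := congrArg List.length h4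
    rw [List.length_append] at this
    omega
  · intro w hw w' hw' heq
    obtain ⟨hwD, hwn⟩ := mem_wordsOfLength.1 hw
    obtain ⟨hwD', hwn'⟩ := mem_wordsOfLength.1 hw'
    simp only [Sigma.mk.injEq] at heq
    rw [(hp w hwD hwn).2.2.2, (hp w' hwD' hwn').2.2.2, eq_of_heq heq.2]
  · intro w hw
    obtain ⟨hwD, hwn⟩ := mem_wordsOfLength.1 hw
    have h4 := (hp w hwD hwn).2.2.2
    rw [← Real.exp_add, Real.exp_le_exp]
    conv_lhs => rw [h4]
    exact supBirkhoff_append_le hX hB (h4 ▸ hD hwD)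
  · intro b _
    positivity

/-- Joining good words by words of length `t`: the partition sums of a collection of words of
bounded variation are supermultiplicative up to a constant. -/
lemma partitionSum_mul_le (hX : IsSubshift X) (hB : ∀ x, |φ x| ≤ B) {t : ℕ} {V : ℝ}
    {G : Set (List A)} (hG : G ⊆ boundedVariationWords X φ V) {k m : ℕ}
    (hglue : ∀ w ∈ G, ∀ u ∈ G, w.length = k → u.length = m →
      ∃ v : List A, v.length = t ∧ w ++ v ++ u ∈ G) :
    partitionSum X G φ k * partitionSum X G φ m ≤
      Real.exp (V + V + t * B) * partitionSum X G φ (k + t + m) := by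
  classical
  have h' : ∀ p : List A × List A, ∃ v : List A, p.1 ∈ G → p.1.length = k → p.2 ∈ G →
      p.2.length = m → v.length = t ∧ p.1 ++ v ++ p.2 ∈ G := by
    intro p
    by_cases hp : p.1 ∈ G ∧ p.1.length = k ∧ p.2 ∈ G ∧ p.2.length = m
    · obtain ⟨v, hv⟩ := hglue p.1 hp.1 p.2 hp.2.2.1 hp.2.1 hp.2.2.2
      exact ⟨v, fun _ _ _ _ => hv⟩
    · exact ⟨[], fun h1 h2 h3 h4 => absurd ⟨h1, h2, h3, h4⟩ hp⟩
  choose v hv using h'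
  rw [partitionSum_eq_sum, partitionSum_eq_sum, partitionSum_eq_sum, Finset.sum_mul_sum,
    ← Finset.sum_product', Finset.mul_sum]
  have hmem : ∀ p ∈ wordsOfLength G k ×ˢ wordsOfLength G m, p.1 ∈ G ∧ p.1.length = k ∧ p.2 ∈ G ∧
      p.2.length = m := by
    intro p hp
    simp only [Finset.mem_product, mem_wordsOfLength] at hp
    exact ⟨hp.1.1, hp.1.2, hp.2.1, hp.2.2⟩
  refine sum_le_sum_of_injOn (fun p => p.1 ++ v p ++ p.2) ?_ ?_ ?_ ?_
  · intro p hp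
    obtain ⟨h1, h2, h3, h4⟩ := hmem p hp
    obtain ⟨h5, h6⟩ := hv p h1 h2 h3 h4
    rw [mem_wordsOfLength]
    refine ⟨h6, ?_⟩
    simp [h2, h4, h5]
    omega
  -- All lengths are fixed, so the glued word determines both factors, whatever gap word was chosen.
  · intro p hp q hq heq
    obtain ⟨h1, h2, h3, h4⟩ := hmem p hp
    obtain ⟨h1', h2', h3', h4'⟩ := hmem q hq
    simp only [List.append_assoc] at heq
    have h5 := List.append_inj heq (by rw [h2, h2'])
    have h6 := List.append_inj h5.2 (by rw [(hv p h1 h2 h3 h4).1, (hv q h1' h2' h3' h4').1])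
    exact Prod.ext h5.1 h6.2
  · intro p hp
    obtain ⟨h1, h2, h3, h4⟩ := hmem p hp
    obtain ⟨h5, h6⟩ := hv p h1 h2 h3 h4
    rw [← Real.exp_add, ← Real.exp_add, Real.exp_le_exp]
    have := le_supBirkhoff_append hX hB (hG h1) (hG h3) (hG h6).1
    rw [h5] at this
    linarith
  · intro w _
    positivity

end Decomposition

/-! ### Growth of almost supermultiplicative sequences -/

section Renewal

/-- A sequence that is supermultiplicative up to a constant and a shift of the index, of
exponential growth rate at most `P`, is at most a constant times `exp (n P)`. -/
lemma le_exp_of_mul_le {a : ℕ → ℝ} {K P : ℝ} {t : ℕ} (hK : 0 < K)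
    (ha : ∀ n, 0 ≤ a n)
    (hmul : ∀ k m, 1 ≤ k → 1 ≤ m → a k * a m ≤ K * a (k + t + m))
    (hgrow : ∀ R, P < R → ∀ᶠ n : ℕ in atTop, a n ≤ Real.exp (n * R)) {k : ℕ} (hk : 1 ≤ k) :
    a k ≤ K * Real.exp ((k + t) * P) := by
  -- If `a k` exceeded the bound by a factor `q > 1`, iterating the product inequality with the
  -- factor `a k` would make `q ^ (j + 1)` unbounded, against growth rate `R`. The claim follows as
  -- `R` decreases to `P`.
  have key : ∀ R, P < R → a k ≤ K * Real.exp ((k + t) * R) := by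
    intro R hR
    by_contra! hcon
    set y := Real.exp ((k + t) * R) with hy
    have hy0 : 0 < y := Real.exp_pos _
    have hak : 0 < a k := lt_of_le_of_lt (by positivity) hcon
    set q := a k / (K * y) with hq
    have hq1 : 1 < q := (one_lt_div (by positivity)).2 hcon
    have hpow : ∀ j : ℕ, a k ^ (j + 1) ≤ K ^ j * a (k + j * (k + t)) := by
      intro j
      induction j with
      | zero => simp
      | succ j ih =>
        calc a k ^ (j + 1 + 1) = a k ^ (j + 1) * a k := pow_succ _ _
          _ ≤ (K ^ j * a (k + j * (k + t))) * a k := mul_le_mul_of_nonneg_right ih (ha k)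
          _ = K ^ j * (a (k + j * (k + t)) * a k) := by ring
          _ ≤ K ^ j * (K * a (k + j * (k + t) + t + k)) :=
              mul_le_mul_of_nonneg_left (hmul _ _ (by omega) hk) (by positivity)
          _ = K ^ (j + 1) * a (k + (j + 1) * (k + t)) := by
              rw [show k + j * (k + t) + t + k = k + (j + 1) * (k + t) by ring]
              ring
    have hidx : Tendsto (fun j : ℕ => k + j * (k + t)) atTop atTop := by
      refine tendsto_atTop_mono (fun j => ?_) tendsto_id
      have : j * 1 ≤ j * (k + t) := Nat.mul_le_mul_left j (by omega)
      simp only [id]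
      omega
    have hev := hidx.eventually (hgrow R hR)
    have hbound : ∀ᶠ j : ℕ in atTop, q ^ (j + 1) ≤ Real.exp (-(t * R)) / K := by
      filter_upwards [hev] with j hj
      rw [hq, div_pow, div_le_div_iff₀ (by positivity) hK]
      calc a k ^ (j + 1) * K ≤ (K ^ j * Real.exp (((k + j * (k + t) : ℕ) : ℝ) * R)) * K :=
            mul_le_mul_of_nonneg_right ((hpow j).trans
              (mul_le_mul_of_nonneg_left hj (by positivity))) hK.le
        _ = Real.exp (-(t * R)) * (K * y) ^ (j + 1) := by
            rw [mul_pow, hy, ← Real.exp_nat_mul, mul_left_comm, ← Real.exp_add, pow_succ]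
            have : ((k + j * (k + t) : ℕ) : ℝ) * R =
                -(t * R) + ((j + 1 : ℕ) : ℝ) * ((k + t) * R) := by
              push_cast
              ring
            rw [this]
            ring
    have hinf := (tendsto_pow_atTop_atTop_of_one_lt hq1).comp (tendsto_add_atTop_nat 1)
    obtain ⟨j, hj1, hj2⟩ := (hbound.and (hinf.eventually_gt_atTop _)).exists
    exact absurd hj1 (not_le.2 hj2)
  have hcont : Continuous fun R : ℝ => K * Real.exp ((k + t) * R) := by fun_prop
  have hlim : Tendsto (fun R : ℝ => K * Real.exp ((k + t) * R)) (𝓝[>] P)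
      (𝓝 (K * Real.exp ((k + t) * P))) := hcont.continuousAt.tendsto.mono_left nhdsWithin_le_nhds
  exact ge_of_tendsto hlim (by filter_upwards [self_mem_nhdsWithin] with R hR using key R hR)

/-- Each term is at most `C K exp (n P) θ ^ (n - k)` with `θ = exp (R - P) < 1`, a geometric series
whose least exponent is `n + 1 - p`. Taking `p = n + 1` covers all words, `p = n - M` those with a
suffix longer than `M`. -/
lemma sum_mul_le_of_le_exp {a c : ℕ → ℝ} {C K P R : ℝ} (hC : 0 ≤ C) (hR : R < P)
    (ha : ∀ n, a n ≤ C * Real.exp (n * P)) (hc : ∀ n, c n ≤ K * Real.exp (n * R))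
    (hc0 : ∀ n, 0 ≤ c n) {n p : ℕ} (hp : p ≤ n + 1) :
    ∑ k ∈ Finset.range p, a k * c (n - k) ≤
      C * K * (1 - Real.exp (R - P))⁻¹ * Real.exp (R - P) ^ (n + 1 - p) * Real.exp (n * P) := by
  set θ := Real.exp (R - P) with hθ
  have hθ0 : 0 < θ := Real.exp_pos _
  have hθ1 : θ < 1 := by
    rw [hθ, Real.exp_lt_one_iff]
    linarith
  have hK : 0 ≤ K := by simpa using (hc0 0).trans (hc 0)
  have hterm : ∀ k ∈ Finset.range p, a k * c (n - k) ≤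
      C * K * Real.exp (n * P) * θ ^ (n + 1 - p) * θ ^ (p - 1 - k) := by
    intro k hk
    have hk' := Finset.mem_range.1 hk
    refine (mul_le_mul (ha k) (hc (n - k)) (hc0 _) (by positivity)).trans_eq ?_
    rw [mul_assoc _ (θ ^ _), ← pow_add, show n + 1 - p + (p - 1 - k) = n - k by omega, hθ,
      ← Real.exp_nat_mul]
    have h1 : C * Real.exp (k * P) * (K * Real.exp ((n - k : ℕ) * R)) =
        C * K * (Real.exp (k * P) * Real.exp ((n - k : ℕ) * R)) := by ring
    have h2 : C * K * Real.exp (n * P) * Real.exp ((n - k : ℕ) * (R - P)) =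
        C * K * (Real.exp (n * P) * Real.exp ((n - k : ℕ) * (R - P))) := by ring
    rw [h1, h2, ← Real.exp_add, ← Real.exp_add, Nat.cast_sub (by omega)]
    congr 2
    ring
  refine (Finset.sum_le_sum hterm).trans ?_
  rw [← Finset.mul_sum, Finset.sum_range_reflect (fun j => θ ^ j) p]
  have hgeo : ∑ j ∈ Finset.range p, θ ^ j ≤ (1 - θ)⁻¹ := by
    rw [← tsum_geometric_of_lt_one hθ0.le hθ1]
    exact (summable_geometric_of_lt_one hθ0.le hθ1).sum_le_tsum _ fun i _ => by positivity
  calc _ ≤ C * K * Real.exp (n * P) * θ ^ (n + 1 - p) * (1 - θ)⁻¹ :=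
        mul_le_mul_of_nonneg_left hgeo (by positivity)
    _ = _ := by ring

end Renewal

/-! ### Uniform counting estimates -/

section Counting

variable {A : Type*} [Finite A] [TopologicalSpace A] {X Y : Set (ℕ → A)}
  {φ : (ℕ → A) → ℝ} {B : ℝ}

/-- The partition sums of the language are at most a constant times `exp (n P)`, and the words of
large variation contribute little to them, uniformly in the length. -/
lemma exists_partitionSum_le [DiscreteTopology A] (hX : IsSubshift X) {t : ℕ}
    (hspec : SpecificationOn X (language X) t) (hY : IsSubshift Y) (hYX : Y ⊆ X)
    (hφ : Continuous φ) (hB : ∀ x, |φ x| ≤ B) (hP : pressure Y φ < pressure X φ)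
    (hG : ∀ l, ∃ V, goodWords X Y l ⊆ boundedVariationWords X φ V) :
    (∃ C > 0, ∀ n : ℕ, partitionSum X (language X) φ n ≤ C * Real.exp (n * pressure X φ)) ∧
    ∀ η > 0, ∃ V, ∀ n : ℕ, partitionSum X (language X \ boundedVariationWords X φ V) φ n ≤
      η * Real.exp (n * pressure X φ) := by
  obtain ⟨l, K, R, hl, hK, hR, hc⟩ := exists_partitionSum_suffixWords_le hX hY hYX hφ hB hP
  obtain ⟨V, hV⟩ := hG l
  set P := pressure X φ with hPdef
  set a := partitionSum X (goodWords X Y l) φ with ha_def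
  set c := partitionSum X (suffixWords X Y l) φ with hc_def
  have ha0 : ∀ n, 0 ≤ a n := partitionSum_nonneg
  have hc0 : ∀ n, 0 ≤ c n := partitionSum_nonneg
  have hGL : goodWords X Y l ⊆ language X := fun w hw => hw.1
  -- The condition `1 ≤ m` makes the right factor nonempty, which keeps the glued word good.
  have hmul : ∀ k m, 1 ≤ k → 1 ≤ m → a k * a m ≤ Real.exp (V + V + t * B) * a (k + t + m) := by
    intro k m _ hm
    refine partitionSum_mul_le hX hB hV fun w hw u hu _ hum => ?_
    obtain ⟨v, hv, h⟩ := hspec.pair hw.1 hu.1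
    exact ⟨v, hv, append_mem_goodWords hu (List.ne_nil_of_length_pos (by omega)) h⟩
  have hgrow : ∀ R, P < R → ∀ᶠ n : ℕ in atTop, a n ≤ Real.exp (n * R) := fun R hR => by
    filter_upwards [eventually_partitionSum_le hX hB hR] with n hn
    exact (partitionSum_mono hGL n).trans hn
  -- The summand `a 0` covers length zero, which the growth bound excludes.
  set C₀ := Real.exp (V + V + t * B) * Real.exp (t * P) + a 0 with hC₀
  have hC₀0 : 0 ≤ C₀ := add_nonneg (by positivity) (ha0 0)
  have ha : ∀ n : ℕ, a n ≤ C₀ * Real.exp (n * P) := by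
    intro n
    rcases Nat.eq_zero_or_pos n with rfl | hn
    · have : 0 ≤ Real.exp (V + V + t * B) * Real.exp (t * P) := by positivity
      simp only [CharP.cast_eq_zero, zero_mul, Real.exp_zero, mul_one]
      linarith
    · refine (le_exp_of_mul_le (Real.exp_pos _) ha0 hmul hgrow hn).trans ?_
      have h1 : Real.exp ((n + t) * P) = Real.exp (t * P) * Real.exp (n * P) := by
        rw [← Real.exp_add]
        ring_nf
      rw [h1, hC₀, add_mul, ← mul_assoc]
      exact le_add_of_nonneg_right (mul_nonneg (ha0 0) (Real.exp_pos _).le)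
  set θ := Real.exp (R - P) with hθ
  have hθ1 : θ < 1 := by
    rw [hθ, Real.exp_lt_one_iff]
    linarith
  have hθ0 : 0 < θ := Real.exp_pos _
  have hθ2 : 0 < (1 - θ)⁻¹ := inv_pos.2 (by linarith)
  refine ⟨⟨C₀ * K * (1 - θ)⁻¹ + 1, by positivity, fun n => ?_⟩, fun η hη => ?_⟩
  · have h1 : partitionSum X (language X) φ n ≤
        ∑ k ∈ Finset.range (n + 1), a k * c (n - k) := by
      refine partitionSum_le_sum_mul hX hB subset_rfl fun w hw hwn => ?_
      obtain ⟨u, hu, v, hv, rfl⟩ := exists_goodWords_append_suffixWords hX hY l hw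
      refine ⟨u, hu, v, hv, ?_, rfl⟩
      rw [List.length_append] at hwn
      rw [Finset.mem_range]
      omega
    refine h1.trans ((sum_mul_le_of_le_exp hC₀0 hR ha hc hc0 le_rfl).trans ?_)
    rw [Nat.sub_self, pow_zero, mul_one]
    exact mul_le_mul_of_nonneg_right (by linarith) (Real.exp_pos _).le
  -- A word outside the class of variation `V + 2MB` has a suffix longer than `M`, and such words
  -- carry a proportion of order `θ ^ (M + 1)`.
  · obtain ⟨M, hM⟩ : ∃ M : ℕ, C₀ * K * (1 - θ)⁻¹ * θ ^ (M + 1) < η := by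
      have := ((tendsto_pow_atTop_nhds_zero_of_lt_one hθ0.le hθ1).comp
        (tendsto_add_atTop_nat 1)).const_mul (C₀ * K * (1 - θ)⁻¹)
      rw [mul_zero] at this
      exact (this.eventually (gt_mem_nhds hη)).exists
    refine ⟨V + 2 * (M * B), fun n => ?_⟩
    have h1 : partitionSum X (language X \ boundedVariationWords X φ (V + 2 * (M * B))) φ n ≤
        ∑ k ∈ Finset.range (n - M), a k * c (n - k) := by
      refine partitionSum_le_sum_mul hX hB Set.sdiff_subset fun w hw hwn => ?_
      obtain ⟨u, hu, v, hv, rfl⟩ := exists_goodWords_append_suffixWords hX hY l hw.1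
      refine ⟨u, hu, v, hv, ?_, rfl⟩
      have hvM : M < v.length := by
        by_contra! hle
        exact hw.2 (append_mem_boundedVariationWords hX (hV hu)
          (mem_boundedVariationWords_of_length_le hB hv.1 hle) hw.1)
      rw [List.length_append] at hwn
      rw [Finset.mem_range]
      omega
    rcases le_or_gt n M with hnM | hnM
    · rw [Nat.sub_eq_zero_of_le hnM, Finset.sum_range_zero] at h1
      exact h1.trans (by positivity)
    refine h1.trans ((sum_mul_le_of_le_exp hC₀0 hR ha hc hc0
      (show n - M ≤ n + 1 by omega)).trans ?_)
    refine mul_le_mul_of_nonneg_right (le_trans ?_ hM.le) (Real.exp_pos _).le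
    exact mul_le_mul_of_nonneg_left (pow_le_pow_of_le_one hθ0.le hθ1.le (by omega))
      (by positivity)

/-- The words of bounded variation carry a fixed proportion of the partition sums. -/
lemma exists_le_partitionSum_boundedVariationWords (hX : IsSubshift X) (hB : ∀ x, |φ x| ≤ B)
    (h : ∀ η > 0, ∃ V, ∀ n : ℕ, partitionSum X (language X \ boundedVariationWords X φ V) φ n ≤
      η * Real.exp (n * pressure X φ)) :
    ∃ V, ∀ n : ℕ, 1 / 2 * Real.exp (n * pressure X φ) ≤
      partitionSum X (boundedVariationWords X φ V) φ n := by
  classical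
  obtain ⟨V, hV⟩ := h (1 / 2) one_half_pos
  refine ⟨V, fun n => ?_⟩
  have h1 := exp_pressure_le_partitionSum (φ := φ) hX hB n
  have h2 := hV n
  have h3 : partitionSum X (language X) φ n ≤
      partitionSum X (boundedVariationWords X φ V) φ n +
      partitionSum X (language X \ boundedVariationWords X φ V) φ n := by
    rw [partitionSum_eq_sum, partitionSum_eq_sum, partitionSum_eq_sum]
    refine (Finset.sum_le_sum_of_subset_of_nonneg (t := wordsOfLength (boundedVariationWords X φ V) n
      ∪ wordsOfLength (language X \ boundedVariationWords X φ V) n) (fun w hw => ?_)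
      fun _ _ _ => (Real.exp_pos _).le).trans ?_
    · simp only [Finset.mem_union, mem_wordsOfLength, Set.mem_sdiff] at hw ⊢
      tauto
    · rw [← Finset.sum_union_inter]
      exact le_add_of_nonneg_right (Finset.sum_nonneg fun _ _ => (Real.exp_pos _).le)
  linarith

end Counting

/-! ### Weights of periodic points -/

section PeriodicPoints

variable {A : Type*} {X : Set (ℕ → A)} {φ : (ℕ → A) → ℝ} {B : ℝ}

lemma eq_of_mem_periodicPoints {x y : ℕ → A} {n : ℕ} (hn : 0 < n)
    (hx : x ∈ periodicPoints X n) (hy : y ∈ periodicPoints X n)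
    (h : initialWord x n = initialWord y n) : x = y := by
  have key : ∀ z ∈ periodicPoints X n, ∀ i, z i = z (i % n) := by
    intro z hz i
    have h1 : shift^[n * (i / n)] z = z := by
      rw [Function.iterate_mul]
      exact Function.iterate_fixed hz.2 _
    calc z i = z (n * (i / n) + i % n) := by rw [Nat.div_add_mod]
      _ = z (i % n) := by rw [← shift_iterate_apply z, h1]
  funext i
  rw [key x hx, key y hy]
  exact initialWord_eq_iff.1 h _ (Nat.mod_lt _ hn)

lemma finite_periodicPoints [Finite A] {n : ℕ} (hn : 0 < n) : (periodicPoints X n).Finite := by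
  refine Set.Finite.of_finite_image ((List.finite_length_eq A n).subset ?_)
    (f := fun x => initialWord x n) fun x hx y hy h => eq_of_mem_periodicPoints hn hx hy h
  rintro _ ⟨x, -, rfl⟩
  simp

/-- The weight `∑ exp (S_n φ(x))` of the points of period `n` in a set. -/
noncomputable def periodicSum (X : Set (ℕ → A)) (φ : (ℕ → A) → ℝ) (n : ℕ) (E : Set (ℕ → A)) :
    ℝ :=
  ∑ᶠ x ∈ periodicPoints X n ∩ E, Real.exp (birkhoffSum shift φ n x)

lemma periodicSum_eq_sum {n : ℕ} {E : Set (ℕ → A)} (h : (periodicPoints X n ∩ E).Finite) :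
    periodicSum X φ n E = ∑ x ∈ h.toFinset, Real.exp (birkhoffSum shift φ n x) :=
  finsum_mem_eq_finite_toFinset_sum _ h

variable [Finite A] [TopologicalSpace A]

/-- A point of period `|w| + m` in `[w]` is determined by the `m` letters after `w`, and these form
a word of the language. -/
lemma periodicSum_cylinder_le (hX : IsSubshift X) (hB : ∀ x, |φ x| ≤ B) {w : List A} {m : ℕ}
    (hn : 0 < w.length + m) :
    periodicSum X φ (w.length + m) (cylinder X w) ≤
      Real.exp (supBirkhoff X φ w) * partitionSum X (language X) φ m := by
  have hfin := (finite_periodicPoints (X := X) hn).subset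
    (Set.inter_subset_left (t := cylinder X w))
  rw [periodicSum_eq_sum hfin, partitionSum_eq_sum, Finset.mul_sum]
  refine sum_le_sum_of_injOn (fun x => initialWord (shift^[w.length] x) m) ?_ ?_ ?_ ?_
  · intro x hx
    rw [Set.Finite.mem_toFinset] at hx
    simpa using initialWord_mem_language (hX.iterate_mem hx.1.1 w.length) m
  · intro x hx y hy hxy
    rw [Finset.mem_coe, Set.Finite.mem_toFinset] at hx hy
    refine eq_of_mem_periodicPoints hn hx.1 hy.1 ?_
    rw [initialWord_add, initialWord_add, (mem_cylinder_iff.1 hx.2).2, (mem_cylinder_iff.1 hy.2).2]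
    exact congrArg _ hxy
  · intro x hx
    rw [Set.Finite.mem_toFinset] at hx
    rw [← Real.exp_add, Real.exp_le_exp, birkhoffSum_add]
    refine add_le_add (birkhoffSum_le_supBirkhoff hB hx.2) ?_
    have := birkhoffSum_le_supBirkhoff (φ := φ) hB
      (mem_cylinder_initialWord (hX.iterate_mem hx.1.1 w.length) m)
    simpa using this
  · intro u _
    positivity

/-- Periodic points with a prescribed beginning of bounded variation carry a large weight. -/
lemma exists_le_periodicSum_cylinder [DiscreteTopology A] (hX : IsSubshift X) {t : ℕ}
    (hspec : SpecificationOn X (language X) t) (hB : ∀ x, |φ x| ≤ B) :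
    ∃ N : ℕ, ∀ (V₁ V₂ : ℝ) (m : ℕ), ∀ w ∈ boundedVariationWords X φ V₁,
      0 < w.length + t + m + N →
      Real.exp (supBirkhoff X φ w - (V₁ + V₂ + (t + N) * B)) *
        partitionSum X (boundedVariationWords X φ V₂) φ m ≤
      periodicSum X φ (w.length + t + m + N) (cylinder X w) := by
  classical
  obtain ⟨N, hN⟩ := exists_periodicPoint hX hspec
  refine ⟨N, fun V₁ V₂ m w hw hn => ?_⟩
  have hfin := (finite_periodicPoints (X := X) hn).subset
    (Set.inter_subset_left (t := cylinder X w))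
  have hex : ∀ u : List A, ∃ x, u ∈ language X → x ∈ periodicPoints X (w.length + t + u.length + N) ∧
      initialWord x w.length = w ∧ initialWord (shift^[w.length + t] x) u.length = u := by
    intro u
    by_cases hu : u ∈ language X
    · obtain ⟨x, hx⟩ := hN w hw.1 u hu
      exact ⟨x, fun _ => hx⟩
    · obtain ⟨x, -⟩ := hX.nonempty
      exact ⟨x, fun h => absurd h hu⟩
  choose x hx using hex
  rw [periodicSum_eq_sum hfin, partitionSum_eq_sum, Finset.mul_sum]
  -- The word `u` is read off its periodic point at position `|w| + t`, whence injectivity. The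
  -- remaining `t + N` letters cost at most `(t + N) B`.
  refine sum_le_sum_of_injOn x ?_ ?_ ?_ ?_
  · intro u hu
    obtain ⟨huD, rfl⟩ := mem_wordsOfLength.1 hu
    obtain ⟨h1, h2, -⟩ := hx u huD.1
    rw [Set.Finite.mem_toFinset]
    exact ⟨h1, mem_cylinder_iff.2 ⟨h1.1, h2⟩⟩
  · intro u hu u' hu' heq
    obtain ⟨huD, hul⟩ := mem_wordsOfLength.1 hu
    obtain ⟨huD', hul'⟩ := mem_wordsOfLength.1 hu'
    rw [← (hx u huD.1).2.2, ← (hx u' huD'.1).2.2, heq, hul, hul']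
  · intro u hu
    obtain ⟨huD, rfl⟩ := mem_wordsOfLength.1 hu
    obtain ⟨h1, h2, h3⟩ := hx u huD.1
    rw [← Real.exp_add, Real.exp_le_exp, birkhoffSum_add, birkhoffSum_add, birkhoffSum_add]
    have h4 := supBirkhoff_sub_le hw (mem_cylinder_iff.2 ⟨h1.1, h2⟩)
    have h5 := supBirkhoff_sub_le huD
      (mem_cylinder_iff.2 ⟨hX.iterate_mem h1.1 (w.length + t), h3⟩)
    have h6 := (abs_le.1 (abs_birkhoffSum_le hB t (shift^[w.length] (x u)))).1
    have h7 := (abs_le.1 (abs_birkhoffSum_le hB N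
      (shift^[w.length + t + u.length] (x u)))).1
    linarith
  · intro y _
    positivity

/-- The shift permutes the points of period `n`, with inverse `shift^[n - 1]`, and `S_n φ` is
constant along a periodic orbit. -/
lemma periodicSum_preimage_shift (hX : IsSubshift X) {n : ℕ} (hn : 0 < n) (E : Set (ℕ → A)) :
    periodicSum X φ n (shift ⁻¹' E) = periodicSum X φ n E := by
  have hfin := finite_periodicPoints (X := X) hn
  rw [periodicSum_eq_sum (hfin.subset Set.inter_subset_left),
    periodicSum_eq_sum (hfin.subset Set.inter_subset_left)]
  obtain ⟨m, rfl⟩ := Nat.exists_eq_add_of_le' hn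
  have hit : ∀ x ∈ periodicPoints X (m + 1), shift^[m.succ] x = x := fun x hx => hx.2
  refine Finset.sum_nbij' shift shift^[m] ?_ ?_ ?_ ?_ ?_
  · intro x hx
    rw [Set.Finite.mem_toFinset] at *
    exact ⟨iterate_mem_periodicPoints hX hx.1 1, hx.2⟩
  · intro x hx
    rw [Set.Finite.mem_toFinset] at *
    refine ⟨iterate_mem_periodicPoints hX hx.1 m, ?_⟩
    rw [Set.mem_preimage, ← Function.iterate_succ_apply' shift, hit x hx.1]
    exact hx.2
  · intro x hx
    rw [Set.Finite.mem_toFinset] at *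
    rw [← Function.iterate_succ_apply, hit x hx.1]
  · intro x hx
    rw [Set.Finite.mem_toFinset] at *
    rw [← Function.iterate_succ_apply' shift, hit x hx.1]
  · intro x hx
    rw [Set.Finite.mem_toFinset] at *
    have := birkhoffSum_apply_sub_birkhoffSum shift φ (m + 1) x
    rw [hx.1.2, sub_self, sub_eq_zero] at this
    rw [this]

end PeriodicPoints

/-! ### Cylinders and measures carried by `X` -/

section Cylinders

variable {A : Type*} {X : Set (ℕ → A)}

lemma cylinder_nil : cylinder X [] = X := by
  ext x
  simp [mem_cylinder_iff]

lemma isClopen_cylinder_univ [TopologicalSpace A] [DiscreteTopology A] (w : List A) :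
    IsClopen (cylinder (Set.univ : Set (ℕ → A)) w) := by
  have : cylinder (Set.univ : Set (ℕ → A)) w =
      ⋂ i : Fin w.length, (fun x : ℕ → A => x i) ⁻¹' {w.get i} := by
    ext x
    simp [cylinder]
  rw [this]
  exact isClopen_iInter_of_finite fun i =>
    (isClopen_discrete _).preimage (continuous_apply _)

lemma cylinder_eq_inter (w : List A) : cylinder X w = X ∩ cylinder Set.univ w := by
  ext x
  simp [mem_cylinder_iff]

/-- Cylinders of the full shift are clopen there, so their measures pass to weak limits, whereas a
cylinder of `X` need not be open in the full shift. -/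
lemma measureReal_cylinder_univ [MeasurableSpace A] {μ : Measure (ℕ → A)} (hμ : μ Xᶜ = 0) (w : List A) :
    μ.real (cylinder Set.univ w) = μ.real (cylinder X w) := by
  rw [measureReal_def, measureReal_def]
  congr 1
  refine measure_congr ?_
  rw [cylinder_eq_inter (X := X), Set.inter_comm]
  exact (inter_ae_eq_left_of_ae_eq_univ (ae_eq_univ.2 hμ)).symm

/-- Since `X` is closed, its complement is covered by the countably many cylinders of words outside
the language. -/
lemma measure_compl_eq_zero [Finite A] [TopologicalSpace A] [DiscreteTopology A]
    [MeasurableSpace A] (hX : IsSubshift X) {μ : Measure (ℕ → A)}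
    (h : ∀ w ∉ language X, μ (cylinder Set.univ w) = 0) : μ Xᶜ = 0 := by
  have hsub : Xᶜ ⊆ ⋃ w : List A, ⋃ (_ : w ∉ language X), cylinder Set.univ w := by
    intro x hx
    by_contra hcon
    simp only [Set.mem_iUnion, not_exists] at hcon
    refine hx (hX.mem_of_initialWord_mem fun n => ⟨n, le_rfl, ?_⟩)
    by_contra hn
    exact hcon _ hn (mem_cylinder_initialWord (Set.mem_univ x) n)
  refine measure_mono_null hsub ?_
  exact measure_iUnion_null fun w => measure_iUnion_null fun hw => h w hw

lemma periodicSum_univ {φ : (ℕ → A) → ℝ} (n : ℕ) :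
    periodicSum X φ n Set.univ = periodicSum X φ n (cylinder X []) := by
  rw [periodicSum, periodicSum, cylinder_nil, Set.inter_univ,
    Set.inter_eq_left.2 fun x hx => hx.1]

lemma measurable_shift [MeasurableSpace A] : Measurable (shift : (ℕ → A) → ℕ → A) :=
  measurable_pi_lambda _ fun n => measurable_pi_apply (n + 1)

end Cylinders

/-! ### Gibbs bounds for periodic weights -/

section PeriodicGibbs

variable {A : Type*} [Finite A] [TopologicalSpace A] {X : Set (ℕ → A)} {φ : (ℕ → A) → ℝ} {B : ℝ}

lemma exists_periodicSum_cylinder_le (hX : IsSubshift X) (hB : ∀ x, |φ x| ≤ B)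
    (hC : ∃ C > 0, ∀ n : ℕ, partitionSum X (language X) φ n ≤ C * Real.exp (n * pressure X φ)) :
    ∃ C > 0, ∀ (w : List A) (n : ℕ), w.length ≤ n → 0 < n →
      periodicSum X φ n (cylinder X w) ≤
        C * Real.exp (supBirkhoff X φ w - w.length * pressure X φ) *
          Real.exp (n * pressure X φ) := by
  obtain ⟨C, hC0, hC⟩ := hC
  refine ⟨C, hC0, fun w n hwn hn => ?_⟩
  obtain ⟨m, rfl⟩ := Nat.exists_eq_add_of_le hwn
  refine (periodicSum_cylinder_le hX hB hn).trans ((mul_le_mul_of_nonneg_left (hC m)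
    (Real.exp_pos _).le).trans_eq ?_)
  rw [mul_left_comm, ← Real.exp_add, mul_assoc, ← Real.exp_add]
  push_cast
  ring_nf

/-- The free letters are filled with words of bounded variation, which carry at least half of `exp
(m P)`. The threshold `n₀` does not depend on `V`. -/
lemma exists_le_periodicSum_cylinder_of_boundedVariation [DiscreteTopology A] (hX : IsSubshift X)
    {t : ℕ} (hspec : SpecificationOn X (language X) t) (hB : ∀ x, |φ x| ≤ B)
    (hbad : ∀ η > 0, ∃ V, ∀ n : ℕ,
      partitionSum X (language X \ boundedVariationWords X φ V) φ n ≤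
        η * Real.exp (n * pressure X φ)) :
    ∃ n₀ : ℕ, ∀ V, ∃ c > 0, ∀ w ∈ boundedVariationWords X φ V, ∀ n, w.length + n₀ ≤ n → 0 < n →
      c * Real.exp (supBirkhoff X φ w - w.length * pressure X φ) *
          Real.exp (n * pressure X φ) ≤ periodicSum X φ n (cylinder X w) := by
  obtain ⟨N, hN⟩ := exists_le_periodicSum_cylinder (φ := φ) hX hspec hB
  obtain ⟨V₂, hV₂⟩ := exists_le_partitionSum_boundedVariationWords hX hB hbad
  refine ⟨t + N, fun V => ⟨1 / 2 * Real.exp (-(V + V₂ + (t + N) * B) - (t + N) * pressure X φ),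
    by positivity, fun w hw n hwn hn => ?_⟩⟩
  obtain ⟨m, rfl⟩ : ∃ m, n = w.length + t + m + N := ⟨n - (w.length + t + N), by omega⟩
  refine le_trans (Eq.le ?_) ((mul_le_mul_of_nonneg_left (hV₂ m) (Real.exp_pos _).le).trans
    (hN V V₂ m w hw hn))
  rw [mul_left_comm, ← Real.exp_add, mul_assoc, mul_assoc, ← Real.exp_add, ← Real.exp_add]
  push_cast
  ring_nf

end PeriodicGibbs

/-! ### Periodic orbit measures -/

section PeriodicMeasure

variable {A : Type*} [Finite A] [MeasurableSpace A] {X : Set (ℕ → A)} {φ : (ℕ → A) → ℝ}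

/-- The periodic orbit measures in terms of the weights of periodic points. -/
lemma periodicMeasure_apply {n : ℕ} (hn : 0 < n) {E : Set (ℕ → A)} (hE : MeasurableSet E) :
    periodicMeasure X φ n E =
      (ENNReal.ofReal (periodicSum X φ n Set.univ))⁻¹ * ENNReal.ofReal (periodicSum X φ n E) := by
  classical
  have hfin := finite_periodicPoints (X := X) hn
  have key : ∀ E : Set (ℕ → A), ENNReal.ofReal (periodicSum X φ n E) =
      ∑' x : periodicPoints X n, ENNReal.ofReal (Real.exp (birkhoffSum shift φ n x)) *
        E.indicator 1 (x : ℕ → A) := by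
    intro E
    rw [periodicSum_eq_sum (hfin.subset Set.inter_subset_left),
      ENNReal.ofReal_sum_of_nonneg fun _ _ => (Real.exp_pos _).le]
    have hF : periodicPoints X n = ↑hfin.toFinset := by simp
    have h2 : ∑' x : periodicPoints X n, ENNReal.ofReal (Real.exp (birkhoffSum shift φ n x)) *
        E.indicator 1 (x : ℕ → A) = ∑ x ∈ hfin.toFinset,
          ENNReal.ofReal (Real.exp (birkhoffSum shift φ n x)) * E.indicator 1 x := by
      rw [← Finset.tsum_subtype' hfin.toFinset fun x =>
        ENNReal.ofReal (Real.exp (birkhoffSum shift φ n x)) * E.indicator 1 x, ← hF]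
    rw [h2]
    have hsub : (hfin.subset (Set.inter_subset_left (t := E))).toFinset ⊆ hfin.toFinset := by
      simp
    rw [← Finset.sum_subset hsub fun x hx hxE => ?_]
    · refine Finset.sum_congr rfl fun x hx => ?_
      rw [Set.Finite.mem_toFinset] at hx
      simp [hx.2]
    · rw [Set.Finite.mem_toFinset] at hx hxE
      have hxE' : x ∉ E := fun h => hxE ⟨hx, h⟩
      simp [hxE']
  rw [periodicMeasure, Measure.smul_apply, Measure.sum_apply _ hE, smul_eq_mul, key E,
    key Set.univ]
  simp [Measure.dirac_apply' _ hE]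

lemma isProbabilityMeasure_periodicMeasure {n : ℕ} (hn : 0 < n)
    (h : 0 < periodicSum X φ n Set.univ) : IsProbabilityMeasure (periodicMeasure X φ n) := by
  refine ⟨?_⟩
  rw [periodicMeasure_apply hn MeasurableSet.univ]
  exact ENNReal.inv_mul_cancel (by simpa using h) ENNReal.ofReal_ne_top

lemma periodicMeasure_real_apply {n : ℕ} (hn : 0 < n)
    (h : 0 < periodicSum X φ n Set.univ)
    {E : Set (ℕ → A)} (hE : MeasurableSet E) :
    (periodicMeasure X φ n).real E = periodicSum X φ n E / periodicSum X φ n Set.univ := by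
  have h0 : 0 ≤ periodicSum X φ n E := 
    finsum_nonneg fun _ => finsum_nonneg fun _ => (Real.exp_pos _).le
  rw [measureReal_def, periodicMeasure_apply hn hE, ENNReal.toReal_mul, ENNReal.toReal_inv,
    ENNReal.toReal_ofReal h.le, ENNReal.toReal_ofReal h0, div_eq_inv_mul]

lemma map_shift_periodicMeasure [TopologicalSpace A] (hX : IsSubshift X) {n : ℕ} (hn : 0 < n) :
    (periodicMeasure X φ n).map shift = periodicMeasure X φ n := by
  ext E hE
  rw [Measure.map_apply measurable_shift hE, periodicMeasure_apply hn (measurable_shift hE),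
    periodicMeasure_apply hn hE, periodicSum_preimage_shift hX hn]

end PeriodicMeasure

/-! ### Limits of periodic orbit measures are Gibbs -/

section CylinderMeasure

variable {A : Type*} [Finite A] [TopologicalSpace A] [DiscreteTopology A]
  {X : Set (ℕ → A)} {φ : (ℕ → A) → ℝ} {B : ℝ}

variable [MeasurableSpace A] [BorelSpace A]

lemma measurableSet_cylinder (hX : IsSubshift X) (w : List A) : MeasurableSet (cylinder X w) := by
  rw [cylinder_eq_inter]
  exact hX.isClosed.measurableSet.inter (isClopen_cylinder_univ w).isOpen.measurableSet

variable {n : ℕ}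

lemma periodicMeasure_compl (hX : IsSubshift X) (hn : 0 < n) :
    periodicMeasure X φ n Xᶜ = 0 := by
  have : periodicPoints X n ∩ Xᶜ = ∅ := by
    ext x
    simp only [Set.mem_inter_iff, Set.mem_compl_iff, Set.mem_empty_iff_false, iff_false]
    exact fun h => h.2 h.1.1
  rw [periodicMeasure_apply hn hX.isClosed.measurableSet.compl,
    show periodicSum X φ n Xᶜ = 0 by rw [periodicSum, this]; simp]
  simp

/-- The Gibbs property: the upper bound for all words of the language, the lower bound for words
of bounded variation. -/
structure IsGibbs (X : Set (ℕ → A)) (φ : (ℕ → A) → ℝ) (μ : Measure (ℕ → A)) : Prop where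
  upper : ∃ K > 0, ∀ w ∈ language X, μ.real (cylinder X w) ≤
    K * Real.exp (supBirkhoff X φ w - w.length * pressure X φ)
  lower : ∀ V, ∃ K > 0, ∀ w ∈ boundedVariationWords X φ V,
    K * Real.exp (supBirkhoff X φ w - w.length * pressure X φ) ≤ μ.real (cylinder X w)

/-- Along an ultrafilter the periodic orbit measures converge to an invariant measure with the
Gibbs property. -/
lemma exists_tendsto_periodicMeasure (hX : IsSubshift X) {t : ℕ}
    (hspec : SpecificationOn X (language X) t) (hB : ∀ x, |φ x| ≤ B)
    (hC : ∃ C > 0, ∀ n : ℕ, partitionSum X (language X) φ n ≤ C * Real.exp (n * pressure X φ))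
    (hbad : ∀ η > 0, ∃ V, ∀ n : ℕ,
      partitionSum X (language X \ boundedVariationWords X φ V) φ n ≤
        η * Real.exp (n * pressure X φ))
    (U : Ultrafilter ℕ) (hU : (U : Filter ℕ) ≤ atTop) :
    ∃ μ : Measure (ℕ → A), μ ∈ invariantMeasures X ∧ IsGibbs X φ μ ∧
      ∀ f : (ℕ → A) → ℝ, Continuous f →
        Tendsto (fun n => ∫ x, f x ∂(periodicMeasure X φ n)) U (𝓝 (∫ x, f x ∂μ)) := by
  classical
  obtain ⟨C, hC0, hCle⟩ := exists_periodicSum_cylinder_le hX hB hC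
  obtain ⟨n₀, hlow⟩ := exists_le_periodicSum_cylinder_of_boundedVariation hX hspec hB hbad
  obtain ⟨c, hc0, hcle⟩ := hlow 0
  have hnil : ([] : List A) ∈ boundedVariationWords X φ 0 :=
    ⟨hX.nil_mem_language, fun x _ y _ => by simp⟩
  have hlowuniv : ∀ n, n₀ ≤ n → 0 < n →
      c * Real.exp (n * pressure X φ) ≤ periodicSum X φ n Set.univ := by
    intro n hn hn0
    have := hcle [] hnil n (by simpa using hn) hn0
    rw [periodicSum_univ]
    simpa [supBirkhoff_nil hX.nonempty] using this
  have hupuniv : ∀ n, 0 < n →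
      periodicSum X φ n Set.univ ≤ C * Real.exp (n * pressure X φ) := by
    intro n hn0
    have := hCle [] n (by simp) hn0
    rw [periodicSum_univ]
    simpa [supBirkhoff_nil hX.nonempty] using this
  have hpos : ∀ n, n₀ ≤ n → 0 < n → 0 < periodicSum X φ n Set.univ := fun n hn hn0 =>
    lt_of_lt_of_le (by positivity) (hlowuniv n hn hn0)
  obtain ⟨x₀, -⟩ := hX.nonempty
  let ν : ℕ → ProbabilityMeasure (ℕ → A) := fun n =>
    if h : IsProbabilityMeasure (periodicMeasure X φ n) then ⟨periodicMeasure X φ n, h⟩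
    else ⟨Measure.dirac x₀, inferInstance⟩
  have hν : ∀ n, n₀ ≤ n → 0 < n → (ν n : Measure (ℕ → A)) = periodicMeasure X φ n := by
    intro n hn hn0
    have := isProbabilityMeasure_periodicMeasure hn0 (hpos n hn hn0)
    have h1 : ν n = ⟨periodicMeasure X φ n, this⟩ := dif_pos this
    rw [h1]
    rfl
  have hevent : ∀ m : ℕ, ∀ᶠ n in (U : Filter ℕ), m ≤ n ∧ n₀ ≤ n ∧ 0 < n := fun m =>
    hU ((eventually_ge_atTop m).and ((eventually_ge_atTop n₀).and (eventually_gt_atTop 0)))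
  obtain ⟨μ, -, hμ⟩ := (isCompact_univ (X := ProbabilityMeasure (ℕ → A))).ultrafilter_le_nhds
    (U.map ν) (by simp)
  have hlim : Tendsto ν U (𝓝 μ) := hμ
  have hcyl : ∀ w : List A, Tendsto (fun n => (ν n : Measure (ℕ → A)).real (cylinder Set.univ w)) U
      (𝓝 ((μ : Measure (ℕ → A)).real (cylinder Set.univ w))) := by
    intro w
    have h1 := ProbabilityMeasure.tendsto_measure_of_null_frontier_of_tendsto' hlim
      (E := cylinder Set.univ w) (by simp [(isClopen_cylinder_univ w).frontier_eq])
    exact (ENNReal.tendsto_toReal (measure_ne_top _ _)).comp h1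
  have hsupp : ∀ n, n₀ ≤ n → 0 < n → (ν n : Measure (ℕ → A)) Xᶜ = 0 := fun n hn hn0 => by
    rw [hν n hn hn0]
    exact periodicMeasure_compl hX hn0
  have hval : ∀ w n, n₀ ≤ n → 0 < n → (ν n : Measure (ℕ → A)).real (cylinder Set.univ w) =
      periodicSum X φ n (cylinder X w) / periodicSum X φ n Set.univ := by
    intro w n hn hn0
    rw [measureReal_cylinder_univ (hsupp n hn hn0), hν n hn hn0,
      periodicMeasure_real_apply hn0 (hpos n hn hn0) (measurableSet_cylinder hX w)]
  have hμX : (μ : Measure (ℕ → A)) Xᶜ = 0 := by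
    refine measure_compl_eq_zero hX fun w hw => ?_
    have h0 : Tendsto (fun n => (ν n : Measure (ℕ → A)).real (cylinder Set.univ w)) U (𝓝 0) := by
      refine tendsto_const_nhds.congr' ?_
      filter_upwards [hevent 0] with n hn
      rw [measureReal_cylinder_univ (hsupp n hn.2.1 hn.2.2), Set.not_nonempty_iff_eq_empty.1 hw]
      simp
    have h1 := tendsto_nhds_unique (hcyl w) h0
    exact (measureReal_eq_zero_iff (measure_ne_top _ _)).1 h1
  refine ⟨μ, ⟨inferInstance, hμX, measurable_shift, ?_⟩, ⟨?_, fun V => ?_⟩, fun f hf => ?_⟩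
  · have h1 := ProbabilityMeasure.tendsto_map_of_tendsto_of_continuous ν μ hlim
      (continuous_shift (A := A))
    have h2 : Tendsto (fun n => (ν n).map (continuous_shift (A := A)).measurable.aemeasurable) U
        (𝓝 μ) := by
      refine hlim.congr' ?_
      filter_upwards [hevent 0] with n hn
      apply Subtype.ext
      change (ν n : Measure (ℕ → A)) = (ν n : Measure (ℕ → A)).map shift
      rw [hν n hn.2.1 hn.2.2, map_shift_periodicMeasure hX hn.2.2]
    have h3 := tendsto_nhds_unique h1 h2
    exact congrArg (fun m : ProbabilityMeasure (ℕ → A) => (m : Measure (ℕ → A))) h3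
  -- The upper bound for the weight of the cylinder over the lower bound for the total weight; `exp
  -- (n P)` cancels.
  · refine ⟨C / c, by positivity, fun w _ => ?_⟩
    rw [← measureReal_cylinder_univ hμX]
    refine le_of_tendsto (hcyl w) ?_
    filter_upwards [hevent w.length] with n hn
    rw [hval w n hn.2.1 hn.2.2, div_le_iff₀ (hpos n hn.2.1 hn.2.2)]
    refine (hCle w n hn.1 hn.2.2).trans ?_
    calc _ = C / c * Real.exp (supBirkhoff X φ w - w.length * pressure X φ) *
          (c * Real.exp (n * pressure X φ)) := by field_simp
      _ ≤ _ := mul_le_mul_of_nonneg_left (hlowuniv n hn.2.1 hn.2.2) (by positivity)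
  · obtain ⟨d, hd0, hd⟩ := hlow V
    refine ⟨d / C, by positivity, fun w hw => ?_⟩
    rw [← measureReal_cylinder_univ hμX]
    refine ge_of_tendsto (hcyl w) ?_
    filter_upwards [hevent (w.length + n₀)] with n hn
    rw [hval w n hn.2.1 hn.2.2, le_div_iff₀ (hpos n hn.2.1 hn.2.2)]
    refine le_trans ?_ (hd w hw n hn.1 hn.2.2)
    calc d / C * Real.exp (supBirkhoff X φ w - w.length * pressure X φ) *
          periodicSum X φ n Set.univ ≤
        d / C * Real.exp (supBirkhoff X φ w - w.length * pressure X φ) *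
          (C * Real.exp (n * pressure X φ)) :=
          mul_le_mul_of_nonneg_left (hupuniv n hn.2.2) (by positivity)
      _ = _ := by field_simp
  · have h1 := ProbabilityMeasure.tendsto_iff_forall_integral_tendsto.1 hlim
      (BoundedContinuousFunction.mkOfCompact ⟨f, hf⟩)
    refine h1.congr' ?_
    filter_upwards [hevent 0] with n hn
    rw [hν n hn.2.1 hn.2.2]
    rfl

end CylinderMeasure

/-! ### Gibbs' inequality for finite-valued maps -/

section FiniteValued

variable {Ω : Type*} [MeasurableSpace Ω] {μ : Measure Ω} {ι : Type*} [Fintype ι]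
  [MeasurableSpace ι] [MeasurableSingletonClass ι] {ξ : Ω → ι}

lemma integrable_comp_of_finite [IsFiniteMeasure μ] (hξ : Measurable ξ) (f : ι → ℝ) :
    Integrable (fun x => f (ξ x)) μ :=
  (Integrable.of_finite (μ := μ.map ξ) (f := f)).comp_measurable hξ

lemma integral_comp_eq_sum [IsFiniteMeasure μ] (hξ : Measurable ξ) (f : ι → ℝ) :
    ∫ x, f (ξ x) ∂μ = ∑ i, μ.real {x | ξ x = i} * f i := by
  rw [← integral_map (φ := ξ) hξ.aemeasurable
    (Integrable.of_finite (μ := μ.map ξ) (f := f)).aestronglyMeasurable,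
    integral_fintype Integrable.of_finite]
  refine Finset.sum_congr rfl fun i _ => ?_
  rw [map_measureReal_apply hξ (measurableSet_singleton i)]
  rfl

/-- The entropy of `ξ` is at most the cross entropy of a pair `(ξ, ζ)` with respect to any
subprobability vector. -/
lemma sum_negMulLog_le_integral [IsProbabilityMeasure μ] (hξ : Measurable ξ) {κ : Type*}
    [Fintype κ] [MeasurableSpace κ] [MeasurableSingletonClass κ] {ζ : Ω → κ} (hζ : Measurable ζ)
    (q : ι → κ → ℝ) (hq : ∀ i k, 0 ≤ q i k) (hpos : ∀ᵐ x ∂μ, 0 < q (ξ x) (ζ x))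
    (hsum : ∑ i, ∑ k, q i k ≤ 1) :
    ∑ i, Real.negMulLog (μ.real {x | ξ x = i}) ≤ ∫ x, -Real.log (q (ξ x) (ζ x)) ∂μ := by
  have hZ : Measurable fun x => (ξ x, ζ x) := hξ.prodMk hζ
  set p : ι → κ → ℝ := fun i k => μ.real {x | (ξ x, ζ x) = (i, k)} with hp
  have hp0 : ∀ i k, 0 ≤ p i k := fun i k => measureReal_nonneg
  have hmarg : ∀ i, μ.real {x | ξ x = i} = ∑ k, p i k := by
    intro i
    have h1 : {x | ξ x = i} = ⋃ k : κ, {x | (ξ x, ζ x) = (i, k)} := by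
      ext x
      simp
    rw [h1, measureReal_iUnion_fintype]
    · intro k k' hkk
      refine Set.disjoint_left.2 fun x hx hx' => hkk ?_
      simp only [Set.mem_ofPred_eq, Prod.mk.injEq] at hx hx'
      rw [← hx.2, hx'.2]
    · exact fun k => hZ (measurableSet_singleton (i, k))
  have hint : ∫ x, -Real.log (q (ξ x) (ζ x)) ∂μ = ∑ i, ∑ k, p i k * -Real.log (q i k) := by
    rw [integral_comp_eq_sum hZ (fun z => -Real.log (q z.1 z.2)), Fintype.sum_prod_type]
  have hptot : ∑ i, ∑ k, p i k = 1 := by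
    have h1 := integral_comp_eq_sum (μ := μ) hZ (fun _ => (1 : ℝ))
    rw [Fintype.sum_prod_type] at h1
    simp only [mul_one, integral_const, probReal_univ, smul_eq_mul] at h1
    exact h1.symm
  -- This is `log s ≤ s - 1` at `s = q / p`, together with the joint mass being at most its
  -- marginal. The corrections `q - p` sum to at most zero.
  have hterm : ∀ i k, -(p i k * Real.log (∑ k, p i k)) ≤
      p i k * -Real.log (q i k) + (q i k - p i k) := by
    intro i k
    rcases (hp0 i k).eq_or_lt with h0 | h0
    · rw [← h0]
      simpa using hq i k
    have hqpos : 0 < q i k := by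
      by_contra hcon
      have : μ {x | (ξ x, ζ x) = (i, k)} = 0 := by
        refine measure_mono_null (fun x hx => ?_) hpos
        simp only [Set.mem_ofPred_eq, Prod.mk.injEq] at hx
        simpa [hx.1, hx.2] using hcon
      simp only [hp, measureReal_def, this, ENNReal.toReal_zero, lt_self_iff_false] at h0
    have h1 : p i k ≤ ∑ k, p i k :=
      Finset.single_le_sum (f := p i) (fun k _ => hp0 i k) (Finset.mem_univ k)
    have h2 : Real.log (p i k) ≤ Real.log (∑ k, p i k) := Real.log_le_log h0 h1
    have h3 : Real.log (q i k / p i k) ≤ q i k / p i k - 1 :=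
      Real.log_le_sub_one_of_pos (by positivity)
    rw [Real.log_div hqpos.ne' h0.ne'] at h3
    have h4 : p i k * (q i k / p i k - 1) = q i k - p i k := by
      field_simp
    have h5 := mul_le_mul_of_nonneg_left h3 h0.le
    have h6 := mul_le_mul_of_nonneg_left h2 h0.le
    rw [h4] at h5
    linarith
  rw [hint]
  calc ∑ i, Real.negMulLog (μ.real {x | ξ x = i})
      = ∑ i, ∑ k, -(p i k * Real.log (∑ k, p i k)) := by
        refine Finset.sum_congr rfl fun i _ => ?_
        rw [hmarg i, Real.negMulLog, Finset.sum_neg_distrib, ← Finset.sum_mul, neg_mul]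
    _ ≤ ∑ i, ∑ k, (p i k * -Real.log (q i k) + (q i k - p i k)) :=
        Finset.sum_le_sum fun i _ => Finset.sum_le_sum fun k _ => hterm i k
    _ = ∑ i, ∑ k, p i k * -Real.log (q i k) + (∑ i, ∑ k, q i k - 1) := by
        simp only [Finset.sum_add_distrib, Finset.sum_sub_distrib]
        rw [hptot]
    _ ≤ _ := by linarith

end FiniteValued

/-! ### Approximation by functions of finitely many letters -/

section KolmogorovSinai

variable {A : Type*} [MeasurableSpace A]

lemma measurable_of_initialWord [Finite A] [MeasurableSingletonClass A] {κ : Type*} [MeasurableSpace κ]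
    {g : (ℕ → A) → κ} {N : ℕ}
    (hg : ∀ x y, initialWord x N = initialWord y N → g x = g y) : Measurable g := by
  rcases isEmpty_or_nonempty (ℕ → A) with h | h
  · exact measurable_of_empty g
  have hf : Function.FactorsThrough g fun (x : ℕ → A) (i : Fin N) => x i := by
    intro x y hxy
    refine hg x y (initialWord_eq_iff.2 fun i hi => ?_)
    exact congrFun hxy ⟨i, hi⟩
  have hr : Measurable fun (x : ℕ → A) (i : Fin N) => x i :=
    measurable_pi_lambda _ fun i => measurable_pi_apply _
  have he : g = (Function.extend (fun (x : ℕ → A) (i : Fin N) => x i) g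
      fun _ => g (Classical.arbitrary _)) ∘ fun (x : ℕ → A) (i : Fin N) => x i := by
    funext x
    exact (hf.extend_apply _ x).symm
  rw [he]
  exact Measurable.of_discrete.comp hr

/-- Measurable sets are approximated by sets that depend on finitely many letters. -/
lemma exists_initialWord_mem_approx (μ : Measure (ℕ → A)) [IsFiniteMeasure μ] {E : Set (ℕ → A)}
    (hE : MeasurableSet E) {ε : ℝ} (hε : 0 < ε) :
    ∃ a > 0, ∃ D : Set (List A), μ.real (symmDiff E {x | initialWord x a ∈ D}) < ε := by
  have hdense := Measure.MeasureDense.of_generateFrom_isSetAlgebra_finite μ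
    (isSetAlgebra_measurableCylinders (α := fun _ : ℕ => A)) generateFrom_measurableCylinders.symm
  obtain ⟨s, hs, h⟩ := hdense.approx E hE (measure_ne_top _ _) ε hε
  rw [measurableCylinders_nat] at hs
  simp only [Set.mem_iUnion, Set.mem_singleton_iff] at hs
  obtain ⟨a, S, -, rfl⟩ := hs
  set D : Set (List A) := {w | ∃ y ∈ MeasureTheory.cylinder (α := fun _ : ℕ => A) (Finset.Iic a) S,
    initialWord y (a + 1) = w} with hD
  have heq : {x | initialWord x (a + 1) ∈ D} =
      MeasureTheory.cylinder (α := fun _ : ℕ => A) (Finset.Iic a) S := by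
    ext x
    constructor
    · rintro ⟨y, hy, hyx⟩
      rw [initialWord_eq_iff] at hyx
      rw [mem_cylinder] at hy ⊢
      have : (Finset.Iic a).restrict x = (Finset.Iic a).restrict y := by
        funext j
        exact (hyx j (Nat.lt_succ_of_le (Finset.mem_Iic.1 j.2))).symm
      rwa [this]
    · exact fun hx => ⟨x, hx, rfl⟩
  refine ⟨a + 1, Nat.succ_pos a, D, ?_⟩
  rw [heq, measureReal_def, ← ENNReal.toReal_ofReal hε.le]
  exact (ENNReal.toReal_lt_toReal (measure_ne_top _ _) ENNReal.ofReal_ne_top).2 h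

/-- A measurable map to a finite set agrees, up to a set of small measure, with one that depends
on finitely many letters. -/
lemma exists_initialWord_approx (μ : Measure (ℕ → A)) [IsProbabilityMeasure μ] {k : ℕ}
    {ξ : (ℕ → A) → Fin k} (hξ : Measurable ξ) {ε : ℝ} (hε : 0 < ε) :
    ∃ (N : ℕ) (g : (ℕ → A) → Fin k), (∀ x y, initialWord x N = initialWord y N → g x = g y) ∧
      μ.real {x | ξ x ≠ g x} < ε := by
  classical
  obtain ⟨x₀⟩ : Nonempty (ℕ → A) := nonempty_of_isProbabilityMeasure μ
  have hk : 0 < k := (ξ x₀).pos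
  have happ : ∀ i : Fin k, ∃ a > 0, ∃ D : Set (List A),
      μ.real (symmDiff (ξ ⁻¹' {i}) {x | initialWord x a ∈ D}) < ε / k := fun i =>
    exists_initialWord_mem_approx μ (hξ (measurableSet_singleton i)) (by positivity)
  choose a _ D hμ using happ
  set s : Fin k → Set (ℕ → A) := fun i => {x | initialWord x (a i) ∈ D i} with hs_def
  have hs : ∀ i x y, initialWord x (a i) = initialWord y (a i) → (x ∈ s i ↔ y ∈ s i) := by
    intro i x y hxy
    simp only [hs_def, Set.mem_ofPred_eq, hxy]
  -- Some index `i` with `x ∈ s i` is chosen, if there is one; off the symmetric differences it can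
  -- only be `ξ x`.
  let c : Set (Fin k) → Fin k := fun T => if h : T.Nonempty then h.some else ξ x₀
  let g : (ℕ → A) → Fin k := fun x => c {i | x ∈ s i}
  refine ⟨∑ i, a i, g, fun x y hxy => ?_, ?_⟩
  · have : {i | x ∈ s i} = {i | y ∈ s i} := by
      ext i
      exact hs i x y (initialWord_eq_of_le hxy
        (Finset.single_le_sum (fun _ _ => Nat.zero_le _) (Finset.mem_univ i)))
    simp only [g, this]
  · have hsub : {x | ξ x ≠ g x} ⊆ ⋃ i, symmDiff (ξ ⁻¹' {i}) (s i) := by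
      intro x hx
      by_contra hcon
      simp only [Set.mem_iUnion, not_exists, Set.mem_symmDiff, Set.mem_preimage,
        Set.mem_singleton_iff] at hcon
      have hT : {i | x ∈ s i} = {ξ x} := by
        ext i
        have := hcon i
        simp only [Set.mem_ofPred_eq, Set.mem_singleton_iff]
        constructor
        · intro h
          by_contra h'
          exact this (Or.inr ⟨h, fun h'' => h' h''.symm⟩)
        · rintro rfl
          by_contra h'
          exact this (Or.inl ⟨rfl, h'⟩)
      apply hx
      have hne : ({ξ x} : Set (Fin k)).Nonempty := Set.singleton_nonempty _
      simp only [g, hT, c, dif_pos hne]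
      exact (Set.mem_singleton_iff.1 hne.some_mem).symm
    have h1 : μ.real {x | ξ x ≠ g x} ≤ ∑ i, μ.real (symmDiff (ξ ⁻¹' {i}) (s i)) :=
      (measureReal_mono hsub).trans (measureReal_iUnion_fintype_le _)
    refine h1.trans_lt ?_
    have hk' : (k : ℝ) ≠ 0 := by positivity
    calc ∑ i, μ.real (symmDiff (ξ ⁻¹' {i}) (s i)) < ∑ _i : Fin k, ε / k :=
          Finset.sum_lt_sum_of_nonempty ⟨ξ x₀, Finset.mem_univ _⟩ fun i _ => hμ i
      _ = ε := by
          simp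
          field_simp

end KolmogorovSinai

/-! ### Invariance under the shift -/

section Shift

variable {A : Type*}

lemma integral_shift_iterate [MeasurableSpace A] {μ : Measure (ℕ → A)} (hμ : MeasurePreserving shift μ μ)
    {f : (ℕ → A) → ℝ} (hf : AEStronglyMeasurable f μ) (i : ℕ) :
    ∫ x, f (shift^[i] x) ∂μ = ∫ x, f x ∂μ := by
  have h := hμ.iterate i
  conv_rhs => rw [← h.map_eq]
  rw [integral_map h.aemeasurable (by rwa [h.map_eq])]

lemma cylinder_univ_initialWord (x : ℕ → A) (m : ℕ) :
    cylinder Set.univ (initialWord x m) = {y | ∀ i : Fin m, y i = x i} := by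
  ext y
  rw [mem_cylinder_iff]
  simp only [Set.mem_univ, length_initialWord, initialWord_eq_iff, true_and, Set.mem_ofPred_eq]
  exact ⟨fun h i => h i i.2, fun h i hi => h ⟨i, hi⟩⟩

end Shift

/-! ### Entropy is bounded by the entropy of words -/

section KolmogorovSinaiTheorem

variable {A : Type*} [Finite A] [MeasurableSpace A] [MeasurableSingletonClass A]

/-- The join entropy of an arbitrary finite partition is bounded by the entropy of words of
length `m`. -/
lemma exists_joinEntropy_le {μ : Measure (ℕ → A)} [IsProbabilityMeasure μ]
    (hμ : MeasurePreserving shift μ μ) {k : ℕ} {ξ : (ℕ → A) → Fin k} (hξ : Measurable ξ)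
    {m : ℕ} (hm : 0 < m) {η : ℝ} (hη : 0 < η) :
    ∃ N : ℕ, ∀ n : ℕ, joinEntropy shift μ ξ n ≤
      (((n + N) / m + 1 : ℕ) : ℝ) *
        ∫ x, -Real.log (μ.real (cylinder Set.univ (initialWord x m))) ∂μ + n * (2 * η) := by
  classical
  have : Fintype A := Fintype.ofFinite A
  obtain ⟨x₀⟩ : Nonempty (ℕ → A) := nonempty_of_isProbabilityMeasure μ
  have hk : 0 < k := (ξ x₀).pos
  have hk1 : (1 : ℝ) ≤ k := by exact_mod_cast hk
  -- Chosen so that `-log (1 - ε) = η`, the cost where `ξ` and `g` agree. A disagreement costs `L =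
  -- -log (ε / k)`, so its measure is taken below `η / (L + 1)`.
  set ε := 1 - Real.exp (-η) with hε
  have hexp : Real.exp (-η) < 1 := by
    rw [Real.exp_lt_one_iff]
    linarith
  have hε0 : 0 < ε := by linarith
  have hε1 : 1 - ε = Real.exp (-η) := by rw [hε]; ring
  have hε2 : ε < 1 := by linarith [Real.exp_pos (-η)]
  set L := -Real.log (ε / k) with hL
  have hL0 : 0 ≤ L := by
    rw [hL, neg_nonneg]
    exact Real.log_nonpos (by positivity) ((div_le_one (by positivity)).2 (by linarith))
  obtain ⟨N, g, hg, hgμ⟩ := exists_initialWord_approx μ hξ (show 0 < η / (L + 1) by positivity)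
  have hgm : Measurable g := measurable_of_initialWord hg
  -- A noisy channel that predicts `ξ` from `g` and keeps some mass for every wrong value.
  let κ : Fin k → Fin k → ℝ := fun a b => if a = b then 1 - ε else ε / k
  have hκ0 : ∀ a b, 0 < κ a b := by
    intro a b
    simp only [κ]
    split_ifs
    · rw [hε1]
      exact Real.exp_pos _
    · positivity
  have hκsum : ∀ b, ∑ a, κ a b ≤ 1 := by
    intro b
    have h1 : ∀ a, κ a b ≤ (if a = b then 1 - ε else 0) + ε / k := by
      intro a
      simp only [κ]
      split_ifs
      · have : 0 ≤ ε / k := by positivity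
        linarith
      · linarith
    refine (Finset.sum_le_sum fun a _ => h1 a).trans ?_
    rw [Finset.sum_add_distrib, Finset.sum_ite_eq' Finset.univ b]
    simp only [Finset.mem_univ, if_true, Finset.sum_const, Finset.card_univ, Fintype.card_fin,
      nsmul_eq_mul]
    rw [mul_div_cancel₀ _ (by positivity)]
    linarith
  have hδ : ∫ x, -Real.log (κ (ξ x) (g x)) ∂μ ≤ 2 * η := by
    have hmeas : MeasurableSet {x | ξ x ≠ g x} := (measurableSet_eq_fun hξ hgm).compl
    have h1 : ∀ x, -Real.log (κ (ξ x) (g x)) ≤ η + {x | ξ x ≠ g x}.indicator (fun _ => L) x := by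
      intro x
      by_cases hx : ξ x = g x
      · rw [Set.indicator_of_notMem (by simpa using hx)]
        simp [κ, hx, hε1]
      · rw [Set.indicator_of_mem (show x ∈ {x | ξ x ≠ g x} from hx)]
        simp only [κ, if_neg hx]
        linarith
    have hi1 : Integrable (fun x => -Real.log (κ (ξ x) (g x))) μ :=
      integrable_comp_of_finite (hξ.prodMk hgm) fun z => -Real.log (κ z.1 z.2)
    have hi2 : Integrable ({x | ξ x ≠ g x}.indicator fun _ => L) μ :=
      (integrable_const L).indicator hmeas
    refine (integral_mono hi1 ((integrable_const η).add hi2) h1).trans ?_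
    simp only [Pi.add_apply]
    rw [integral_add (integrable_const η) hi2, integral_indicator hmeas, setIntegral_const,
      integral_const, probReal_univ, one_smul, smul_eq_mul]
    have h2 : μ.real {x | ξ x ≠ g x} * L ≤ η / (L + 1) * (L + 1) :=
      mul_le_mul hgμ.le (by linarith) hL0 (by positivity)
    rw [div_mul_cancel₀ _ (by positivity)] at h2
    linarith
  let r : (Fin m → A) → ℝ := fun b => μ.real {x : ℕ → A | (fun i : Fin m => x i) = b}
  have hrest : Measurable fun (x : ℕ → A) (i : Fin m) => x i :=
    measurable_pi_lambda _ fun i => measurable_pi_apply _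
  have hr0 : ∀ b, 0 ≤ r b := fun b => measureReal_nonneg
  have hrsum : ∑ b, r b = 1 := by
    have h1 := integral_comp_eq_sum (μ := μ) hrest fun _ => (1 : ℝ)
    simp only [mul_one, integral_const, probReal_univ, smul_eq_mul] at h1
    exact h1.symm
  have hrae : ∀ᵐ x ∂μ, 0 < r fun i : Fin m => x i := by
    have h1 : {x : ℕ → A | ¬ 0 < r fun i : Fin m => x i} ⊆
        ⋃ b : Fin m → A, ⋃ (_ : r b = 0), {x : ℕ → A | (fun i : Fin m => x i) = b} := by
      intro x hx
      simp only [Set.mem_iUnion]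
      exact ⟨_, le_antisymm (not_lt.1 hx) (hr0 _), rfl⟩
    refine measure_mono_null h1 (measure_iUnion_null fun b => measure_iUnion_null fun hb => ?_)
    exact (measureReal_eq_zero_iff (measure_ne_top _ _)).1 hb
  have hrH : ∀ x : ℕ → A, μ.real (cylinder Set.univ (initialWord x m)) =
      r fun i : Fin m => x i := by
    intro x
    rw [cylinder_univ_initialWord]
    simp only [r, funext_iff]
  simp only [hrH]
  refine ⟨N, fun n => ?_⟩
  -- Enough blocks of length `m` to evaluate `g`, which reads `N` letters, at the first `n` shifts.
  set J := (n + N) / m + 1 with hJ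
  have hJm : n + N ≤ J * m := by
    rw [hJ, add_mul, one_mul]
    have := Nat.div_add_mod (n + N) m
    have h2 := Nat.mod_lt (n + N) hm
    have h3 : m * ((n + N) / m) = (n + N) / m * m := mul_comm _ _
    omega
  let ζ : (ℕ → A) → Fin J → Fin m → A := fun x j i => x (j * m + i)
  have hζ : Measurable ζ := measurable_pi_lambda _ fun j => measurable_pi_lambda _ fun i =>
    measurable_pi_apply _
  have hζx : ∀ x y, ζ x = ζ y → ∀ i < J * m, x i = y i := by
    intro x y hxy i hi
    have h1 : i / m < J := Nat.div_lt_of_lt_mul (by rwa [mul_comm] at hi)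
    have h2 := congrFun (congrFun hxy ⟨i / m, h1⟩) ⟨i % m, Nat.mod_lt _ hm⟩
    have h3 : i / m * m + i % m = i := Nat.div_add_mod' i m
    simpa only [ζ, h3] using h2
  let G : Fin n → (Fin J → Fin m → A) → Fin k := fun i =>
    Function.extend ζ (fun x => g (shift^[(i : ℕ)] x)) fun _ => ξ x₀
  have hG : ∀ i x, G i (ζ x) = g (shift^[(i : ℕ)] x) := by
    intro i x
    have hf : Function.FactorsThrough (fun x => g (shift^[(i : ℕ)] x)) ζ := by
      intro x y hxy
      refine hg _ _ (initialWord_eq_iff.2 fun j hj => ?_)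
      rw [shift_iterate_apply, shift_iterate_apply]
      exact hζx x y hxy _ (by have := i.2; omega)
    exact hf.extend_apply _ x
  let ξn : (ℕ → A) → Fin n → Fin k := fun x i => ξ (shift^[(i : ℕ)] x)
  have hξn : Measurable ξn := measurable_pi_lambda _ fun i =>
    hξ.comp (measurable_shift.iterate _)
  -- The blocks are coded as if independent, each with the law of words of length `m`, and `ξ` is
  -- then coded from `g` through the channel. By invariance the cross entropy is `J` word entropies
  -- plus `n` channel costs, so conditional entropy is not needed.
  let q : (Fin n → Fin k) → (Fin J → Fin m → A) → ℝ := fun s w =>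
    (∏ j, r (w j)) * ∏ i, κ (s i) (G i w)
  have hq0 : ∀ s w, 0 ≤ q s w := fun s w =>
    mul_nonneg (Finset.prod_nonneg fun j _ => hr0 _) (Finset.prod_nonneg fun i _ => (hκ0 _ _).le)
  have hqsum : ∑ s, ∑ w, q s w ≤ 1 := by
    rw [Finset.sum_comm]
    have h1 : ∀ w, ∑ s : Fin n → Fin k, q s w ≤ ∏ j, r (w j) := by
      intro w
      simp only [q]
      rw [← Finset.mul_sum]
      have h2 : ∑ s : Fin n → Fin k, ∏ i, κ (s i) (G i w) = ∏ i, ∑ a, κ a (G i w) := by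
        rw [Finset.prod_univ_sum, Fintype.piFinset_univ]
      rw [h2]
      refine mul_le_of_le_one_right (Finset.prod_nonneg fun j _ => hr0 _) ?_
      exact Finset.prod_le_one (fun i _ => Finset.sum_nonneg fun a _ => (hκ0 _ _).le)
        fun i _ => hκsum _
    refine (Finset.sum_le_sum fun w _ => h1 w).trans_eq ?_
    have h3 : ∑ w : Fin J → Fin m → A, ∏ j, r (w j) = ∏ _j : Fin J, ∑ b, r b := by
      rw [Finset.prod_univ_sum, Fintype.piFinset_univ]
    rw [h3, hrsum, Finset.prod_const_one]
  have hblock : ∀ x (j : Fin J), ζ x j = fun i : Fin m => (shift^[(j : ℕ) * m] x) i := by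
    intro x j
    funext i
    rw [shift_iterate_apply]
  have hae : ∀ᵐ x ∂μ, ∀ j, 0 < r (ζ x j) := by
    rw [ae_all_iff]
    intro j
    simp only [hblock]
    exact (hμ.iterate (j * m)).quasiMeasurePreserving.ae hrae
  have hpos : ∀ᵐ x ∂μ, 0 < q (ξn x) (ζ x) := by
    filter_upwards [hae] with x hx
    exact mul_pos (Finset.prod_pos fun j _ => hx j) (Finset.prod_pos fun i _ => hκ0 _ _)
  have hmain := sum_negMulLog_le_integral hξn hζ q hq0 hpos hqsum
  have hjoin : joinEntropy shift μ ξ n = ∑ s, Real.negMulLog (μ.real {x | ξn x = s}) := by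
    simp only [joinEntropy, ξn, funext_iff]
  rw [hjoin]
  refine hmain.trans ?_
  have hlog : ∀ᵐ x ∂μ, -Real.log (q (ξn x) (ζ x)) =
      ∑ j : Fin J, -Real.log (r fun i : Fin m => (shift^[(j : ℕ) * m] x) i) +
      ∑ i : Fin n, -Real.log (κ (ξ (shift^[(i : ℕ)] x)) (g (shift^[(i : ℕ)] x))) := by
    filter_upwards [hae] with x hx
    simp only [q]
    rw [Real.log_mul (Finset.prod_pos fun j _ => hx j).ne'
      (Finset.prod_pos fun i _ => hκ0 _ _).ne', Real.log_prod fun j _ => (hx j).ne',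
      Real.log_prod fun i _ => (hκ0 _ _).ne', neg_add, Finset.sum_neg_distrib,
      Finset.sum_neg_distrib]
    simp only [hG, hblock, ξn]
  have hir : Integrable (fun x : ℕ → A => -Real.log (r fun i : Fin m => x i)) μ :=
    integrable_comp_of_finite hrest fun b => -Real.log (r b)
  have hiκ : Integrable (fun x => -Real.log (κ (ξ x) (g x))) μ :=
    integrable_comp_of_finite (hξ.prodMk hgm) fun z => -Real.log (κ z.1 z.2)
  have hir' : ∀ j : Fin J, Integrable
      (fun x => -Real.log (r fun i : Fin m => (shift^[(j : ℕ) * m] x) i)) μ := fun j =>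
    (hμ.iterate (j * m)).integrable_comp_of_integrable hir
  have hiκ' : ∀ i : Fin n, Integrable
      (fun x => -Real.log (κ (ξ (shift^[(i : ℕ)] x)) (g (shift^[(i : ℕ)] x)))) μ := fun i =>
    (hμ.iterate i).integrable_comp_of_integrable hiκ
  rw [integral_congr_ae hlog, integral_add (integrable_finsetSum _ fun j _ => hir' j)
    (integrable_finsetSum _ fun i _ => hiκ' i), integral_finsetSum _ fun j _ => hir' j,
    integral_finsetSum _ fun i _ => hiκ' i]
  refine add_le_add (le_of_eq ?_) ?_
  · have h (j : Fin J) : ∫ x, -Real.log (r fun i : Fin m => (shift^[(j : ℕ) * m] x) i) ∂μ =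
        ∫ x, -Real.log (r fun i : Fin m => x i) ∂μ :=
      integral_shift_iterate hμ hir.aestronglyMeasurable (j * m)
    simp [h]
  · have h (i : Fin n) :
        ∫ x, -Real.log (κ (ξ (shift^[(i : ℕ)] x)) (g (shift^[(i : ℕ)] x))) ∂μ =
          ∫ x, -Real.log (κ (ξ x) (g x)) ∂μ :=
      integral_shift_iterate hμ hiκ.aestronglyMeasurable i
    simp only [h, Finset.sum_const, Finset.card_univ, Fintype.card_fin, nsmul_eq_mul]
    exact mul_le_mul_of_nonneg_left hδ (Nat.cast_nonneg n)

/-- The entropy of a shift-invariant measure is at most the normalized entropy of words of any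
given length. -/
lemma measureEntropy_le {μ : Measure (ℕ → A)} [IsProbabilityMeasure μ]
    (hμ : MeasurePreserving shift μ μ) {m : ℕ} (hm : 0 < m) :
    measureEntropy shift μ ≤
      (((∫ x, -Real.log (μ.real (cylinder Set.univ (initialWord x m))) ∂μ) / m : ℝ) : EReal) := by
  set H := ∫ x, -Real.log (μ.real (cylinder Set.univ (initialWord x m))) ∂μ with hH
  have hm' : (0 : ℝ) < m := by exact_mod_cast hm
  have hH0 : 0 ≤ H := integral_nonneg fun x =>
    neg_nonneg.2 (Real.log_nonpos measureReal_nonneg measureReal_le_one)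
  refine iSup_le fun k => iSup_le fun ξ => iSup_le fun hξ => ?_
  -- Two `η` come from the channel; the third absorbs the bounded excess in the number of blocks.
  have key : ∀ η > 0, limsup (fun n : ℕ => ((joinEntropy shift μ ξ n / n : ℝ) : EReal)) atTop ≤
      ((H / m + 3 * η : ℝ) : EReal) := by
    intro η hη
    obtain ⟨N, hN⟩ := exists_joinEntropy_le hμ hξ hm hη
    refine limsup_le_of_le (by isBoundedDefault) ?_
    filter_upwards [eventually_gt_atTop 0, (tendsto_natCast_atTop_atTop.const_mul_atTop
      hη).eventually_ge_atTop ((N / m + 1) * H)] with n hn0 hn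
    rw [EReal.coe_le_coe_iff]
    have hn' : (0 : ℝ) < n := by exact_mod_cast hn0
    rw [div_le_iff₀ hn']
    refine (hN n).trans ?_
    have h1 : (((n + N) / m + 1 : ℕ) : ℝ) ≤ ((n : ℝ) + N) / m + 1 := by
      have := @Nat.cast_div_le ℝ _ _ _ (n + N) m
      push_cast at this ⊢
      linarith
    have h2 := mul_le_mul_of_nonneg_right h1 hH0
    have h3 : (((n : ℝ) + N) / m + 1) * H = H / m * n + (N / m + 1) * H := by
      field_simp
      ring
    linarith
  have hcont : Tendsto (fun η : ℝ => ((H / m + 3 * η : ℝ) : EReal)) (𝓝[>] 0)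
      (𝓝 ((H / m : ℝ) : EReal)) := by
    have h1 : Continuous fun η : ℝ => ((H / m + 3 * η : ℝ) : EReal) :=
      continuous_coe_real_ereal.comp (by fun_prop)
    have h2 := (h1.tendsto 0).mono_left (nhdsWithin_le_nhds (s := Set.Ioi 0))
    simpa using h2
  exact ge_of_tendsto hcont (by filter_upwards [self_mem_nhdsWithin] with η hη using key η hη)

end KolmogorovSinaiTheorem

/-! ### Integrals as sums over words -/

section WordSums

variable {A : Type*} [Finite A] [TopologicalSpace A] [DiscreteTopology A] [MeasurableSpace A]
  [BorelSpace A] {X : Set (ℕ → A)} {φ : (ℕ → A) → ℝ} {B : ℝ} {μ : Measure (ℕ → A)}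

lemma integral_initialWord [IsFiniteMeasure μ] (hX : IsSubshift X) (hμX : μ Xᶜ = 0) (n : ℕ)
    (f : List A → ℝ) : ∫ x, f (initialWord x n) ∂μ =
      ∑ w ∈ wordsOfLength (language X) n, μ.real (cylinder X w) * f w := by
  have hae : ∀ᵐ x ∂μ, f (initialWord x n) =
      ∑ w ∈ wordsOfLength (language X) n, (cylinder X w).indicator (fun _ => f w) x := by
    have hx : ∀ᵐ x ∂μ, x ∈ X := hμX
    filter_upwards [hx] with x hx
    rw [Finset.sum_eq_single (initialWord x n)]
    · rw [Set.indicator_of_mem (mem_cylinder_initialWord hx n)]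
    · intro w hw hne
      refine Set.indicator_of_notMem (fun hxw => hne ?_) _
      rw [← (mem_cylinder_iff.1 hxw).2, (mem_wordsOfLength.1 hw).2]
    · intro h
      exact absurd (by simpa using initialWord_mem_language hx n) h
  rw [integral_congr_ae hae, integral_finsetSum _ fun w _ =>
    (integrable_const _).indicator (measurableSet_cylinder hX w)]
  refine Finset.sum_congr rfl fun w _ => ?_
  rw [integral_indicator_const _ (measurableSet_cylinder hX w), smul_eq_mul]

lemma measurableSet_initialWord_mem (n : ℕ) (D : Set (List A)) :
    MeasurableSet {x : ℕ → A | initialWord x n ∈ D} := by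
  classical
  have hm : Measurable fun x : ℕ → A => initialWord x n ∈ D :=
    measurable_of_initialWord (N := n) fun x y h => by rw [h]
  exact measurableSet_setOfPred.2 hm

lemma measureReal_initialWord_mem [IsFiniteMeasure μ] (hX : IsSubshift X) (hμX : μ Xᶜ = 0) (n : ℕ)
    (D : Set (List A)) : μ.real {x | initialWord x n ∈ D} =
      ∑ w ∈ wordsOfLength (language X ∩ D) n, μ.real (cylinder X w) := by
  classical
  have h1 := integral_initialWord (μ := μ) hX hμX n (D.indicator fun _ => 1)
  have h2 : ∀ x : ℕ → A, D.indicator (fun _ => (1 : ℝ)) (initialWord x n) =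
      {x | initialWord x n ∈ D}.indicator (fun _ => 1) x := fun x => rfl
  simp only [h2] at h1
  rw [integral_indicator_const _ (measurableSet_initialWord_mem n D), smul_eq_mul, mul_one] at h1
  rw [h1]
  refine (Finset.sum_subset (fun w hw => ?_) fun w hw hwD => ?_).symm.trans
    (Finset.sum_congr rfl fun w hw => ?_)
  · rw [mem_wordsOfLength] at *
    exact ⟨hw.1.1, hw.2⟩
  · rw [mem_wordsOfLength] at *
    have : w ∉ D := fun h => hwD ⟨⟨hw.1, h⟩, hw.2⟩
    simp [this]
  · simp [(mem_wordsOfLength.1 hw).1.2]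

lemma sum_measureReal_cylinder [IsProbabilityMeasure μ] (hX : IsSubshift X) (hμX : μ Xᶜ = 0)
    (n : ℕ) : ∑ w ∈ wordsOfLength (language X) n, μ.real (cylinder X w) = 1 := by
  have := measureReal_initialWord_mem hX hμX n Set.univ
  simpa using this.symm

lemma integrable_of_abs_le [IsFiniteMeasure μ] (hφ : Continuous φ) (hB : ∀ x, |φ x| ≤ B) :
    Integrable φ μ :=
  Integrable.of_bound hφ.aestronglyMeasurable B (Eventually.of_forall hB)

lemma integral_birkhoffSum [IsFiniteMeasure μ] (hμ : MeasurePreserving shift μ μ)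
    (hφ : Continuous φ) (hB : ∀ x, |φ x| ≤ B) (n : ℕ) :
    ∫ x, birkhoffSum shift φ n x ∂μ = n * ∫ x, φ x ∂μ := by
  have hi := integrable_of_abs_le (μ := μ) hφ hB
  simp only [birkhoffSum]
  have hi' (i : ℕ) : Integrable (fun x => φ (shift^[i] x)) μ :=
    (hμ.iterate i).integrable_comp_of_integrable hi
  rw [integral_finsetSum _ fun i _ => hi' i]
  have h (i : ℕ) : ∫ x, φ (shift^[i] x) ∂μ = ∫ x, φ x ∂μ :=
    integral_shift_iterate hμ hi.aestronglyMeasurable i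
  simp [h]

lemma integrable_birkhoffSum [IsFiniteMeasure μ] (hμ : MeasurePreserving shift μ μ)
    (hφ : Continuous φ) (hB : ∀ x, |φ x| ≤ B) (n : ℕ) :
    Integrable (fun x => birkhoffSum shift φ n x) μ :=
  integrable_finsetSum _ fun i _ =>
    (hμ.iterate i).integrable_comp_of_integrable (integrable_of_abs_le hφ hB)

lemma integrable_initialWord [IsFiniteMeasure μ] (n : ℕ) (f : List A → ℝ) :
    Integrable (fun x => f (initialWord x n)) μ := by
  have : Fintype A := Fintype.ofFinite A
  have hr : Measurable fun (x : ℕ → A) (i : Fin n) => x i :=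
    measurable_pi_lambda _ fun i => measurable_pi_apply _
  have h := integrable_comp_of_finite (μ := μ) hr fun b => f (List.ofFn b)
  refine h.congr (Eventually.of_forall fun x => ?_)
  simp only [initialWord]
  congr 1
  apply List.ext_getElem (by simp)
  intro i h1 h2
  simp

lemma mul_integral_le_sum [IsProbabilityMeasure μ] (hX : IsSubshift X) (hμX : μ Xᶜ = 0)
    (hμ : MeasurePreserving shift μ μ) (hφ : Continuous φ) (hB : ∀ x, |φ x| ≤ B) (n : ℕ) :
    n * ∫ x, φ x ∂μ ≤
      ∑ w ∈ wordsOfLength (language X) n, μ.real (cylinder X w) * supBirkhoff X φ w := by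
  rw [← integral_initialWord hX hμX n, ← integral_birkhoffSum hμ hφ hB n]
  refine integral_mono_ae (integrable_birkhoffSum hμ hφ hB n) (integrable_initialWord n _) ?_
  have hx : ∀ᵐ x ∂μ, x ∈ X := hμX
  filter_upwards [hx] with x hx
  have := birkhoffSum_le_supBirkhoff (φ := φ) hB (mem_cylinder_initialWord hx n)
  simpa using this

/-- On a cylinder the supremum exceeds any Birkhoff sum by at most `ε n + C`, which is negligible
after division by `n` and `ε → 0`. -/
lemma sum_le_mul_integral [IsProbabilityMeasure μ] (hX : IsSubshift X) (hμX : μ Xᶜ = 0)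
    (hμ : MeasurePreserving shift μ μ) (hφ : Continuous φ) (hB : ∀ x, |φ x| ≤ B) {ε : ℝ}
    (hε : 0 < ε) : ∃ C, ∀ n : ℕ,
      ∑ w ∈ wordsOfLength (language X) n, μ.real (cylinder X w) * supBirkhoff X φ w ≤
        n * ∫ x, φ x ∂μ + ε * n + C := by
  obtain ⟨C, hC⟩ := exists_abs_birkhoffSum_sub_le hφ hB hε
  refine ⟨C, fun n => ?_⟩
  rw [← integral_initialWord hX hμX n, ← integral_birkhoffSum hμ hφ hB n]
  have hi := integrable_birkhoffSum hμ hφ hB n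
  have h1 : ∫ x, supBirkhoff X φ (initialWord x n) ∂μ ≤
      ∫ x, (birkhoffSum shift φ n x + (ε * n + C)) ∂μ := by
    refine integral_mono_ae (integrable_initialWord n _) (hi.add (integrable_const _)) ?_
    have hx : ∀ᵐ x ∂μ, x ∈ X := hμX
    filter_upwards [hx] with x hx
    refine supBirkhoff_le (initialWord_mem_language hx n) fun y hy => ?_
    have := hC n y x (by simpa using (mem_cylinder_iff.1 hy).2)
    rw [length_initialWord]
    linarith [(abs_le.1 this).2]
  rw [integral_add hi (integrable_const _)] at h1
  simp only [integral_const, probReal_univ, one_smul] at h1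
  linarith

end WordSums

/-! ### The variational principle -/

section VariationalPrinciple

variable {A : Type*} [Finite A] [TopologicalSpace A] [DiscreteTopology A] [MeasurableSpace A]
  [BorelSpace A] {X : Set (ℕ → A)} {φ : (ℕ → A) → ℝ} {B : ℝ} {μ ν : Measure (ℕ → A)}

/-- The bound holds at each single length, not only in the limit; the uniqueness estimate relies on
this. -/
lemma freeEnergy_le_sum (hX : IsSubshift X) (hφ : Continuous φ) (hB : ∀ x, |φ x| ≤ B)
    (hν : ν ∈ invariantMeasures X) {m : ℕ} (hm : 0 < m) :
    freeEnergy φ ν ≤ (((∑ w ∈ wordsOfLength (language X) m, ν.real (cylinder X w) *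
      (supBirkhoff X φ w - Real.log (ν.real (cylinder X w)))) / m : ℝ) : EReal) := by
  obtain ⟨hprob, hνX, hinv⟩ := hν
  have hm' : (0 : ℝ) < m := by exact_mod_cast hm
  have h1 := measureEntropy_le hinv hm
  rw [integral_initialWord hX hνX m fun w => -Real.log (ν.real (cylinder Set.univ w))] at h1
  have h2 := mul_integral_le_sum hX hνX hinv hφ hB m
  refine (add_le_add_left h1 _).trans ?_
  rw [← EReal.coe_add, EReal.coe_le_coe_iff, le_div_iff₀ hm', add_mul, div_mul_cancel₀ _ hm'.ne']
  simp only [measureReal_cylinder_univ hνX, mul_sub, Finset.sum_sub_distrib, mul_neg,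
    Finset.sum_neg_distrib]
  linarith

/-- Gibbs' inequality against the weights `exp (φ_m(w)) / Λ_m` bounds the sum over words by `log
Λ_m`. -/
lemma freeEnergy_le_pressure (hX : IsSubshift X) (hφ : Continuous φ) (hB : ∀ x, |φ x| ≤ B)
    (hν : ν ∈ invariantMeasures X) : freeEnergy φ ν ≤ (pressure X φ : EReal) := by
  have hlim : Tendsto (fun n : ℕ =>
      ((Real.log (partitionSum X (language X) φ n) / n : ℝ) : EReal)) atTop
      (𝓝 (pressure X φ : EReal)) :=
    (continuous_coe_real_ereal.tendsto _).comp (tendsto_pressure hX hB)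
  refine ge_of_tendsto hlim ?_
  filter_upwards [eventually_gt_atTop 0] with m hm
  refine (freeEnergy_le_sum hX hφ hB hν hm).trans ?_
  have := hν.1
  rw [EReal.coe_le_coe_iff]
  refine div_le_div_of_nonneg_right ?_ (Nat.cast_nonneg m)
  set Λ := partitionSum X (language X) φ m with hΛ
  have hΛ0 : 0 < Λ := partitionSum_language_pos hX m
  have hterm : ∀ w ∈ wordsOfLength (language X) m, ν.real (cylinder X w) *
      (supBirkhoff X φ w - Real.log (ν.real (cylinder X w))) ≤
      ν.real (cylinder X w) * Real.log Λ +
        (Real.exp (supBirkhoff X φ w) / Λ - ν.real (cylinder X w)) := by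
    intro w _
    rcases (measureReal_nonneg (μ := ν) (s := cylinder X w)).eq_or_lt with h0 | h0
    · rw [← h0]
      simp only [zero_mul, sub_zero, zero_add]
      positivity
    · have h3 : Real.log (Real.exp (supBirkhoff X φ w) / Λ / ν.real (cylinder X w)) ≤
          Real.exp (supBirkhoff X φ w) / Λ / ν.real (cylinder X w) - 1 :=
        Real.log_le_sub_one_of_pos (by positivity)
      rw [Real.log_div (by positivity) h0.ne', Real.log_div (Real.exp_pos _).ne' hΛ0.ne',
        Real.log_exp] at h3
      have h5 := mul_le_mul_of_nonneg_left h3 h0.le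
      have h4 : ν.real (cylinder X w) *
          (Real.exp (supBirkhoff X φ w) / Λ / ν.real (cylinder X w) - 1) =
          Real.exp (supBirkhoff X φ w) / Λ - ν.real (cylinder X w) := by
        rw [mul_sub, mul_div_cancel₀ _ h0.ne', mul_one]
      rw [h4] at h5
      linarith
  refine (Finset.sum_le_sum hterm).trans ?_
  rw [Finset.sum_add_distrib, Finset.sum_sub_distrib, ← Finset.sum_mul, ← Finset.sum_div,
    ← partitionSum_eq_sum, sum_measureReal_cylinder hX hν.2.1, ← hΛ, div_self hΛ0.ne']
  linarith

/-- A measure with the upper Gibbs bound has free energy at least the pressure. -/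
lemma IsGibbs.pressure_le_freeEnergy (h : IsGibbs X φ μ) (hX : IsSubshift X) (hφ : Continuous φ)
    (hB : ∀ x, |φ x| ≤ B) (hμ : μ ∈ invariantMeasures X) :
    (pressure X φ : EReal) ≤ freeEnergy φ μ := by
  obtain ⟨hprob, hμX, hinv⟩ := hμ
  obtain ⟨K, hK, hup⟩ := h.upper
  have : Fintype A := Fintype.ofFinite A
  let e := Fintype.equivFin A
  set I := ∫ x, φ x ∂μ with hI
  -- The partition by the first letter: its joins are the partitions into words, where the Gibbs
  -- bound applies.
  let ξ : (ℕ → A) → Fin (Fintype.card A) := fun x => e (x 0)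
  have hξ : Measurable ξ := (Measurable.of_discrete (f := e)).comp (measurable_pi_apply 0)
  have hjoin : ∀ n, joinEntropy shift μ ξ n =
      ∑ w ∈ wordsOfLength (language X) n,
        μ.real (cylinder X w) * -Real.log (μ.real (cylinder X w)) := by
    intro n
    have hZ : Measurable fun (x : ℕ → A) (i : Fin n) => e (x i) :=
      measurable_pi_lambda _ fun i =>
        (Measurable.of_discrete (f := e)).comp (measurable_pi_apply _)
    have h1 := integral_comp_eq_sum (μ := μ) hZ fun s =>
      -Real.log (μ.real {x : ℕ → A | (fun i : Fin n => e (x i)) = s})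
    have h2 : ∀ x : ℕ → A, {y : ℕ → A | (fun i : Fin n => e (y i)) = fun i : Fin n => e (x i)} =
        cylinder Set.univ (initialWord x n) := by
      intro x
      rw [cylinder_univ_initialWord]
      ext y
      simp [funext_iff]
    simp only [h2] at h1
    rw [integral_initialWord hX hμX n fun w => -Real.log (μ.real (cylinder Set.univ w))] at h1
    simp only [measureReal_cylinder_univ hμX] at h1
    rw [h1, joinEntropy]
    refine Finset.sum_congr rfl fun s _ => ?_
    have h3 : {x : ℕ → A | ∀ i : Fin n, ξ (shift^[(i : ℕ)] x) = s i} =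
        {x : ℕ → A | (fun i : Fin n => e (x i)) = s} := by
      ext x
      simp [funext_iff, ξ, shift_iterate_apply]
    rw [h3, Real.negMulLog]
    ring
  have hlow : ∀ ε > 0, ∃ C, ∀ n : ℕ,
      n * (pressure X φ - I) - ε * n - C ≤ joinEntropy shift μ ξ n := by
    intro ε hε
    obtain ⟨C, hC⟩ := sum_le_mul_integral hX hμX hinv hφ hB hε
    refine ⟨C + Real.log K, fun n => ?_⟩
    rw [hjoin n]
    -- The upper Gibbs bound read as `-log μ[w] ≥ n P - φ_n(w) - log K`, averaged over `w`.
    have hterm : ∀ w ∈ wordsOfLength (language X) n,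
        μ.real (cylinder X w) * (n * pressure X φ - Real.log K) -
          μ.real (cylinder X w) * supBirkhoff X φ w ≤
        μ.real (cylinder X w) * -Real.log (μ.real (cylinder X w)) := by
      intro w hw
      obtain ⟨hwL, hwn⟩ := mem_wordsOfLength.1 hw
      rcases (measureReal_nonneg (μ := μ) (s := cylinder X w)).eq_or_lt with h0 | h0
      · rw [← h0]
        simp
      · have h1 := Real.log_le_log h0 (hup w hwL)
        rw [Real.log_mul hK.ne' (Real.exp_pos _).ne', Real.log_exp, hwn] at h1
        rw [← mul_sub]
        exact mul_le_mul_of_nonneg_left (by linarith) h0.le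
    have hsum := Finset.sum_le_sum hterm
    rw [Finset.sum_sub_distrib, ← Finset.sum_mul, sum_measureReal_cylinder hX hμX] at hsum
    have := hC n
    linarith
  have hent : ∀ ε > 0, ((pressure X φ - I - 2 * ε : ℝ) : EReal) ≤ measureEntropy shift μ := by
    intro ε hε
    obtain ⟨C, hC⟩ := hlow ε hε
    have h1 : ((pressure X φ - I - 2 * ε : ℝ) : EReal) ≤
        limsup (fun n : ℕ => ((joinEntropy shift μ ξ n / n : ℝ) : EReal)) atTop := by
      refine le_limsup_of_frequently_le (Eventually.frequently ?_) (by isBoundedDefault)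
      filter_upwards [eventually_gt_atTop 0, (tendsto_natCast_atTop_atTop.const_mul_atTop
        hε).eventually_ge_atTop C] with n hn0 hn
      rw [EReal.coe_le_coe_iff, le_div_iff₀ (by exact_mod_cast hn0)]
      have := hC n
      linarith
    exact h1.trans (le_iSup_of_le (Fintype.card A) (le_iSup_of_le ξ (le_iSup_of_le hξ le_rfl)))
  have key : ∀ ε > 0, ((pressure X φ - 2 * ε : ℝ) : EReal) ≤ freeEnergy φ μ := by
    intro ε hε
    have h1 := add_le_add_left (hent ε hε) (I : EReal)
    rw [← EReal.coe_add] at h1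
    refine le_trans (le_of_eq ?_) h1
    congr 1
    ring
  have hcont : Tendsto (fun ε : ℝ => ((pressure X φ - 2 * ε : ℝ) : EReal)) (𝓝[>] 0)
      (𝓝 ((pressure X φ : ℝ) : EReal)) := by
    have h1 : Continuous fun ε : ℝ => ((pressure X φ - 2 * ε : ℝ) : EReal) :=
      continuous_coe_real_ereal.comp (by fun_prop)
    have h2 := (h1.tendsto 0).mono_left (nhdsWithin_le_nhds (s := Set.Ioi 0))
    simpa using h2
  exact le_of_tendsto hcont (by filter_upwards [self_mem_nhdsWithin] with ε hε using key ε hε)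

lemma IsGibbs.isEquilibriumState (h : IsGibbs X φ μ) (hX : IsSubshift X) (hφ : Continuous φ)
    (hB : ∀ x, |φ x| ≤ B) (hμ : μ ∈ invariantMeasures X) : IsEquilibriumState X φ μ :=
  ⟨hμ, fun _ hν => (freeEnergy_le_pressure hX hφ hB hν).trans
    (h.pressure_le_freeEnergy hX hφ hB hμ)⟩

end VariationalPrinciple

/-! ### Absolute continuity and ergodicity -/

section Uniqueness

variable {A : Type*} [Finite A] [TopologicalSpace A] [DiscreteTopology A] [MeasurableSpace A]
  [BorelSpace A] {X : Set (ℕ → A)} {φ : (ℕ → A) → ℝ} {B : ℝ} {μ ν : Measure (ℕ → A)}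

/-- If the free energy of `ν` is at least the pressure, a set of words that contributes at most
`b exp (n P)` to the partition sum has small `ν`-measure. -/
lemma sum_measureReal_mul_le (hX : IsSubshift X) (hφ : Continuous φ) (hB : ∀ x, |φ x| ≤ B)
    (hν : ν ∈ invariantMeasures X) (hP : (pressure X φ : EReal) ≤ freeEnergy φ ν) {C : ℝ}
    (hC : ∀ n : ℕ, partitionSum X (language X) φ n ≤ C * Real.exp (n * pressure X φ))
    {D : Set (List A)} (hD : D ⊆ language X) {n : ℕ} (hn : 0 < n) {a : ℝ}
    (hb : partitionSum X D φ n ≤ Real.exp (-a) * Real.exp (n * pressure X φ)) :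
    (∑ w ∈ wordsOfLength D n, ν.real (cylinder X w)) * a ≤ C := by
  classical
  have hn' : (0 : ℝ) < n := by exact_mod_cast hn
  have h1 := hP.trans (freeEnergy_le_sum hX hφ hB hν hn)
  have := hν.1
  rw [EReal.coe_le_coe_iff, le_div_iff₀ hn'] at h1
  set P := pressure X φ with hPdef
  -- Gibbs' inequality is applied to the weights `exp (-n P + φ_n(w))`, tilted by `exp a` on `D`.
  -- The tilt gains `a ν(D)`, while the total mass stays at most `C + 1`.
  set r : List A → ℝ := fun w => if w ∈ D then a else 0 with hr
  have hterm : ∀ w ∈ wordsOfLength (language X) n,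
      ν.real (cylinder X w) * (supBirkhoff X φ w - Real.log (ν.real (cylinder X w))) +
        ν.real (cylinder X w) * r w ≤
      ν.real (cylinder X w) * (P * n) +
        (Real.exp (-(P * n)) * (Real.exp (supBirkhoff X φ w) * Real.exp (r w)) -
          ν.real (cylinder X w)) := by
    intro w _
    rcases (measureReal_nonneg (μ := ν) (s := cylinder X w)).eq_or_lt with h0 | h0
    · rw [← h0]
      simp only [zero_mul, sub_zero, zero_add]
      positivity
    · set p := ν.real (cylinder X w)
      set q := Real.exp (-(P * n)) * (Real.exp (supBirkhoff X φ w) * Real.exp (r w)) with hq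
      have hq0 : 0 < q := by positivity
      have h3 : Real.log (q / p) ≤ q / p - 1 := Real.log_le_sub_one_of_pos (by positivity)
      rw [Real.log_div hq0.ne' h0.ne'] at h3
      have hlog : Real.log q = -(P * n) + (supBirkhoff X φ w + r w) := by
        rw [hq, ← Real.exp_add, ← Real.exp_add, Real.log_exp]
      rw [hlog] at h3
      have h5 := mul_le_mul_of_nonneg_left h3 h0.le
      have h4 : p * (q / p - 1) = q - p := by
        field_simp
      rw [h4] at h5
      linarith
  have hsum := Finset.sum_le_sum hterm
  rw [Finset.sum_add_distrib, Finset.sum_add_distrib, Finset.sum_sub_distrib, ← Finset.sum_mul,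
    ← Finset.mul_sum, sum_measureReal_cylinder hX hν.2.1] at hsum
  have hsub : wordsOfLength D n ⊆ wordsOfLength (language X) n := fun w hw => by
    rw [mem_wordsOfLength] at *
    exact ⟨hD hw.1, hw.2⟩
  have hleft : ∑ w ∈ wordsOfLength (language X) n, ν.real (cylinder X w) * r w =
      (∑ w ∈ wordsOfLength D n, ν.real (cylinder X w)) * a := by
    rw [Finset.sum_mul, ← Finset.sum_subset hsub fun w hw hwD => ?_]
    · exact Finset.sum_congr rfl fun w hw => by
        rw [hr]
        simp [(mem_wordsOfLength.1 hw).1]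
    · rw [mem_wordsOfLength] at *
      have : w ∉ D := fun h => hwD ⟨h, hw.2⟩
      simp [hr, this]
  have hright : ∑ w ∈ wordsOfLength (language X) n,
      Real.exp (supBirkhoff X φ w) * Real.exp (r w) ≤
      partitionSum X (language X) φ n + Real.exp a * partitionSum X D φ n := by
    rw [partitionSum_eq_sum, partitionSum_eq_sum, Finset.mul_sum]
    have h6 : ∑ w ∈ wordsOfLength D n, Real.exp a * Real.exp (supBirkhoff X φ w) =
        ∑ w ∈ wordsOfLength (language X) n,
          if w ∈ D then Real.exp a * Real.exp (supBirkhoff X φ w) else 0 := by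
      rw [← Finset.sum_subset hsub fun w hw hwD => ?_]
      · exact Finset.sum_congr rfl fun w hw => by simp [(mem_wordsOfLength.1 hw).1]
      · rw [mem_wordsOfLength] at *
        have : w ∉ D := fun h => hwD ⟨h, hw.2⟩
        simp [this]
    rw [h6, ← Finset.sum_add_distrib]
    refine Finset.sum_le_sum fun w _ => ?_
    simp only [hr]
    split_ifs
    · rw [mul_comm]
      exact le_add_of_nonneg_left (Real.exp_pos _).le
    · simp
  have hbound : Real.exp (-(P * n)) * (∑ w ∈ wordsOfLength (language X) n,
      Real.exp (supBirkhoff X φ w) * Real.exp (r w)) ≤ C + 1 := by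
    have h7 : partitionSum X (language X) φ n + Real.exp a * partitionSum X D φ n ≤
        C * Real.exp (n * P) + Real.exp (n * P) := by
      refine add_le_add (hC n) ((mul_le_mul_of_nonneg_left hb (Real.exp_pos a).le).trans_eq ?_)
      rw [← mul_assoc, ← Real.exp_add, add_neg_cancel, Real.exp_zero, one_mul]
    refine (mul_le_mul_of_nonneg_left (hright.trans h7) (Real.exp_pos _).le).trans_eq ?_
    have h8 : Real.exp (-(P * n)) * Real.exp (n * P) = 1 := by
      rw [← Real.exp_add, mul_comm P, neg_add_cancel, Real.exp_zero]
    rw [mul_add, mul_left_comm, h8, mul_one]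
  rw [hleft] at hsum
  linarith

/-- An equilibrium state is absolutely continuous with respect to a Gibbs measure. -/
lemma IsGibbs.absolutelyContinuous (h : IsGibbs X φ μ) (hX : IsSubshift X) (hφ : Continuous φ)
    (hB : ∀ x, |φ x| ≤ B)
    (hC : ∃ C > 0, ∀ n : ℕ, partitionSum X (language X) φ n ≤ C * Real.exp (n * pressure X φ))
    (hbad : ∀ η > 0, ∃ V, ∀ n : ℕ,
      partitionSum X (language X \ boundedVariationWords X φ V) φ n ≤
        η * Real.exp (n * pressure X φ))
    (hμ : μ ∈ invariantMeasures X) (hν : ν ∈ invariantMeasures X)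
    (hP : (pressure X φ : EReal) ≤ freeEnergy φ ν) : ν ≪ μ := by
  classical
  obtain ⟨C, hC0, hC⟩ := hC
  have := hμ.1
  have := hν.1
  have key : ∀ ε > 0, ∃ δ > 0, ∀ n : ℕ, 0 < n → ∀ D : Set (List A),
      μ.real {x | initialWord x n ∈ D} < δ → ν.real {x | initialWord x n ∈ D} < ε := by
    intro ε hε
    -- With this `a`, the entropy estimate gives less than `ε / 2` twice: for the words of `D` of
    -- variation at most `V` and for the others.
    set a := 2 * C / ε + 1 with ha
    have ha0 : 0 < a := by positivity
    obtain ⟨V, hV⟩ := hbad (Real.exp (-a)) (Real.exp_pos _)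
    obtain ⟨K, hK, hlow⟩ := h.lower V
    have hsmall : ∀ {s : ℝ}, s * a ≤ C → s < ε / 2 := by
      intro s hs
      by_contra! hcon
      have h1 := mul_le_mul_of_nonneg_right hcon ha0.le
      have h2 : ε / 2 * a = C + ε / 2 := by
        rw [ha]
        field_simp
      linarith
    refine ⟨K * Real.exp (-a), by positivity, fun n hn D hD => ?_⟩
    rw [measureReal_initialWord_mem hX hμ.2.1] at hD
    rw [measureReal_initialWord_mem hX hν.2.1]
    -- The lower Gibbs bound turns small `μ`-measure into a small partition sum.
    have hgood : partitionSum X (D ∩ boundedVariationWords X φ V) φ n ≤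
        Real.exp (-a) * Real.exp (n * pressure X φ) := by
      have h1 : K * Real.exp (-(n * pressure X φ)) *
          partitionSum X (D ∩ boundedVariationWords X φ V) φ n ≤
          ∑ w ∈ wordsOfLength (language X ∩ D) n, μ.real (cylinder X w) := by
        rw [partitionSum_eq_sum, Finset.mul_sum]
        refine sum_le_sum_of_injOn id (fun w hw => ?_) Function.injective_id.injOn
          (fun w hw => ?_) fun _ _ => measureReal_nonneg
        · rw [id, mem_wordsOfLength] at *
          exact ⟨⟨hw.1.2.1, hw.1.1⟩, hw.2⟩
        · rw [mem_wordsOfLength] at hw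
          refine le_trans (le_of_eq ?_) (hlow w hw.1.2)
          rw [mul_assoc, ← Real.exp_add, hw.2]
          ring_nf
      have h2 := (h1.trans hD.le)
      rw [mul_assoc, mul_le_mul_iff_right₀ hK, Real.exp_neg, inv_mul_le_iff₀ (Real.exp_pos _)] at h2
      rwa [mul_comm]
    have hbad' : partitionSum X (D ∩ (language X \ boundedVariationWords X φ V)) φ n ≤
        Real.exp (-a) * Real.exp (n * pressure X φ) :=
      (partitionSum_mono Set.inter_subset_right n).trans (hV n)
    have h1 := hsmall (sum_measureReal_mul_le hX hφ hB hν hP hC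
      (fun w hw => hw.2.1) hn hgood)
    have h2 := hsmall (sum_measureReal_mul_le hX hφ hB hν hP hC
      (fun w hw => hw.2.1) hn hbad')
    have h3 : ∑ w ∈ wordsOfLength (language X ∩ D) n, ν.real (cylinder X w) ≤
        ∑ w ∈ wordsOfLength (D ∩ boundedVariationWords X φ V) n, ν.real (cylinder X w) +
        ∑ w ∈ wordsOfLength (D ∩ (language X \ boundedVariationWords X φ V)) n,
          ν.real (cylinder X w) := by
      rw [← Finset.sum_union_inter]
      refine le_add_of_le_of_nonneg (Finset.sum_le_sum_of_subset_of_nonneg (fun w hw => ?_)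
        fun _ _ _ => measureReal_nonneg) (Finset.sum_nonneg fun _ _ => measureReal_nonneg)
      simp only [Finset.mem_union, mem_wordsOfLength, Set.mem_inter_iff, Set.mem_sdiff] at hw ⊢
      tauto
    linarith
  refine Measure.AbsolutelyContinuous.mk fun E hE hE0 => ?_
  rw [← measureReal_eq_zero_iff (measure_ne_top _ _)]
  refine le_antisymm (le_of_forall_pos_le_add fun ε hε => ?_) measureReal_nonneg
  obtain ⟨δ, hδ, hkey⟩ := key (ε / 2) (half_pos hε)
  -- Approximation with respect to `μ + ν` makes one set of words serve both measures.
  obtain ⟨n, hn, D, hD⟩ := exists_initialWord_mem_approx (μ + ν) hE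
    (show 0 < min δ (ε / 2) from lt_min hδ (half_pos hε))
  rw [measureReal_add_apply] at hD
  set T := {x : ℕ → A | initialWord x n ∈ D} with hT
  have h0 : μ.real E = 0 := (measureReal_eq_zero_iff (measure_ne_top _ _)).2 hE0
  have hsub1 : T ⊆ E ∪ symmDiff E T := fun x hx => by
    by_cases hxE : x ∈ E
    · exact Or.inl hxE
    · exact Or.inr (Or.inr ⟨hx, hxE⟩)
  have hsub2 : E ⊆ T ∪ symmDiff E T := fun x hx => by
    by_cases hxT : x ∈ T
    · exact Or.inl hxT
    · exact Or.inr (Or.inl ⟨hx, hxT⟩)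
  have h1 : μ.real T ≤ μ.real E + μ.real (symmDiff E T) :=
    (measureReal_mono hsub1).trans (measureReal_union_le _ _)
  have h2 : ν.real E ≤ ν.real T + ν.real (symmDiff E T) :=
    (measureReal_mono hsub2).trans (measureReal_union_le _ _)
  have h3 : 0 ≤ μ.real (symmDiff E T) := measureReal_nonneg
  have h4 : 0 ≤ ν.real (symmDiff E T) := measureReal_nonneg
  have h5 := hkey n hn D (show μ.real T < δ by linarith [min_le_left δ (ε / 2)])
  have h6 : ν.real T < ε / 2 := h5
  linarith [min_le_right δ (ε / 2)]

/-- A lower bound for the measure of the points that see a word of `D₁` and, after a gap of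
length `t`, a word of `D₂`. -/
lemma IsGibbs.exists_mul_le (h : IsGibbs X φ μ) (hX : IsSubshift X) (hB : ∀ x, |φ x| ≤ B) {t : ℕ}
    (hspec : SpecificationOn X (language X) t) (hμ : μ ∈ invariantMeasures X) (V : ℝ) :
    ∃ c > 0, ∀ (n : ℕ) (D₁ D₂ : Set (List A)),
      c * μ.real {x | initialWord x n ∈ D₁ ∩ boundedVariationWords X φ V} *
          μ.real {x | initialWord x n ∈ D₂ ∩ boundedVariationWords X φ V} ≤
        μ.real {x | initialWord x n ∈ D₁ ∧ initialWord (shift^[n + t] x) n ∈ D₂} := by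
  classical
  have := hμ.1
  obtain ⟨K, hK, hup⟩ := h.upper
  obtain ⟨K', hK', hlow⟩ := h.lower (V + 2 * (t * B) + V)
  set P := pressure X φ with hP
  -- The loss in the exponent: `V + V + t B` from gluing, `t P` from the extra length of the gap.
  set M := V + V + t * B + t * P with hM
  refine ⟨K' * Real.exp (-M) / K ^ 2, by positivity, fun n D₁ D₂ => ?_⟩
  have hset : {x : ℕ → A | initialWord x n ∈ D₁ ∧ initialWord (shift^[n + t] x) n ∈ D₂} =
      {x | initialWord x (n + t + n) ∈ {z | z.take n ∈ D₁ ∧ z.drop (n + t) ∈ D₂}} := by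
    ext x
    have h1 : (initialWord x (n + t + n)).take n = initialWord x n := by
      rw [add_assoc, initialWord_add, List.take_left' (by simp)]
    have h2 : (initialWord x (n + t + n)).drop (n + t) = initialWord (shift^[n + t] x) n := by
      rw [initialWord_add, List.drop_left' (by simp)]
    simp only [Set.mem_ofPred_eq, h1, h2]
  have hglue : ∀ p : List A × List A, ∃ v : List A, p.1 ∈ language X → p.2 ∈ language X →
      v.length = t ∧ p.1 ++ v ++ p.2 ∈ language X := by
    intro p
    by_cases hp : p.1 ∈ language X ∧ p.2 ∈ language X
    · obtain ⟨v, hv⟩ := hspec.pair hp.1 hp.2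
      exact ⟨v, fun _ _ => hv⟩
    · exact ⟨[], fun h1 h2 => absurd ⟨h1, h2⟩ hp⟩
  choose v hv using hglue
  rw [hset, measureReal_initialWord_mem hX hμ.2.1, measureReal_initialWord_mem hX hμ.2.1,
    measureReal_initialWord_mem hX hμ.2.1, mul_assoc, Finset.sum_mul_sum, ← Finset.sum_product',
    Finset.mul_sum]
  have hmem : ∀ p ∈ wordsOfLength (language X ∩ (D₁ ∩ boundedVariationWords X φ V)) n ×ˢ
      wordsOfLength (language X ∩ (D₂ ∩ boundedVariationWords X φ V)) n,
      p.1 ∈ D₁ ∧ p.1 ∈ boundedVariationWords X φ V ∧ p.1.length = n ∧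
      p.2 ∈ D₂ ∧ p.2 ∈ boundedVariationWords X φ V ∧ p.2.length = n := by
    intro p hp
    simp only [Finset.mem_product, mem_wordsOfLength] at hp
    exact ⟨hp.1.1.2.1, hp.1.1.2.2, hp.1.2, hp.2.1.2.1, hp.2.1.2.2, hp.2.2⟩
  refine sum_le_sum_of_injOn (fun p => p.1 ++ v p ++ p.2) ?_ ?_ ?_ fun _ _ => measureReal_nonneg
  · intro p hp
    obtain ⟨h1, h2, h3, h4, h5, h6⟩ := hmem p hp
    obtain ⟨h7, h8⟩ := hv p h2.1 h5.1
    rw [mem_wordsOfLength]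
    refine ⟨⟨h8, ?_, ?_⟩, by simp [h3, h6, h7]; omega⟩
    · rwa [List.append_assoc, List.take_left' h3]
    · rwa [List.drop_left' (by simp [h3, h7])]
  · intro p hp q hq heq
    obtain ⟨h1, h2, h3, h4, h5, h6⟩ := hmem p hp
    obtain ⟨h1', h2', h3', h4', h5', h6'⟩ := hmem q hq
    simp only [List.append_assoc] at heq
    have h7 := List.append_inj heq (by rw [h3, h3'])
    have h8 := List.append_inj h7.2 (by rw [(hv p h2.1 h5.1).1, (hv q h2'.1 h5'.1).1])
    exact Prod.ext h7.1 h8.2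
  · intro p hp
    obtain ⟨h1, h2, h3, h4, h5, h6⟩ := hmem p hp
    obtain ⟨h7, h8⟩ := hv p h2.1 h5.1
    have hvL : v p ∈ language X := hX.mem_language_right (mem_language_left h8)
    have hz : p.1 ++ v p ++ p.2 ∈ boundedVariationWords X φ (V + 2 * (t * B) + V) :=
      append_mem_boundedVariationWords hX (append_mem_boundedVariationWords hX h2
        (mem_boundedVariationWords_of_length_le hB hvL h7.le) (mem_language_left h8)) h5 h8
    refine le_trans ?_ (hlow _ hz)
    have h9 := le_supBirkhoff_append hX hB h2 h5 h8
    have h10 := mul_le_mul (hup _ h2.1) (hup _ h5.1) measureReal_nonneg (by positivity)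
    refine (mul_le_mul_of_nonneg_left h10 (by positivity)).trans ?_
    have h11 : K' * Real.exp (-M) / K ^ 2 *
        (K * Real.exp (supBirkhoff X φ p.1 - p.1.length * P) *
          (K * Real.exp (supBirkhoff X φ p.2 - p.2.length * P))) =
        K' * (Real.exp (-M) * (Real.exp (supBirkhoff X φ p.1 - p.1.length * P) *
          Real.exp (supBirkhoff X φ p.2 - p.2.length * P))) := by
      field_simp
    rw [h11, ← Real.exp_add, ← Real.exp_add]
    refine mul_le_mul_of_nonneg_left (Real.exp_le_exp.2 ?_) hK'.le
    rw [h7] at h9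
    simp only [List.length_append, h3, h6, h7]
    push_cast
    rw [hM]
    linarith

/-- By the upper Gibbs bound, words of large variation have measure at most `K` times their
proportion in the partition sum. -/
lemma IsGibbs.exists_measureReal_le (h : IsGibbs X φ μ) (hX : IsSubshift X)
    (hbad : ∀ η > 0, ∃ V, ∀ n : ℕ,
      partitionSum X (language X \ boundedVariationWords X φ V) φ n ≤
        η * Real.exp (n * pressure X φ))
    (hμ : μ ∈ invariantMeasures X) {η : ℝ} (hη : 0 < η) :
    ∃ V, ∀ (n : ℕ) (D : Set (List A)), μ.real {x | initialWord x n ∈ D} ≤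
      μ.real {x | initialWord x n ∈ D ∩ boundedVariationWords X φ V} + η := by
  classical
  have := hμ.1
  obtain ⟨K, hK, hup⟩ := h.upper
  obtain ⟨V, hV⟩ := hbad (η / K) (by positivity)
  refine ⟨V, fun n D => ?_⟩
  have h1 : μ.real {x | initialWord x n ∈ language X \ boundedVariationWords X φ V} ≤ η := by
    rw [measureReal_initialWord_mem hX hμ.2.1]
    have h2 : ∑ w ∈ wordsOfLength (language X ∩ (language X \ boundedVariationWords X φ V)) n,
        μ.real (cylinder X w) ≤ K * Real.exp (-(n * pressure X φ)) *
          partitionSum X (language X \ boundedVariationWords X φ V) φ n := by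
      rw [partitionSum_eq_sum, Finset.mul_sum]
      refine sum_le_sum_of_injOn id (fun w hw => ?_) Function.injective_id.injOn
        (fun w hw => ?_) fun _ _ => by positivity
      · rw [id, mem_wordsOfLength] at *
        exact ⟨hw.1.2, hw.2⟩
      · rw [mem_wordsOfLength] at hw
        refine (hup w hw.1.1).trans (le_of_eq ?_)
        rw [mul_assoc, ← Real.exp_add, hw.2, id]
        ring_nf
    refine h2.trans ((mul_le_mul_of_nonneg_left (hV n) (by positivity)).trans_eq ?_)
    have h3 : Real.exp (-(n * pressure X φ)) * Real.exp (n * pressure X φ) = 1 := by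
      rw [← Real.exp_add, neg_add_cancel, Real.exp_zero]
    calc _ = K * (η / K) * (Real.exp (-(n * pressure X φ)) * Real.exp (n * pressure X φ)) := by
          ring
      _ = η := by rw [h3, mul_one, mul_div_cancel₀ _ hK.ne']
  have hsub : {x | initialWord x n ∈ D} ⊆
      ({x | initialWord x n ∈ D ∩ boundedVariationWords X φ V} ∪
        {x | initialWord x n ∈ language X \ boundedVariationWords X φ V}) ∪ Xᶜ := by
    intro x hx
    by_cases hxX : x ∈ X
    · left
      by_cases hxV : initialWord x n ∈ boundedVariationWords X φ V
      · exact Or.inl ⟨hx, hxV⟩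
      · exact Or.inr ⟨initialWord_mem_language hxX n, hxV⟩
    · exact Or.inr hxX
  have h0 : μ.real Xᶜ = 0 := (measureReal_eq_zero_iff (measure_ne_top _ _)).2 hμ.2.1
  have h4 := (measureReal_mono (μ := μ) hsub).trans (measureReal_union_le _ _)
  have h5 := measureReal_union_le (μ := μ)
    {x | initialWord x n ∈ D ∩ boundedVariationWords X φ V}
    {x | initialWord x n ∈ language X \ boundedVariationWords X φ V}
  linarith

/-- Gibbs measures are ergodic. -/
lemma IsGibbs.ergodic (h : IsGibbs X φ μ) (hX : IsSubshift X) (hB : ∀ x, |φ x| ≤ B) {t : ℕ}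
    (hspec : SpecificationOn X (language X) t)
    (hbad : ∀ η > 0, ∃ V, ∀ n : ℕ,
      partitionSum X (language X \ boundedVariationWords X φ V) φ n ≤
        η * Real.exp (n * pressure X φ))
    (hμ : μ ∈ invariantMeasures X) : Ergodic shift μ := by
  have := hμ.1
  refine ⟨hμ.2.2, ⟨fun E hE hinv => ?_⟩⟩
  by_contra hcon
  have hα : 0 < μ.real E := by
    refine measureReal_nonneg.lt_of_ne fun h0 => hcon ?_
    have h1 : μ E = 0 := (measureReal_eq_zero_iff (measure_ne_top _ _)).1 h0.symm
    rw [eventuallyConst_set']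
    exact Or.inl (ae_eq_empty.2 h1)
  have hβ : 0 < μ.real Eᶜ := by
    refine measureReal_nonneg.lt_of_ne fun h0 => hcon ?_
    have h1 : μ Eᶜ = 0 := (measureReal_eq_zero_iff (measure_ne_top _ _)).1 h0.symm
    rw [eventuallyConst_set']
    exact Or.inr (ae_eq_univ.2 h1)
  set α := μ.real E with hαdef
  set β := μ.real Eᶜ with hβdef
  set γ := min α β with hγ
  have hγ0 : 0 < γ := lt_min hα hβ
  obtain ⟨V, hV⟩ := h.exists_measureReal_le hX hbad hμ (show 0 < γ / 4 by positivity)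
  obtain ⟨c, hc, hmix⟩ := h.exists_mul_le hX hB hspec hμ V
  -- The first bound leaves measure `γ / 2` on both sides once words of large variation are
  -- discarded; the second makes `2ε` smaller than the lower bound from gluing.
  set ε := min (γ / 4) (c * (γ / 2) * (γ / 2) / 4) with hε
  have hε0 : 0 < ε := lt_min (by positivity) (by positivity)
  obtain ⟨n, -, D, hD⟩ := exists_initialWord_mem_approx μ hE hε0
  set T := {x : ℕ → A | initialWord x n ∈ D} with hT
  have hTc : Tᶜ = {x : ℕ → A | initialWord x n ∈ Dᶜ} := rfl
  have hsub1 : E ⊆ T ∪ symmDiff E T := fun x hx => by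
    by_cases hxT : x ∈ T
    · exact Or.inl hxT
    · exact Or.inr (Or.inl ⟨hx, hxT⟩)
  have hsub2 : Eᶜ ⊆ Tᶜ ∪ symmDiff E T := fun x hx => by
    by_cases hxT : x ∈ T
    · exact Or.inr (Or.inr ⟨hxT, hx⟩)
    · exact Or.inl hxT
  have h1 : α ≤ μ.real T + μ.real (symmDiff E T) :=
    (measureReal_mono hsub1).trans (measureReal_union_le _ _)
  have h2 : β ≤ μ.real Tᶜ + μ.real (symmDiff E T) :=
    (measureReal_mono hsub2).trans (measureReal_union_le _ _)
  have h3 := hV n D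
  have h4 := hV n Dᶜ
  rw [← hTc] at h4
  have h5 := hmix n D Dᶜ
  have hεγ : ε ≤ γ / 4 := min_le_left _ _
  have h6 : γ / 2 ≤ μ.real {x | initialWord x n ∈ D ∩ boundedVariationWords X φ V} := by
    linarith [min_le_left α β]
  have h7 : γ / 2 ≤ μ.real {x | initialWord x n ∈ Dᶜ ∩ boundedVariationWords X φ V} := by
    linarith [min_le_right α β]
  have hEit : ∀ k x, shift^[k] x ∈ E ↔ x ∈ E := by
    intro k x
    have hk : shift^[k] ⁻¹' E = E := by
      induction k with
      | zero => simp
      | succ k ih => rw [Function.iterate_succ, Set.preimage_comp, ih, hinv]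
    exact Set.ext_iff.1 hk x
  -- As `E` is invariant, a point that passes from `T` to its complement lies in the error set at
  -- one of the two times.
  have hsub3 : {x : ℕ → A | initialWord x n ∈ D ∧ initialWord (shift^[n + t] x) n ∈ Dᶜ} ⊆
      symmDiff E T ∪ shift^[n + t] ⁻¹' symmDiff E T := by
    rintro x ⟨hx1, hx2⟩
    by_cases hxE : x ∈ E
    · exact Or.inr (Or.inl ⟨(hEit _ x).2 hxE, hx2⟩)
    · exact Or.inl (Or.inr ⟨hx1, hxE⟩)
  have hmeas : MeasurableSet (symmDiff E T) := hE.symmDiff (measurableSet_initialWord_mem n D)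
  have h8 : μ.real (shift^[n + t] ⁻¹' symmDiff E T) = μ.real (symmDiff E T) := by
    rw [measureReal_def, (hμ.2.2.iterate (n + t)).measure_preimage hmeas.nullMeasurableSet,
      measureReal_def]
  have h9 := (measureReal_mono (μ := μ) hsub3).trans (measureReal_union_le _ _)
  rw [h8] at h9
  have h10 : c * (γ / 2) * (γ / 2) ≤
      c * μ.real {x | initialWord x n ∈ D ∩ boundedVariationWords X φ V} *
          μ.real {x | initialWord x n ∈ Dᶜ ∩ boundedVariationWords X φ V} :=
    mul_le_mul (mul_le_mul_of_nonneg_left h6 hc.le) h7 (by positivity)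
      (mul_nonneg hc.le measureReal_nonneg)
  have h11 : ε ≤ c * (γ / 2) * (γ / 2) / 4 := min_le_right _ _
  have h12 : 0 < c * (γ / 2) * (γ / 2) := by positivity
  linarith

end Uniqueness

/-! ### Dependence on the potential only through its values on `X` -/

section Extension

variable {A : Type*} [TopologicalSpace A] {X : Set (ℕ → A)}
  {φ ψ : (ℕ → A) → ℝ}

/-- Tietze's theorem; it allows all estimates to be made for a bounded continuous potential on the
full shift. -/
lemma IsSubshift.exists_continuous_extension [Finite A] [DiscreteTopology A] (hX : IsSubshift X)
    {f : (ℕ → A) → ℝ} (hf : ContinuousOn f X) :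
    ∃ g : (ℕ → A) → ℝ, Continuous g ∧ ∀ x ∈ X, f x = g x := by
  obtain ⟨g, hg⟩ := ContinuousMap.exists_restrict_eq hX.isClosed
    (⟨X.domRestrict f, continuousOn_iff_continuous_domRestrict.1 hf⟩ : C(X, ℝ))
  refine ⟨g, g.continuous, fun x hx => ?_⟩
  have := congrArg (fun h : C(X, ℝ) => h ⟨x, hx⟩) hg
  exact this.symm

lemma birkhoffSum_congr (hX : IsSubshift X) (h : ∀ x ∈ X, φ x = ψ x) (n : ℕ) {x : ℕ → A}
    (hx : x ∈ X) : birkhoffSum shift φ n x = birkhoffSum shift ψ n x :=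
  Finset.sum_congr rfl fun k _ => h _ (hX.iterate_mem hx k)

lemma supBirkhoff_congr (hX : IsSubshift X) (h : ∀ x ∈ X, φ x = ψ x) :
    supBirkhoff X φ = supBirkhoff X ψ := by
  funext w
  rw [supBirkhoff, supBirkhoff, Set.image_congr fun x hx => birkhoffSum_congr hX h _ hx.1]

lemma pressure_congr (hX : IsSubshift X) (h : ∀ x ∈ X, φ x = ψ x) :
    pressure X φ = pressure X ψ := by
  simp only [pressure, partitionSum, supBirkhoff_congr hX h]

variable [MeasurableSpace A]

lemma periodicMeasure_congr (hX : IsSubshift X) (h : ∀ x ∈ X, φ x = ψ x) :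
    periodicMeasure X φ = periodicMeasure X ψ := by
  funext n
  have h1 : ∀ x : periodicPoints X n,
      birkhoffSum shift φ n (x : ℕ → A) = birkhoffSum shift ψ n x := fun x =>
    birkhoffSum_congr hX h n x.2.1
  simp only [periodicMeasure, h1]

end Extension

section Congruence

variable {A : Type*} [MeasurableSpace A] {X : Set (ℕ → A)} {φ ψ : (ℕ → A) → ℝ}

lemma integral_congr_of_measure_compl {μ : Measure (ℕ → A)} (hμ : μ Xᶜ = 0)
    (h : ∀ x ∈ X, φ x = ψ x) : ∫ x, φ x ∂μ = ∫ x, ψ x ∂μ := by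
  have hx : ∀ᵐ x ∂μ, x ∈ X := hμ
  exact integral_congr_ae (by filter_upwards [hx] with x hx using h x hx)

lemma isEquilibriumState_congr (h : ∀ x ∈ X, φ x = ψ x) {μ : Measure (ℕ → A)} :
    IsEquilibriumState X φ μ ↔ IsEquilibriumState X ψ μ := by
  have h1 : ∀ ν ∈ invariantMeasures X, freeEnergy φ ν = freeEnergy ψ ν := fun ν hν => by
    rw [freeEnergy, freeEnergy, integral_congr_of_measure_compl hν.2.1 h]
  refine and_congr_right fun hμ => forall₂_congr fun ν hν => ?_
  rw [h1 ν hν, h1 μ hμ]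

end Congruence

/-- The weak Gibbs property with respect to `𝓖^ℓ` and `𝓒^{s,ℓ}`. -/
lemma IsGibbs.isWeakGibbs {A : Type*} [TopologicalSpace A] [MeasurableSpace A]
    {X Y : Set (ℕ → A)} {φ : (ℕ → A) → ℝ} {B : ℝ} {μ : Measure (ℕ → A)}
    (h : IsGibbs X φ μ) (hX : IsSubshift X) (hB : ∀ x, |φ x| ≤ B) {l : ℕ} {V : ℝ}
    (hV : goodWords X Y l ⊆ boundedVariationWords X φ V) :
    IsWeakGibbs X φ {[]} (goodWords X Y l) (suffixWords X Y l) μ := by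
  obtain ⟨K', hK', hup⟩ := h.upper
  refine ⟨K', hK', fun M => ?_⟩
  obtain ⟨K, hK, hlow⟩ := h.lower (V + 2 * (M * B))
  refine ⟨K, hK, fun w hw => ?_⟩
  obtain ⟨hwL, u, hu, v, hv, z, hz, -, hzM, heq⟩ := hw
  rw [Set.mem_singleton_iff] at hu
  rw [hu, List.nil_append] at heq
  have hwV : w ∈ boundedVariationWords X φ (V + 2 * (M * B)) := by
    rw [heq] at hwL ⊢
    exact append_mem_boundedVariationWords hX (hV hv)
      (mem_boundedVariationWords_of_length_le hB hz.1 hzM) hwL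
  have he : -(w.length * pressure X φ) + supBirkhoff X φ w =
      supBirkhoff X φ w - w.length * pressure X φ := by ring
  rw [he, le_div_iff₀ (Real.exp_pos _), div_le_iff₀ (Real.exp_pos _)]
  exact ⟨hlow w hwV, hup w hwL⟩

end SymbolicDynamics

/-! ### The theorem -/

theorem mainTheorem5 {A : Type*} [Finite A] [TopologicalSpace A] [DiscreteTopology A]
    [MeasurableSpace A] [BorelSpace A] (X Y : Set (ℕ → A))
    (hX : IsSubshift X) (hspec : HasSpecification X)
    (hY : IsSubshift Y) (hYX : Y ⊆ X)
    (φ : (ℕ → A) → ℝ) (hφ : IsBowenPlusGrid X Y φ)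
    (hP : pressure Y φ < pressure X φ) :
    ∃ μ : Measure (ℕ → A),
      IsEquilibriumState X φ μ ∧
      (∀ ν : Measure (ℕ → A), IsEquilibriumState X φ ν → ν = μ) ∧
      (∀ l : ℕ, IsDecomposition X {[]} (goodWords X Y l) (suffixWords X Y l) ∧
        IsWeakGibbs X φ {[]} (goodWords X Y l) (suffixWords X Y l) μ) ∧
      WeakStarTendsto X (periodicMeasure X φ) μ := by
  obtain ⟨φr, φ₀, hφr, ⟨V, hV⟩, hφ₀, hsum⟩ := hφ
  obtain ⟨t, hspec⟩ := hspec
  have hφ₀c := hφ₀.continuousOn hY.nonempty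
  have hφX : ContinuousOn φ X := (hφr.add hφ₀c).congr hsum
  obtain ⟨ψ, hψ, hφψ⟩ := hX.exists_continuous_extension hφX
  obtain ⟨B, hB⟩ := isCompact_univ.exists_bound_of_continuousOn (f := ψ) hψ.continuousOn
  replace hB : ∀ x, |ψ x| ≤ B := fun x => hB x (Set.mem_univ x)
  obtain ⟨B₀, hB₀⟩ := hX.isClosed.isCompact.exists_bound_of_continuousOn hφ₀c
  have hgood : ∀ l, ∃ V, goodWords X Y l ⊆ boundedVariationWords X ψ V := fun l =>
    ⟨_, goodWords_subset_boundedVariationWords hX hY hV hB₀ hφ₀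
      (fun x hx => (hφψ x hx).symm.trans (hsum x hx)) l⟩
  rw [pressure_congr hY fun x hx => hφψ x (hYX hx), pressure_congr hX hφψ] at hP
  obtain ⟨hC, hbad⟩ := exists_partitionSum_le hX hspec hY hYX hψ hB hP hgood
  have hlimit := exists_tendsto_periodicMeasure hX hspec hB hC hbad
  obtain ⟨μ, hμ, hGibbs, -⟩ := hlimit (hyperfilter ℕ) Nat.hyperfilter_le_atTop
  have huniq : ∀ ν, IsEquilibriumState X ψ ν → ν = μ := by
    intro ν hν
    have := hμ.1
    have := hν.1.1
    have hP' : (pressure X ψ : EReal) ≤ freeEnergy ψ ν :=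
      (hGibbs.pressure_le_freeEnergy hX hψ hB hμ).trans (hν.2 μ hμ)
    -- An invariant probability measure absolutely continuous with respect to an ergodic one is
    -- equal to it.
    exact (hGibbs.ergodic hX hB hspec hbad hμ).eq_of_absolutelyContinuous hν.1.2.2
      (hGibbs.absolutelyContinuous hX hψ hB hC hbad hμ hν.1 hP')
  refine ⟨μ, (isEquilibriumState_congr hφψ).2 (hGibbs.isEquilibriumState hX hψ hB hμ),
    fun ν hν => huniq ν ((isEquilibriumState_congr hφψ).1 hν),
    fun l => ⟨isDecomposition_goodWords hX hY l, ?_⟩, fun f hf => ?_⟩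
  -- Bounded variation of good words holds for every `ℓ`, although the counting estimates use only
  -- one.
  · obtain ⟨W, hW⟩ := hgood l
    have := hGibbs.isWeakGibbs hX hB hW
    rwa [IsWeakGibbs, ← pressure_congr hX hφψ, ← supBirkhoff_congr hX hφψ] at this
  · rw [periodicMeasure_congr hX hφψ]
    obtain ⟨g, hg, hfg⟩ := hX.exists_continuous_extension hf
    rw [integral_congr_of_measure_compl hμ.2.1 hfg]
    have hev : (fun n => ∫ x, g x ∂(periodicMeasure X ψ n)) =ᶠ[atTop]
        fun n => ∫ x, f x ∂(periodicMeasure X ψ n) := by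
      -- Every point of `X` is fixed by the zeroth iterate, so `n = 0` is left out.
      filter_upwards [eventually_gt_atTop 0] with n hn
      exact (integral_congr_of_measure_compl (periodicMeasure_compl hX hn) hfg).symm
    refine Tendsto.congr' hev ?_
    -- Along each ultrafilter there is a limit measure; it is Gibbs, hence an equilibrium state,
    -- hence `μ`.
    rw [tendsto_iff_ultrafilter]
    intro U hU
    obtain ⟨ν, hν, hνG, hlim⟩ := hlimit U hU
    rw [← huniq ν (hνG.isEquilibriumState hX hψ hB hν)]
    exact hlim g hg
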